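/- **Setting.** *Game.* Let $N\ge 1$, $m,p\ge 0$, $N'=N+m$. The legitimate players are $\mathcal L=\{1,\dots,N\}$ and the malicious ones are $\mathcal M=\{N+1,\dots,N'\}$. Each $i\in\mathcal L$ has a nonempty convex compact strategy set $\Omega_i\subset\mathbb R^p$, a map $\phi_i$ and a cost $f_i(x_i,s)$, where $\phi_i$ and $f_i$ are continuously differentiable on open neighbourhoods of $\Omega_i$ and $\Omega_i\times\mathbb R$. Put $\Omega=\prod_i\Omega_i$ and $\sigma(x)=\sum_{i=1}^N\phi_i(x_i)$. For each $i$ the cost $f_i(x_i,\sigma(x))$ is convex in $x_i\in\Omega_i$ when the other strategies are fixed. Let $$G_i(x_i,s)=\partial_1 f_i(x_i,s)+\partial_2 f_i(x_i,s)\nabla\phi_i(x_i),$$ the gradient of $f_i(x_i,\sigma(x))$ in $x_i$ at aggregate value $s$. Put $G(x,s)=(G_i(x_i,s_i))_i$ for $s\in\mathbb R^N$, and $G(x)=G(x,\sigma(x)1_N)$. Assume that there are $\mu,L_2,L_3>0$ such that for all $x,x'\in\Omega$, $s,s'\in\mathbb R^N$, $i\in\mathcal L$ and $y,z\in\Omega_i$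 $$\langle G(x)-G(x'),x-x'\rangle\ge\mu\|x-x'\|^2,\quad \|G(x,s)-G(x,s')\|\le L_2\|s-s'\|,\quad |\phi_i(y)-\phi_i(z)|\le L_3\|y-z\|.$$ Let $x^*\in\Omega$ be the Nash equilibrium: $f_i(x_i^*,\sigma(x^*))\le f_i(y,\sum_{j\ne i}\phi_j(x_j^*)+\phi_i(y))$ for all $i\in\mathcal L$, $y\in\Omega_i$. *Network.* A fixed digraph on $\{1,\dots,N'\}$ is given whose sub-digraph induced by $\mathcal L$ is strongly connected. $\mathcal N_i$ denotes the set of in-neighbours of $i$ together with $i$ itself. Let $A\in\mathbb R^{N\times N}$ be the matrix with $A_{ij}=1/|\mathcal N_i\cap\mathcal L|$ for $j\in\mathcal N_i\cap\mathcal L$ and $A_{ij}=0$ otherwise. Put $V_\infty=\lim_k A^k=1_Nv^T$ and $\hat V_\infty=\mathrm{diag}(v)$, let $[v]_{\min},[v]_{\max}$ be the extreme entries of $v$, and set $\|y\|_{\hat V_\infty}=\sqrt{y^T\hat V_\infty y}$, $\rho_1=\|A-V_\infty\|_{\hat V_\infty}$ (induced norm), $\rho_2=\|I-V_\infty\|$,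 $\rho=\sup_{k\ge0}\|\mathrm{diag}(A^k)^{-1}\|$. *Trust observations.* For $i\in\mathcal L$, $j\in\mathcal N_i$, iterations $k\ge1$ and rounds $0\le l<S_k$ (with integers $S_k\ge1$) there are random variables $\tau_{ij,k,l}\in[0,1]$ with mean $\frac12+E_{ij}$, where $E_{ij}>0$ if $j\in\mathcal L$ and $E_{ij}<0$ if $j\in\mathcal M$. For each pair $(i,j)$ they are independent over $(k,l)$, and identically distributed if $j\in\mathcal M$. Put $E_{\min}=\min\{|E_{ij}|: i\in\mathcal L,\ j\in\mathcal N_i\}$. *Fast algorithm (legitimate players only).* Start from $x_1\in\Omega$, $\sigma_{i,1}=\phi_i(x_{i,1})$, $V_1=I$, and iterate $$V_{k+1}=A^{S_k}V_k,\qquad x_{i,k+1}=P_{\Omega_i}[x_{i,k}-\alpha_kG_i(x_{i,k},\sigma_{i,k})],$$ $$\sigma_{i,k+1}=[A^{S_k}\sigma_k]_i+\frac{\phi_i(x_{i,k+1})}{[V_{k+1}]_{ii}}-\frac{\phi_i(x_{i,k})}{[V_k]_{ii}}.$$ *Resilient algorithm.* Each $i\in\mathcal L$ starts from $x_{i,1}\in\Omega_i$,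 $v_{i,1}=e_i\in\mathbb R^{N'}$, $\sigma_{i,1}=\phi_i(x_{i,1})$, $\beta_{ij,1}=0$, $\iota_{i,1}=0$, $\mathcal A_{i,1}=0\in\mathbb N^{N'}$, $\mathcal N_{i,0}=\mathcal N_i$. At iteration $k=1,2,\dots$ it does the following. 1. It sets $\mathcal N_{i,k}=\{j\in\mathcal N_i:\beta_{ij,k}\ge0\}$ and uses the weights $a_{ij,k}=1/|\mathcal N_{i,k}|$ for $j\in\mathcal N_{i,k}$, and $0$ otherwise. 2. If $\mathcal N_{i,k}\neq\mathcal N_{i,k-1}$ it sets $\iota_{i,k}=N'$. It sets $\mathcal A_{i,k}(i)=k$. Then it takes the maximum of the received values, $\iota_{i,k}\leftarrow\max_{j\in\mathcal N_{i,k}}\iota_{j,k}$ and (componentwise) $\mathcal A_{i,k+1}=\max_{j\in\mathcal N_{i,k}}\mathcal A_{j,k}$. It lets $i'$ be the position of $i$ in the increasing list of all $j$ with $\mathcal A_{i,k+1}(i)-\mathcal A_{i,k+1}(j)\le N'-1$. 3. With $\sigma_{i,k,0}=\sigma_{i,k}$ and $v_{i,k,0}=v_{i,k}$, it computes for $l=0,\dots,S_k-1$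 the averages $\sigma_{i,k,l+1}=\sum_{j\in\mathcal N_i}a_{ij,k}\sigma_{j,k,l}$ and $v_{i,k,l+1}=\sum_{j\in\mathcal N_i}a_{ij,k}v_{j,k,l}$. 4. It sets $\beta_{ij,k+1}=\beta_{ij,k}+\sum_{l=0}^{S_k-1}(\tau_{ij,k,l}-\frac12)$. 5. If $\iota_{i,k}=0$, it sets $v_{i,k+1}=v_{i,k,S_k}$, $x_{i,k+1}=P_{\Omega_i}[x_{i,k}-\alpha_kG_i(x_{i,k},\sigma_{i,k})]$, $\sigma_{i,k+1}=\sigma_{i,k,S_k}+\phi_i(x_{i,k+1})/[v_{i,k+1}]_{i'}-\phi_i(x_{i,k})/[v_{i,k}]_{i'}$ and $\iota_{i,k+1}=0$. Otherwise it resets $v_{i,k+1}=e_{i'}$, $x_{i,k+1}=x_{i,1}$, $\sigma_{i,k+1}=\sigma_{i,1}$ and sets $\iota_{i,k+1}=\iota_{i,k}-1$. (In iterations before the classification has settled, a quotient with zero denominator and a maximum over the empty set are read as $0$.) Every value that a malicious player sends (aggregate estimates in $\mathbb R$, weight estimates in $\mathbb R^{N'}$, counters in $\mathbb N$, marks in $\mathbb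 N^{N'}$) is an arbitrary random variable, possibly different for different receivers and depending on everything else; only the marks, being iteration stamps, are at most $k$ when sent at iteration $k$. **Theorem.** Let $(x_k)_{k\ge1}$ be the strategies of the legitimate players generated by the resilient algorithm. 1. Let $\alpha_k=\alpha>0$ and $S_k=S\ge1$ for all $k\ge1$, and suppose that the largest eigenvalue $\rho(\Gamma_\alpha)$ of $$\Gamma_\alpha=\begin{bmatrix}1-2\alpha\mu&\alpha L_2/\sqrt{[v]_{\min}}\\ \alpha L_2/\sqrt{[v]_{\min}}&(\rho_1^2)^S\end{bmatrix}$$ is less than $1$. For the fast algorithm with the same $x_1,\alpha,S$ there exist constants $\tilde M$ and $M$ such that for all $k\ge1$ $$\|\sigma_{k+1}-V_\infty\sigma_{k+1}\|_{\hat V_\infty}\le\tilde M,\qquad \|G(x_k,\sigma_k)\|\le M,$$ and for all such $\tilde M,M$ the resilient algorithm satisfies $$\limsup_{k\to\infty}\mathbb E\|x_k-x^*\|^2\le\frac{D_3\,e^{2E_{\min}^2}}{(1-\rho(\Gamma_\alpha))(1-e^{-2E_{\min}^2})},$$ $$D_3=2\rho_1^S\tilde M\sqrt{[v]_{\max}}\,\rho_2\,\rho\,L_3M\alpha+\bigl(2[v]_{\max}\rho_2^2\rho^2L_3^2M^2+4M^2\bigr)\alpha^2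 .$$ 2. Let $\alpha_k=1/(k+1)^r$ with $\frac12<r<1$, and let $S_k\ge\frac{\ln(1/2)}{2\ln\rho_1}$ for all $k\ge1$ (the right-hand side being read as $0$ if $\rho_1=0$). Then $\lim_{k\to\infty}\mathbb E\|x_k-x^*\|^2=0$. In both cases $\|x_k-x^*\|^2$ is integrable for every $k$, and in case 1 the sequence $\mathbb E\|x_k-x^*\|^2$ is bounded. -/

import Mathlib

open MeasureTheory ProbabilityTheory Filter Topology

noncomputable section

namespace AggGame

/-- Strategies of a single player: vectors of dimension `p`, with the Euclidean norm. -/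
abbrev Strat (p : ℕ) := EuclideanSpace ℝ (Fin p)

/-- Stacked strategy profiles of the `N` legitimate players, with the Euclidean norm. -/
abbrev Profile (N p : ℕ) := PiLp 2 (fun _ : Fin N => Strat p)

/-! ### Aggregative games -/

/-- The data of an aggregative game of the legitimate players: strategy sets, cost functions
`f i (x i) s` of the own strategy and of the aggregate, and aggregation maps `φ i`. -/
structure Game (N p : ℕ) where
  Ω : Fin N → Set (Strat p)
  f : Fin N → Strat p → ℝ → ℝ
  φ : Fin N → Strat p → ℝ

variable {N p : ℕ}

/-- `x ∈ Ω = ∏ Ω i`. -/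
def Game.Feasible (g : Game N p) (x : Fin N → Strat p) : Prop := ∀ i, x i ∈ g.Ω i

/-- The aggregate `∑ i, φ i (x i)`. -/
def Game.agg (g : Game N p) (x : Fin N → Strat p) : ℝ := ∑ i, g.φ i (x i)

/-- The aggregate of all players but `i`. -/
def Game.aggOthers (g : Game N p) (x : Fin N → Strat p) (i : Fin N) : ℝ :=
  ∑ j ∈ Finset.univ.erase i, g.φ j (x j)

/-- Nash equilibrium. -/
def Game.IsNash (g : Game N p) (x : Fin N → Strat p) : Prop :=
  g.Feasible x ∧ ∀ i, ∀ y ∈ g.Ω i,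
    g.f i (x i) (g.agg x) ≤ g.f i y (g.aggOthers x i + g.φ i y)

/-- `G i (y, s)`: the gradient of the cost of player `i` in its own strategy at `y`, where the
aggregate has the value `s` and depends on the own strategy through `φ i`
(so it equals `∂₁ f i (y, s) + ∂₂ f i (y, s) • ∇ φ i (y)`). -/
def Game.G (g : Game N p) (i : Fin N) (y : Strat p) (s : ℝ) : Strat p :=
  gradient (fun z => g.f i z s) y + deriv (fun t => g.f i y t) s • gradient (g.φ i) y

/-- The stacked map `G (x, s) = (G i (x i, s i)) i` with one aggregate value per player. -/
def Game.Gvec (g : Game N p) (x : Fin N → Strat p) (s : Fin N → ℝ) : Profile N p :=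
  WithLp.toLp 2 fun i => g.G i (x i) (s i)

/-- The pseudo-gradient `x ↦ (G i (x i, σ(x))) i`. -/
def Game.pseudoGrad (g : Game N p) (x : Fin N → Strat p) : Profile N p :=
  g.Gvec x fun _ => g.agg x

/-- Strategy sets are nonempty, convex and compact; `f i` and `φ i` are continuously
differentiable (on an open neighbourhood of the domain); the cost of player `i` is convex in its
own strategy for all strategies of the others. -/
structure Game.Regular (g : Game N p) : Prop where
  nonempty : ∀ i, (g.Ω i).Nonempty
  convex : ∀ i, Convex ℝ (g.Ω i)
  compact : ∀ i, IsCompact (g.Ω i)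
  smooth : ∀ i, ∃ U : Set (Strat p), IsOpen U ∧ g.Ω i ⊆ U ∧
    ContDiffOn ℝ 1 (fun q : Strat p × ℝ => g.f i q.1 q.2) (U ×ˢ Set.univ) ∧
    ContDiffOn ℝ 1 (g.φ i) U
  cost_convex : ∀ i, ∀ x, g.Feasible x →
    ConvexOn ℝ (g.Ω i) fun y => g.f i y (g.aggOthers x i + g.φ i y)

/-- The pseudo-gradient is `μ`-strongly monotone on `Ω`. -/
def Game.StronglyMonotone (g : Game N p) (μ : ℝ) : Prop :=
  ∀ x y : Profile N p, g.Feasible x → g.Feasible y →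
    μ * ‖x - y‖ ^ 2 ≤ inner ℝ (g.pseudoGrad x - g.pseudoGrad y) (x - y)

/-- `G (x, ·)` is `L₂`-Lipschitz in the vector of aggregate values, and every `φ i` is
`L₃`-Lipschitz on `Ω i`. -/
structure Game.LipschitzConsts (g : Game N p) (L₂ L₃ : ℝ) : Prop where
  grad : ∀ x, g.Feasible x → ∀ s t : EuclideanSpace ℝ (Fin N),
    ‖g.Gvec x s - g.Gvec x t‖ ≤ L₂ * ‖s - t‖
  phi : ∀ i, ∀ y ∈ g.Ω i, ∀ z ∈ g.Ω i, |g.φ i y - g.φ i z| ≤ L₃ * ‖y - z‖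

/-- Euclidean projection onto a nonempty closed convex set: the nearest point. -/
def proj (K : Set (Strat p)) (u : Strat p) : Strat p :=
  Classical.epsilon fun y => y ∈ K ∧ ∀ z ∈ K, ‖u - y‖ ≤ ‖u - z‖

/-! ### The network

There are `N + m` players. The legitimate ones are `Fin.castAdd m i` with `i : Fin N` (the first
`N`), the malicious ones are `Fin.natAdd N j` with `j : Fin m`. `D.Adj j i` means that `i` can
receive information from `j`. -/

variable {m : ℕ}

open Classical in
/-- The in-neighbours of the legitimate player `i`, including `i`. -/
def inNbr (D : Digraph (Fin (N + m))) (i : Fin N) : Finset (Fin (N + m)) :=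
  Finset.univ.filter fun j => D.Adj j (Fin.castAdd m i) ∨ j = Fin.castAdd m i

/-- The sub-digraph induced by the legitimate players is strongly connected. -/
def LegitStronglyConnected (D : Digraph (Fin (N + m))) : Prop :=
  ∀ i j : Fin N,
    Relation.ReflTransGen (fun a b => D.Adj (Fin.castAdd m a) (Fin.castAdd m b)) i j

open Classical in
/-- The legitimate in-neighbours of the legitimate player `i`, including `i`. -/
def legitNbr (D : Digraph (Fin (N + m))) (i : Fin N) : Finset (Fin N) :=
  Finset.univ.filter fun j => Fin.castAdd m j ∈ inNbr D i

open Classical in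
/-- The weight matrix `A` of the sub-digraph induced by the legitimate players. -/
def weightMatrix (D : Digraph (Fin (N + m))) : Matrix (Fin N) (Fin N) ℝ :=
  fun i j => if j ∈ legitNbr D i then 1 / ((legitNbr D i).card : ℝ) else 0

/-- `V_∞ = lim A ^ k`. -/
def Vinf (A : Matrix (Fin N) (Fin N) ℝ) : Matrix (Fin N) (Fin N) ℝ :=
  limUnder atTop fun k : ℕ => A ^ k

/-- The diagonal of `V_∞`, which is the left Perron vector `v` of `A`
(all rows of `V_∞` equal `vᵀ`). -/
def vinf (A : Matrix (Fin N) (Fin N) ℝ) (i : Fin N) : ℝ := Vinf A i i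

/-- The norm `√(yᵀ V̂_∞ y)` with `V̂_∞ = diag V_∞`. -/
def wnorm (A : Matrix (Fin N) (Fin N) ℝ) (y : Fin N → ℝ) : ℝ :=
  Real.sqrt (∑ i, vinf A i * y i ^ 2)

/-- The operator norm of a matrix for the Euclidean norm. -/
def opNorm (B : Matrix (Fin N) (Fin N) ℝ) : ℝ := ‖Matrix.toEuclideanCLM (𝕜 := ℝ) B‖

/-- The largest component of `v`. -/
def vmax (A : Matrix (Fin N) (Fin N) ℝ) : ℝ := ⨆ i, vinf A i

/-- The smallest component of `v`. -/
def vmin (A : Matrix (Fin N) (Fin N) ℝ) : ℝ := ⨅ i, vinf A i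

/-- `ρ₁`, the norm of `A - V_∞` induced by `wnorm`. -/
def rho1 (A : Matrix (Fin N) (Fin N) ℝ) : ℝ :=
  sSup {r | ∃ y : Fin N → ℝ, y ≠ 0 ∧ r = wnorm A ((A - Vinf A).mulVec y) / wnorm A y}

/-- `ρ₂ = ‖I - V_∞‖`. -/
def rho2 (A : Matrix (Fin N) (Fin N) ℝ) : ℝ := opNorm (1 - Vinf A)

/-- `ρ = sup_k ‖(diag (A ^ k))⁻¹‖`. -/
def rhoSup (A : Matrix (Fin N) (Fin N) ℝ) : ℝ :=
  ⨆ k : ℕ, opNorm ((Matrix.diagonal (A ^ k).diag)⁻¹)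

/-- The symmetric matrix `Γ_α`. -/
def Gam (A : Matrix (Fin N) (Fin N) ℝ) (μ L₂ α : ℝ) (S : ℕ) : Matrix (Fin 2) (Fin 2) ℝ :=
  !![1 - 2 * α * μ, α * L₂ / Real.sqrt (vmin A);
     α * L₂ / Real.sqrt (vmin A), (rho1 A ^ 2) ^ S]

/-- The largest eigenvalue of a real symmetric matrix. -/
def lamMax (B : Matrix (Fin 2) (Fin 2) ℝ) : ℝ := sSup (spectrum ℝ B)

/-! ### The fast algorithm, run by the legitimate players alone -/

/-- Variables of the fast algorithm at one iteration: strategies, estimates of the aggregate, and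
the matrix `V` whose rows are the weight estimates of the players. -/
structure FastState (N p : ℕ) where
  x : Fin N → Strat p
  σ : Fin N → ℝ
  V : Matrix (Fin N) (Fin N) ℝ

/-- One iteration with step-size `α` and `S` communication rounds. -/
def fastStep (g : Game N p) (A : Matrix (Fin N) (Fin N) ℝ) (α : ℝ) (S : ℕ)
    (s : FastState N p) : FastState N p :=
  let V' := A ^ S * s.V
  let x' : Fin N → Strat p := fun i => proj (g.Ω i) (s.x i - α • g.G i (s.x i) (s.σ i))
  { x := x'
    σ := fun i =>
      (A ^ S).mulVec s.σ i + g.φ i (x' i) / V' i i - g.φ i (s.x i) / s.V i i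
    V := V' }

/-- The fast algorithm with constant step-size and number of rounds, started at `x1`:
`fastRun … n` holds the variables at iteration `n + 1`. -/
def fastRun (g : Game N p) (A : Matrix (Fin N) (Fin N) ℝ) (α : ℝ) (S : ℕ)
    (x1 : Fin N → Strat p) : ℕ → FastState N p
  | 0 => { x := x1, σ := fun i => g.φ i (x1 i), V := 1 }
  | n + 1 => fastStep g A α S (fastRun g A α S x1 n)

/-- `Mt` bounds `‖σ_{k+1} - V_∞ σ_{k+1}‖` in the weighted norm, for all iterations `k ≥ 1`. -/
def IsTrackingBound (g : Game N p) (A : Matrix (Fin N) (Fin N) ℝ) (α : ℝ) (S : ℕ)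
    (x1 : Fin N → Strat p) (Mt : ℝ) : Prop :=
  ∀ n : ℕ, wnorm A ((fastRun g A α S x1 (n + 1)).σ
    - (Vinf A).mulVec (fastRun g A α S x1 (n + 1)).σ) ≤ Mt

/-- `M` bounds `‖G(x_k, σ_k)‖` for all iterations `k ≥ 1`. -/
def IsGradBound (g : Game N p) (A : Matrix (Fin N) (Fin N) ℝ) (α : ℝ) (S : ℕ)
    (x1 : Fin N → Strat p) (M : ℝ) : Prop :=
  ∀ n : ℕ, ‖g.Gvec (fastRun g A α S x1 n).x (fastRun g A α S x1 n).σ‖ ≤ M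

/-- The constant `D₃`. -/
def D3 (A : Matrix (Fin N) (Fin N) ℝ) (L₃ α : ℝ) (S : ℕ) (Mt M : ℝ) : ℝ :=
  2 * rho1 A ^ S * Mt * Real.sqrt (vmax A) * rho2 A * rhoSup A * L₃ * M * α
    + (2 * vmax A * rho2 A ^ 2 * rhoSup A ^ 2 * L₃ ^ 2 * M ^ 2 + 4 * M ^ 2) * α ^ 2

/-! ### The resilient algorithm -/

/-- What the malicious players send: values of the appropriate type. In each field the
first argument is the (legitimate) receiver, the second the (malicious) sender, the third the
iteration; `sig` and `vec` also depend on the communication round `l`. -/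
structure Attack (N m : ℕ) where
  sig : Fin N → Fin m → ℕ → ℕ → ℝ
  vec : Fin N → Fin m → ℕ → ℕ → Fin (N + m) → ℝ
  mark : Fin N → Fin m → ℕ → Fin (N + m) → ℕ
  cnt : Fin N → Fin m → ℕ → ℕ

/-- Variables of the legitimate players at the beginning of an iteration `k`: strategies `x`,
weight estimates `v`, aggregate estimates `σ`, trustworthiness `β`, trusted in-neighbours
`trust = 𝒩_{i,k-1}` of the previous iteration, counters `cnt = ι`, and marks `mark = 𝒜`. -/
structure State (N m p : ℕ) where
  x : Fin N → Strat p
  v : Fin N → Fin (N + m) → ℝ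
  σ : Fin N → ℝ
  β : Fin N → Fin (N + m) → ℝ
  trust : Fin N → Finset (Fin (N + m))
  cnt : Fin N → ℕ
  mark : Fin N → Fin (N + m) → ℕ

/-- The value that a receiver gets from player `h`: the own value of `h` if `h` is legitimate, an
adversarial one otherwise. -/
def received {X : Type} (own : Fin N → X) (adv : Fin m → X) (h : Fin (N + m)) : X :=
  Fin.addCases own adv h

open Classical in
/-- The trusted in-neighbours `𝒩_{i,k} = {j ∈ 𝒩_i | β_{ij,k} ≥ 0}`. -/
def trusted (D : Digraph (Fin (N + m))) (s : State N m p) (i : Fin N) : Finset (Fin (N + m)) :=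
  (inNbr D i).filter fun j => 0 ≤ s.β i j

/-- The weights `a_{ij,k}` for a given set `T` of trusted in-neighbours. -/
def weight (T : Finset (Fin (N + m))) (j : Fin (N + m)) : ℝ :=
  if j ∈ T then 1 / (T.card : ℝ) else 0

/-- Multi-round communication at iteration `k`: the pairs `(σ_{i,k,l}, v_{i,k,l})`. -/
def mrc (D : Digraph (Fin (N + m))) (att : Attack N m) (k : ℕ) (s : State N m p) :
    ℕ → (Fin N → ℝ) × (Fin N → Fin (N + m) → ℝ)
  | 0 => (s.σ, s.v)
  | l + 1 =>
    let q := mrc D att k s l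
    (fun i => ∑ h ∈ inNbr D i, weight (trusted D s i) h *
        received q.1 (fun j => att.sig i j k l) h,
     fun i => ∑ h ∈ inNbr D i, weight (trusted D s i) h •
        received q.2 (fun j => att.vec i j k l) h)

/-- The counter `ι_{i,k}` after a change of classification has been noticed. -/
def cntNoticed (D : Digraph (Fin (N + m))) (s : State N m p) (i : Fin N) : ℕ :=
  if s.trust i ≠ trusted D s i then N + m else s.cnt i

/-- The counter `ι_{i,k}` after taking the maximum over the trusted in-neighbours. -/
def cntSpread (D : Digraph (Fin (N + m))) (att : Attack N m) (k : ℕ) (s : State N m p)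
    (i : Fin N) : ℕ :=
  (trusted D s i).sup (received (cntNoticed D s) fun j => att.cnt i j k)

/-- The vectors `𝒜_{i,k}` after `𝒜_{i,k}(i)` has been set to `k`. -/
def markOwn (k : ℕ) (s : State N m p) (i : Fin N) : Fin (N + m) → ℕ :=
  Function.update (s.mark i) (Fin.castAdd m i) k

/-- The vectors `𝒜_{i,k+1}`, componentwise maxima over the trusted in-neighbours. -/
def markNext (D : Digraph (Fin (N + m))) (att : Attack N m) (k : ℕ) (s : State N m p)
    (i : Fin N) (j : Fin (N + m)) : ℕ :=
  (trusted D s i).sup fun h => received (markOwn k s) (fun a => att.mark i a k) h j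

/-- The list of the players that player `i` considers as participating. -/
def playerList (D : Digraph (Fin (N + m))) (att : Attack N m) (k : ℕ) (s : State N m p)
    (i : Fin N) : Finset (Fin (N + m)) :=
  Finset.univ.filter fun j =>
    (markNext D att k s i (Fin.castAdd m i) : ℤ) - (markNext D att k s i j : ℤ)
      ≤ ((N + m : ℕ) : ℤ) - 1

/-- The position `i'` of player `i` in its (increasing) list, counted from `0`: the number of
listed players that precede `i`. -/
def position (D : Digraph (Fin (N + m))) (att : Attack N m) (k : ℕ) (s : State N m p)
    (i : Fin N) : Fin (N + m) :=
  ⟨((playerList D att k s i).filter fun j => j < Fin.castAdd m i).card, by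
    have h : ((playerList D att k s i).filter fun j => j < Fin.castAdd m i)
        ⊆ Finset.Iio (Fin.castAdd m i) := by
      intro j hj
      simpa using (Finset.mem_filter.mp hj).2
    have h2 := Finset.card_le_card h
    rw [Fin.card_Iio] at h2
    exact lt_of_le_of_lt h2 (Fin.castAdd m i).isLt⟩

/-- The initial variables (iteration `1`). -/
def initState (g : Game N p) (D : Digraph (Fin (N + m))) (x1 : Fin N → Strat p) :
    State N m p where
  x := x1
  v := fun i => Pi.single (Fin.castAdd m i) 1
  σ := fun i => g.φ i (x1 i)
  β := fun _ _ => 0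
  trust := fun i => inNbr D i
  cnt := fun _ => 0
  mark := fun _ _ => 0

/-- Iteration `k` with step-size `α` and `S` rounds; `obs i j l` is the trust observation
`τ_{ij,k,l}`. A player whose counter is `0` makes the gradient-based update, the others reset
their variables and decrement the counter. -/
def step (g : Game N p) (D : Digraph (Fin (N + m))) (x1 : Fin N → Strat p) (att : Attack N m)
    (k : ℕ) (α : ℝ) (S : ℕ) (obs : Fin N → Fin (N + m) → ℕ → ℝ) (s : State N m p) :
    State N m p :=
  let ι : Fin N → ℕ := cntSpread D att k s
  let pos : Fin N → Fin (N + m) := position D att k s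
  let q := mrc D att k s S
  let x' : Fin N → Strat p := fun i => proj (g.Ω i) (s.x i - α • g.G i (s.x i) (s.σ i))
  { x := fun i => if ι i = 0 then x' i else x1 i
    v := fun i => if ι i = 0 then q.2 i else Pi.single (pos i) 1
    σ := fun i => if ι i = 0 then
        q.1 i + g.φ i (x' i) / q.2 i (pos i) - g.φ i (s.x i) / s.v i (pos i)
      else g.φ i (x1 i)
    β := fun i j => s.β i j + ∑ l ∈ Finset.range S, (obs i j l - 1 / 2)
    trust := trusted D s
    cnt := fun i => ι i - 1
    mark := markNext D att k s }

/-- The resilient algorithm with step-sizes `α k` and round numbers `S k`, for given trust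
observations `τ i j k l` and given adversarial messages: `resilientRun … n` holds the variables at
iteration `n + 1`. -/
def resilientRun (g : Game N p) (D : Digraph (Fin (N + m))) (x1 : Fin N → Strat p)
    (att : Attack N m) (α : ℕ → ℝ) (S : ℕ → ℕ) (τ : Fin N → Fin (N + m) → ℕ → ℕ → ℝ) :
    ℕ → State N m p
  | 0 => initState g D x1
  | n + 1 => step g D x1 att (n + 1) (α (n + 1)) (S (n + 1)) (fun i j l => τ i j (n + 1) l)
      (resilientRun g D x1 att α S τ n)

/-- The squared error at iteration `n + 1`. -/
def sqError (g : Game N p) (D : Digraph (Fin (N + m))) (x1 : Fin N → Strat p)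
    (att : Attack N m) (α : ℕ → ℝ) (S : ℕ → ℕ) (τ : Fin N → Fin (N + m) → ℕ → ℕ → ℝ)
    (xs : Profile N p) (n : ℕ) : ℝ :=
  ‖(WithLp.toLp 2 (resilientRun g D x1 att α S τ n).x : Profile N p) - xs‖ ^ 2

/-! ### Randomness -/

/-- The messages of the malicious players are random variables, which may depend in any way on
each other and on the trust observations. The only restriction is on the marks, which are
iteration stamps: a mark sent at iteration `k` does not lie in the future of `k`. -/
structure AdmissibleAttack {W : Type*} [MeasurableSpace W] (att : W → Attack N m) : Prop where
  sig : ∀ i j k l, Measurable fun ω => (att ω).sig i j k l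
  vec : ∀ i j k l h, Measurable fun ω => (att ω).vec i j k l h
  mark : ∀ i j k h, Measurable fun ω => (att ω).mark i j k h
  cnt : ∀ i j k, Measurable fun ω => (att ω).cnt i j k
  mark_le : ∀ ω i j k h, 1 ≤ k → (att ω).mark i j k h ≤ k

/-- The assumption on the trust observations `τ i j k l` (iterations `k ≥ 1`, rounds
`0 ≤ l < S k`, legitimate `i`, in-neighbours `j` of `i`): they are random variables in `[0, 1]`
with mean `1 / 2 + E i j`, where `E i j > 0` for legitimate and `E i j < 0` for malicious `j`; for
each pair `(i, j)` they are independent, and for malicious `j` also identically distributed. -/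
structure TrustAssumption {W : Type*} [MeasurableSpace W] (P : Measure W)
    (D : Digraph (Fin (N + m))) (S : ℕ → ℕ) (τ : Fin N → Fin (N + m) → ℕ → ℕ → W → ℝ)
    (E : Fin N → Fin (N + m) → ℝ) : Prop where
  meas : ∀ i, ∀ j ∈ inNbr D i, ∀ k l, 1 ≤ k → l < S k → Measurable (τ i j k l)
  range : ∀ i, ∀ j ∈ inNbr D i, ∀ k l, 1 ≤ k → l < S k → ∀ ω, τ i j k l ω ∈ Set.Icc (0 : ℝ) 1
  mean : ∀ i, ∀ j ∈ inNbr D i, ∀ k l, 1 ≤ k → l < S k → E i j = ∫ ω, τ i j k l ω ∂P - 1 / 2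
  legit : ∀ i, ∀ j : Fin N, Fin.castAdd m j ∈ inNbr D i → 0 < E i (Fin.castAdd m j)
  malicious : ∀ i, ∀ j : Fin m, Fin.natAdd N j ∈ inNbr D i → E i (Fin.natAdd N j) < 0
  indep : ∀ i, ∀ j ∈ inNbr D i,
    iIndepFun (fun q : {q : ℕ × ℕ // 1 ≤ q.1 ∧ q.2 < S q.1} => τ i j q.1.1 q.1.2) P
  ident : ∀ i, ∀ j : Fin m, Fin.natAdd N j ∈ inNbr D i → ∀ k l k' l', 1 ≤ k → l < S k →
    1 ≤ k' → l' < S k' →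
    IdentDistrib (τ i (Fin.natAdd N j) k l) (τ i (Fin.natAdd N j) k' l') P P

/-- `E_min`: the smallest classification margin `|E i j|` over all pairs of neighbours. -/
def Emin (D : Digraph (Fin (N + m))) (E : Fin N → Fin (N + m) → ℝ) : ℝ :=
  ⨅ q : {q : Fin N × Fin (N + m) // q.2 ∈ inNbr D q.1}, |E q.1.1 q.1.2|

end AggGame

end

/-! The argument is pathwise; expectations enter only at the end.

Classification. A trust value is a sum of independent variables in [0, 1] minus 1/2, whose means
have a fixed nonzero bias E. By Hoeffding, the probability of a wrong sign after n iterations is at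
most exp(-2E²)^n, which is summable. By Borel–Cantelli, almost surely every legitimate player
eventually trusts exactly its legitimate in-neighbours (`TrustAssumption.ae_eventually_classified`).

Synchronous restart. Let T be the last iteration at which some trusted set changes. From T on
nothing malicious is used. Counters evolve by a maximum over in-neighbours and a decrement, so the
largest one, B ≥ N + m, floods the strongly connected network in at most N ≤ B rounds. Hence
everybody resets at iteration offset B - 1 after T and nobody later. The marks ensure that the reset
weight vectors are the right unit vectors. So from a random but finite iteration K on, the
trajectory is that of the fast algorithm started at `x1`, with step-sizes and round numbers shifted
by K (`exists_resilientRun_eq_varRun`). If no change ever occurs, K = 0.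

Fast algorithm. The powers of A converge geometrically to V_∞ (Doeblin). The v-average of the
estimates equals ∑ v_i φ_i(x_i) / V_ii, which approaches the aggregate because V_ii → v_i. The
disagreement of the estimates is contracted by A and driven by increments of φ_i / V_ii, one part of
order α and one part that vanishes anyway. A projected gradient step contracts the squared distance
e² to the equilibrium up to the tracking error. With constant steps, e² + δ², where δ is the
weighted disagreement, contracts with the largest eigenvalue of Γ_α up to D₃ and vanishing terms
(`eventually_fastRun_le`). With diminishing steps all errors vanish (`tendsto_varRun`).

Expectation. By compactness the squared errors are uniformly bounded, so dominated convergence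
transfers the almost sure bound D₃ / (1 - λ), with λ that eigenvalue. The stated bound is larger,
since exp(2E²) / (1 - exp(-2E²)) ≥ 1. -/

namespace AggGame

variable {N m p : ℕ}

/-! ### Reachability in the network of the legitimate players -/

/-- `Reach D d i j`: information of `j` arrives at `i` within `d` rounds. -/
def Reach (D : Digraph (Fin (N + m))) : ℕ → Fin N → Fin N → Prop
  | 0, i, j => i = j
  | d + 1, i, j => ∃ h ∈ legitNbr D i, Reach D d h j

lemma mem_inNbr {D : Digraph (Fin (N + m))} {i : Fin N} {j : Fin (N + m)} :
    j ∈ inNbr D i ↔ D.Adj j (Fin.castAdd m i) ∨ j = Fin.castAdd m i := by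
  classical
  unfold inNbr
  exact Finset.mem_filter.trans (by simp)

lemma mem_legitNbr {D : Digraph (Fin (N + m))} {i j : Fin N} :
    j ∈ legitNbr D i ↔ Fin.castAdd m j ∈ inNbr D i := by
  simp [legitNbr]

lemma self_mem_legitNbr (D : Digraph (Fin (N + m))) (i : Fin N) : i ∈ legitNbr D i := by
  rw [mem_legitNbr, mem_inNbr]
  exact Or.inr rfl

lemma Reach.succ {D : Digraph (Fin (N + m))} {d : ℕ} {i j : Fin N} (h : Reach D d i j) :
    Reach D (d + 1) i j := ⟨i, self_mem_legitNbr D i, h⟩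

lemma Reach.mono {D : Digraph (Fin (N + m))} {d e : ℕ} {i j : Fin N} (hde : d ≤ e)
    (h : Reach D d i j) : Reach D e i j := by
  induction hde with
  | refl => exact h
  | step _ ih => exact ih.succ

/-- Self-loops make the sets `B d` increase with `d`. Each strict increase adds a player; once the
growth stops, the set is closed under edges and contains `j`, so strong connectivity makes it
everything. -/
lemma reach_card {D : Digraph (Fin (N + m))} (hconn : LegitStronglyConnected D) (i j : Fin N) :
    Reach D N i j := by
  classical
  let B : ℕ → Finset (Fin N) := fun d => Finset.univ.filter fun i => Reach D d i j
  have key : ∀ d, B d = Finset.univ ∨ d + 1 ≤ (B d).card := by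
    intro d
    induction d with
    | zero =>
      right
      exact Finset.card_pos.mpr ⟨j, Finset.mem_filter.mpr ⟨Finset.mem_univ j, rfl⟩⟩
    | succ d ih =>
      have hsub : B d ⊆ B (d + 1) := by
        intro a ha
        simp only [B, Finset.mem_filter, Finset.mem_univ, true_and] at ha ⊢
        exact ha.succ
      rcases ih with h | h
      · left
        exact Finset.univ_subset_iff.mp (h ▸ hsub)
      · by_cases hcl : B (d + 1) ⊆ B d
        · left
          refine Finset.univ_subset_iff.mp fun a _ => hsub ?_
          have hja : ∀ b, Relation.ReflTransGen
              (fun a b => D.Adj (Fin.castAdd m a) (Fin.castAdd m b)) j b → b ∈ B d := by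
            intro b hb
            induction hb with
            | refl =>
              simp only [B, Finset.mem_filter, Finset.mem_univ, true_and]
              exact Reach.mono (Nat.zero_le d) (show Reach D 0 j j from rfl)
            | tail _ hbc hb =>
              refine hcl ?_
              simp only [B, Finset.mem_filter, Finset.mem_univ, true_and] at hb ⊢
              exact ⟨_, by simp [legitNbr, inNbr, hbc], hb⟩
          exact hja a (hconn j a)
        · right
          have := Finset.card_lt_card (Finset.ssubset_iff_subset_ne.mpr
            ⟨hsub, fun h => hcl h.symm.subset⟩)
          omega
  have hN : B N = Finset.univ := by
    rcases key N with h | h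
    · exact h
    · have := Finset.card_le_univ (B N)
      simp at this
      omega
  have := Finset.mem_univ i
  rw [← hN] at this
  simpa [B] using this

/-! ### Powers of a stochastic matrix -/

/-- A row-stochastic matrix some power of which is positive. -/
structure IsPrimitiveStochastic (A : Matrix (Fin N) (Fin N) ℝ) : Prop where
  nonneg : ∀ i j, 0 ≤ A i j
  row_sum : ∀ i, ∑ j, A i j = 1
  diag_pos : ∀ i, 0 < A i i
  pow_pos : ∃ n, ∀ i j, 0 < (A ^ n) i j

lemma legitNbr_card_pos (D : Digraph (Fin (N + m))) (i : Fin N) :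
    (0 : ℝ) < (legitNbr D i).card :=
  Nat.cast_pos.mpr (Finset.card_pos.mpr ⟨i, self_mem_legitNbr D i⟩)

lemma weightMatrix_nonneg (D : Digraph (Fin (N + m))) (i j : Fin N) :
    0 ≤ weightMatrix D i j := by
  unfold weightMatrix
  split_ifs
  · positivity
  · exact le_rfl

lemma weightMatrix_pos {D : Digraph (Fin (N + m))} {i j : Fin N} (h : j ∈ legitNbr D i) :
    0 < weightMatrix D i j := by
  rw [weightMatrix, if_pos h]
  exact div_pos one_pos (legitNbr_card_pos D i)

lemma matrix_pow_nonneg {A : Matrix (Fin N) (Fin N) ℝ} (hA : ∀ i j, 0 ≤ A i j) (n : ℕ) :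
    ∀ i j, 0 ≤ (A ^ n) i j := by
  induction n with
  | zero =>
    intro i j
    rw [pow_zero, Matrix.one_apply]
    split_ifs <;> norm_num
  | succ n ih =>
    intro i j
    rw [pow_succ', Matrix.mul_apply]
    exact Finset.sum_nonneg fun h _ => mul_nonneg (hA i h) (ih h j)

lemma weightMatrix_pow_pos {D : Digraph (Fin (N + m))} (d : ℕ) :
    ∀ i j, Reach D d i j → 0 < (weightMatrix D ^ d) i j := by
  induction d with
  | zero =>
    intro i j h
    cases (show i = j from h)
    simp
  | succ d ih =>
    rintro i j ⟨h, hh, hr⟩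
    rw [pow_succ', Matrix.mul_apply]
    refine Finset.sum_pos' (fun a _ => mul_nonneg (weightMatrix_nonneg D i a)
      (matrix_pow_nonneg (weightMatrix_nonneg D) d a j)) ⟨h, Finset.mem_univ h, ?_⟩
    exact mul_pos (weightMatrix_pos hh) (ih h j hr)

lemma isPrimitiveStochastic_weightMatrix {D : Digraph (Fin (N + m))}
    (hconn : LegitStronglyConnected D) : IsPrimitiveStochastic (weightMatrix D) where
  nonneg := weightMatrix_nonneg D
  row_sum i := by
    simp only [weightMatrix]
    rw [Finset.sum_ite_mem, Finset.univ_inter, Finset.sum_const, nsmul_eq_mul]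
    field_simp [(legitNbr_card_pos D i).ne']
  diag_pos i := weightMatrix_pos (self_mem_legitNbr D i)
  pow_pos := ⟨N, fun i j => weightMatrix_pow_pos N i j (reach_card hconn i j)⟩

section Stochastic

variable {A : Matrix (Fin N) (Fin N) ℝ}

lemma matrix_pow_row_sum (h1 : ∀ i, ∑ j, A i j = 1) (n : ℕ) :
    ∀ i, ∑ j, (A ^ n) i j = 1 := by
  have h (B : Matrix (Fin N) (Fin N) ℝ) : (∀ i, ∑ j, B i j = 1) ↔ B.mulVec 1 = 1 := by
    simp [funext_iff, Matrix.mulVec, dotProduct]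
  rw [h] at h1 ⊢
  induction n with
  | zero => simp
  | succ n ih => rw [pow_succ, ← Matrix.mulVec_mulVec, h1, ih]

/-- The term at `j` of the average of `y a - y j` vanishes, so only the mass `1 - B i j`
contributes. -/
lemma mulVec_sub_le {B : Matrix (Fin N) (Fin N) ℝ} (h0 : ∀ i j, 0 ≤ B i j)
    (h1 : ∀ i, ∑ j, B i j = 1) {y : Fin N → ℝ} {r : ℝ} {i j : Fin N}
    (hy : ∀ a, y a - y j ≤ r) : B.mulVec y i - y j ≤ (1 - B i j) * r := by
  have e : B.mulVec y i - y j = ∑ a, B i a * (y a - y j) := by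
    simp only [Matrix.mulVec, dotProduct, mul_sub, Finset.sum_sub_distrib, ← Finset.sum_mul,
      h1 i, one_mul]
  rw [e, ← Finset.add_sum_erase _ _ (Finset.mem_univ j), sub_self, mul_zero, zero_add,
    ← h1 i, ← Finset.add_sum_erase (a := j) _ (fun a => B i a) (Finset.mem_univ j),
    add_sub_cancel_left, Finset.sum_mul]
  exact Finset.sum_le_sum fun a _ => mul_le_mul_of_nonneg_left (hy a) (h0 i a)

lemma le_mulVec {B : Matrix (Fin N) (Fin N) ℝ} (h0 : ∀ i j, 0 ≤ B i j)
    (h1 : ∀ i, ∑ j, B i j = 1) {y : Fin N → ℝ} {a : ℝ} {i : Fin N}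
    (hy : ∀ j, a ≤ y j) : a ≤ B.mulVec y i := by
  have e : a = ∑ j, B i j * a := by rw [← Finset.sum_mul, h1, one_mul]
  rw [e]
  exact Finset.sum_le_sum fun j _ => mul_le_mul_of_nonneg_left (hy j) (h0 i j)

/-- Doeblin's contraction of the oscillation. -/
lemma osc_mulVec {B : Matrix (Fin N) (Fin N) ℝ} (h0 : ∀ i j, 0 ≤ B i j)
    (h1 : ∀ i, ∑ j, B i j = 1) {c : ℝ} (hc : ∀ i j, c ≤ B i j) {y : Fin N → ℝ} {r : ℝ}
    (hr : 0 ≤ r) (hy : ∀ i j, y i - y j ≤ r) (i k : Fin N) :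
    B.mulVec y i - B.mulVec y k ≤ (1 - c) * r := by
  have : Nonempty (Fin N) := ⟨i⟩
  -- Row `i` puts mass at least `c` on the minimiser `j`, while the average in row `k` is at least
  -- `y j`.
  obtain ⟨j, hj⟩ := Finite.exists_min y
  have h2 := mulVec_sub_le h0 h1 (i := i) (j := j) (fun a => hy a j)
  have h3 : y j ≤ B.mulVec y k := le_mulVec h0 h1 hj
  nlinarith [hc i j]

/-- A positive power of `A` shrinks the oscillation by a fixed factor `1 - c`, and the remaining
powers do not increase it. This yields a geometric rate along all powers. -/
lemma IsPrimitiveStochastic.exists_osc_le (hA : IsPrimitiveStochastic A) :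
    ∃ C q : ℝ, 0 < C ∧ 0 < q ∧ q < 1 ∧ ∀ (y : Fin N → ℝ) (r : ℝ), 0 ≤ r →
      (∀ i j, y i - y j ≤ r) → ∀ (k : ℕ) (i j : Fin N),
        (A ^ k).mulVec y i - (A ^ k).mulVec y j ≤ C * q ^ k * r := by
  obtain ⟨n, hn⟩ := hA.pow_pos
  obtain ⟨c, hc0, hc1, hc⟩ : ∃ c : ℝ, 0 < c ∧ c < 1 ∧ ∀ i j, c ≤ (A ^ n) i j := by
    rcases isEmpty_or_nonempty (Fin N) with h | h
    · exact ⟨1 / 2, by norm_num, by norm_num, fun i => h.elim i⟩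
    · obtain ⟨q, hq⟩ := Finite.exists_min fun q : Fin N × Fin N => (A ^ n) q.1 q.2
      refine ⟨min ((A ^ n) q.1 q.2) (1 / 2), lt_min (hn _ _) (by norm_num),
        (min_le_right _ _).trans_lt (by norm_num), fun i j => (min_le_left _ _).trans (hq (i, j))⟩
  -- Passing to `n + 1` makes the block length positive; averaging rows of `A ^ n` keeps the lower
  -- bound `c`.
  set n' := n + 1 with hn'
  have hcn : ∀ i j, c ≤ (A ^ n') i j := by
    intro i j
    rw [hn', pow_succ', Matrix.mul_apply]
    have : c = ∑ h, A i h * c := by rw [← Finset.sum_mul, hA.row_sum, one_mul]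
    rw [this]
    exact Finset.sum_le_sum fun h _ => mul_le_mul_of_nonneg_left (hc h j) (hA.nonneg i h)
  have hn0 : (0 : ℝ) < n' := by positivity
  have hn1 : (1 : ℝ) ≤ n' := by rw [hn']; push_cast; linarith [Nat.cast_nonneg (α := ℝ) n]
  -- By Bernoulli's inequality this `q` satisfies `1 - c ≤ q ^ n'`, which avoids roots.
  set q : ℝ := 1 - c / n' with hq
  have hcn' : c / n' ≤ c := div_le_self hc0.le hn1
  have hq0 : 0 < q := by rw [hq]; linarith
  have hq1 : q < 1 := by rw [hq]; linarith [div_pos hc0 hn0]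
  have hqn : 1 - c ≤ q ^ n' := by
    have := one_add_mul_le_pow (a := -(c / n')) (by linarith) n'
    have e : 1 + (n' : ℝ) * -(c / n') = 1 - c := by field_simp; ring
    rw [e] at this
    simpa [hq, sub_eq_add_neg] using this
  -- The constant `(q ^ n')⁻¹` absorbs the incomplete block of fewer than `n'` factors.
  refine ⟨(q ^ n')⁻¹, q, by positivity, hq0, hq1, fun y r hr hy k => ?_⟩
  induction k using Nat.strong_induction_on with
  | _ k ih =>
    by_cases hk : k < n'
    · intro i j
      have h1 := osc_mulVec (matrix_pow_nonneg hA.nonneg k) (matrix_pow_row_sum hA.row_sum k)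
        (matrix_pow_nonneg hA.nonneg k) hr hy i j
      refine h1.trans ?_
      rw [sub_zero]
      refine mul_le_mul_of_nonneg_right ?_ hr
      have : q ^ n' ≤ q ^ k := pow_le_pow_of_le_one hq0.le hq1.le hk.le
      rw [inv_mul_eq_div, one_le_div (by positivity)]
      exact this
    · obtain ⟨l, rfl⟩ := Nat.exists_eq_add_of_le (not_lt.mp hk)
      intro i j
      have hl := ih l (by omega)
      have h2 := osc_mulVec (matrix_pow_nonneg hA.nonneg n') (matrix_pow_row_sum hA.row_sum n')
        hcn (by positivity) hl i j
      rw [pow_add, ← Matrix.mulVec_mulVec]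
      refine h2.trans ?_
      calc (1 - c) * ((q ^ n')⁻¹ * q ^ l * r) ≤ q ^ n' * ((q ^ n')⁻¹ * q ^ l * r) :=
            mul_le_mul_of_nonneg_right hqn (by positivity)
        _ = _ := by rw [pow_add]; ring

/-- An entry of `A ^ (k + 1)` is an average of the entries of `A ^ k` in the same column, so it
moves by at most the oscillation of that column. The entries are therefore Cauchy at a geometric
rate, and the limit is constant along columns. -/
lemma IsPrimitiveStochastic.exists_col_limit (hA : IsPrimitiveStochastic A) :
    ∃ (C q : ℝ) (V : Matrix (Fin N) (Fin N) ℝ), 0 < C ∧ 0 < q ∧ q < 1 ∧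
      (∀ k i j, |(A ^ k) i j - V i j| ≤ C * q ^ k) ∧ ∀ i i' j, V i j = V i' j := by
  obtain ⟨C, q, hC, hq0, hq1, h⟩ := hA.exists_osc_le
  have hosc : ∀ k i i' j, (A ^ k) i j - (A ^ k) i' j ≤ C * q ^ k := by
    intro k i i' j
    have := h (Pi.single j 1) 1 zero_le_one (by
      intro a b
      simp only [Pi.single_apply]
      split_ifs <;> norm_num) k i i'
    simpa using this
  have hstep : ∀ i j k, dist ((A ^ k) i j) ((A ^ (k + 1)) i j) ≤ C * q ^ k := by
    intro i j k
    rw [Real.dist_eq, pow_succ', Matrix.mul_apply]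
    have e : (A ^ k) i j - ∑ a, A i a * (A ^ k) a j
        = ∑ a, A i a * ((A ^ k) i j - (A ^ k) a j) := by
      simp only [mul_sub, Finset.sum_sub_distrib, ← Finset.sum_mul, hA.row_sum i, one_mul]
    rw [e]
    refine (Finset.abs_sum_le_sum_abs _ _).trans ?_
    have e2 : C * q ^ k = ∑ a, A i a * (C * q ^ k) := by
      rw [← Finset.sum_mul, hA.row_sum, one_mul]
    rw [e2]
    refine Finset.sum_le_sum fun a _ => ?_
    rw [abs_mul, abs_of_nonneg (hA.nonneg i a)]
    refine mul_le_mul_of_nonneg_left (abs_le.mpr ⟨?_, hosc k i a j⟩) (hA.nonneg i a)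
    linarith [hosc k a i j]
  choose V hV using fun i j =>
    cauchySeq_tendsto_of_complete (cauchySeq_of_le_geometric q C hq1 (hstep i j))
  refine ⟨C / (1 - q), q, V, by have := sub_pos.mpr hq1; positivity, hq0, hq1,
    fun k i j => ?_, fun i i' j => ?_⟩
  · have := dist_le_of_le_geometric_of_tendsto q C hq1 (hstep i j) (hV i j) k
    rw [Real.dist_eq] at this
    rwa [div_mul_eq_mul_div]
  · have hlim : Tendsto (fun k : ℕ => C * q ^ k) atTop (𝓝 0) := by
      simpa using (tendsto_pow_atTop_nhds_zero_of_lt_one hq0.le hq1).const_mul C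
    have h1 := fun a b => le_of_tendsto_of_tendsto ((hV a j).sub (hV b j)) hlim
      (Eventually.of_forall fun k => hosc k a b j)
    linarith [h1 i i', h1 i' i]

lemma IsPrimitiveStochastic.exists_pow_sub_le (hA : IsPrimitiveStochastic A) :
    ∃ C q : ℝ, 0 < C ∧ 0 < q ∧ q < 1 ∧ ∀ k i j, |(A ^ k) i j - Vinf A i j| ≤ C * q ^ k := by
  obtain ⟨C, q, V, hC, hq0, hq1, hV, -⟩ := hA.exists_col_limit
  have hlim : Tendsto (fun k : ℕ => A ^ k) atTop (𝓝 V) := by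
    refine tendsto_pi_nhds.mpr fun i => tendsto_pi_nhds.mpr fun j => ?_
    rw [tendsto_iff_dist_tendsto_zero]
    refine squeeze_zero (fun _ => dist_nonneg) (fun k => hV k i j) ?_
    simpa using (tendsto_pow_atTop_nhds_zero_of_lt_one hq0.le hq1).const_mul C
  have e : Vinf A = V := hlim.limUnder_eq
  exact ⟨C, q, hC, hq0, hq1, e ▸ hV⟩

lemma IsPrimitiveStochastic.tendsto_pow (hA : IsPrimitiveStochastic A) :
    Tendsto (fun k : ℕ => A ^ k) atTop (𝓝 (Vinf A)) := by
  obtain ⟨C, q, hC, hq0, hq1, hV⟩ := hA.exists_pow_sub_le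
  refine tendsto_pi_nhds.mpr fun i => tendsto_pi_nhds.mpr fun j => ?_
  rw [tendsto_iff_dist_tendsto_zero]
  refine squeeze_zero (fun _ => dist_nonneg) (fun k => hV k i j) ?_
  simpa using (tendsto_pow_atTop_nhds_zero_of_lt_one hq0.le hq1).const_mul C

lemma IsPrimitiveStochastic.tendsto_pow_apply (hA : IsPrimitiveStochastic A) (i j : Fin N) :
    Tendsto (fun k : ℕ => (A ^ k) i j) atTop (𝓝 (Vinf A i j)) :=
  tendsto_pi_nhds.mp (tendsto_pi_nhds.mp hA.tendsto_pow i) j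

lemma IsPrimitiveStochastic.Vinf_apply (hA : IsPrimitiveStochastic A) (i j : Fin N) :
    Vinf A i j = vinf A j := by
  obtain ⟨C, q, V, hC, hq0, hq1, hV, hrow⟩ := hA.exists_col_limit
  have e : Vinf A = V := by
    ext a b
    refine tendsto_nhds_unique (hA.tendsto_pow_apply a b) ?_
    rw [tendsto_iff_dist_tendsto_zero]
    refine squeeze_zero (fun _ => dist_nonneg) (fun k => hV k a b) ?_
    simpa using (tendsto_pow_atTop_nhds_zero_of_lt_one hq0.le hq1).const_mul C
  rw [vinf, e, hrow]

lemma IsPrimitiveStochastic.mul_Vinf (hA : IsPrimitiveStochastic A) : A * Vinf A = Vinf A := by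
  refine tendsto_nhds_unique (hA.tendsto_pow.const_mul A) ?_
  exact (hA.tendsto_pow.comp (tendsto_add_atTop_nat 1)).congr fun k => pow_succ' A k

lemma IsPrimitiveStochastic.Vinf_mul (hA : IsPrimitiveStochastic A) : Vinf A * A = Vinf A := by
  refine tendsto_nhds_unique (hA.tendsto_pow.mul_const A) ?_
  exact (hA.tendsto_pow.comp (tendsto_add_atTop_nat 1)).congr fun k => pow_succ A k

lemma IsPrimitiveStochastic.Vinf_mul_pow (hA : IsPrimitiveStochastic A) (n : ℕ) :
    Vinf A * A ^ n = Vinf A := by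
  induction n with
  | zero => simp
  | succ n ih => rw [pow_succ, ← mul_assoc, ih, hA.Vinf_mul]

lemma IsPrimitiveStochastic.pow_mul_Vinf (hA : IsPrimitiveStochastic A) (n : ℕ) :
    A ^ n * Vinf A = Vinf A := by
  induction n with
  | zero => simp
  | succ n ih => rw [pow_succ, mul_assoc, hA.mul_Vinf, ih]

lemma IsPrimitiveStochastic.Vinf_mul_Vinf (hA : IsPrimitiveStochastic A) :
    Vinf A * Vinf A = Vinf A := by
  refine tendsto_nhds_unique (hA.tendsto_pow.const_mul (Vinf A)) ?_
  simp only [hA.Vinf_mul_pow]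
  exact tendsto_const_nhds

lemma IsPrimitiveStochastic.sum_vinf (hA : IsPrimitiveStochastic A) (hN : 0 < N) :
    ∑ j, vinf A j = 1 := by
  have h := tendsto_finsetSum Finset.univ fun j _ => hA.tendsto_pow_apply ⟨0, hN⟩ j
  simp only [hA.Vinf_apply] at h
  refine tendsto_nhds_unique h ?_
  simp only [matrix_pow_row_sum hA.row_sum]
  exact tendsto_const_nhds

/-- The vector `v` is nonnegative with sum 1 and satisfies `v = v A ^ n` with `A ^ n` positive. -/
lemma IsPrimitiveStochastic.vinf_pos (hA : IsPrimitiveStochastic A) (i : Fin N) :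
    0 < vinf A i := by
  obtain ⟨n, hn⟩ := hA.pow_pos
  have hnn : ∀ j, 0 ≤ vinf A j := fun j => ge_of_tendsto (hA.tendsto_pow_apply j j)
    (Eventually.of_forall fun k => matrix_pow_nonneg hA.nonneg k j j)
  have e : vinf A i = ∑ j, vinf A j * (A ^ n) j i := by
    conv_lhs => rw [vinf, ← hA.Vinf_mul_pow n, Matrix.mul_apply]
    simp only [hA.Vinf_apply]
  have hs := hA.sum_vinf (Fin.pos i)
  obtain ⟨j, -, hj⟩ : ∃ j ∈ Finset.univ, 0 < vinf A j := by
    by_contra! h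
    linarith [Finset.sum_nonpos h]
  rw [e]
  exact Finset.sum_pos' (fun j _ => mul_nonneg (hnn j) (hn j i).le)
    ⟨j, Finset.mem_univ j, mul_pos hj (hn j i)⟩

lemma IsPrimitiveStochastic.Vinf_mulVec (hA : IsPrimitiveStochastic A) (y : Fin N → ℝ)
    (i : Fin N) : (Vinf A).mulVec y i = ∑ j, vinf A j * y j := by
  simp only [Matrix.mulVec, dotProduct, hA.Vinf_apply]

lemma IsPrimitiveStochastic.pow_diag_pos (hA : IsPrimitiveStochastic A) (n : ℕ) (i : Fin N) :
    0 < (A ^ n) i i := by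
  induction n with
  | zero => simp
  | succ n ih =>
    rw [pow_succ', Matrix.mul_apply]
    exact Finset.sum_pos' (fun j _ => mul_nonneg (hA.nonneg i j)
      (matrix_pow_nonneg hA.nonneg n j i)) ⟨i, Finset.mem_univ i, mul_pos (hA.diag_pos i) ih⟩

lemma IsPrimitiveStochastic.exists_mulVec_sub_le (hA : IsPrimitiveStochastic A) :
    ∃ C q : ℝ, 0 < C ∧ 0 < q ∧ q < 1 ∧ ∀ (k : ℕ) (y : Fin N → ℝ),
      ‖(A ^ k).mulVec y - (Vinf A).mulVec y‖ ≤ C * q ^ k * ‖y‖ := by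
  obtain ⟨C, q, hC, hq0, hq1, hV⟩ := hA.exists_pow_sub_le
  -- The factor `N + 1` instead of `N` keeps the constant positive when `N = 0`.
  refine ⟨(N + 1) * C, q, by positivity, hq0, hq1, fun k y => ?_⟩
  rw [pi_norm_le_iff_of_nonneg (by positivity)]
  intro i
  rw [Pi.sub_apply, Matrix.mulVec, Matrix.mulVec, ← sub_dotProduct, dotProduct]
  refine (norm_sum_le _ _).trans ?_
  calc ∑ j, ‖((A ^ k) i - Vinf A i) j * y j‖ ≤ ∑ _j : Fin N, C * q ^ k * ‖y‖ := by
        refine Finset.sum_le_sum fun j _ => ?_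
        rw [norm_mul]
        exact mul_le_mul (hV k i j) (norm_le_pi_norm y j) (norm_nonneg _) (by positivity)
    _ = N * (C * q ^ k * ‖y‖) := by simp
    _ ≤ (N + 1) * C * q ^ k * ‖y‖ := by
        have : 0 ≤ C * q ^ k * ‖y‖ := by positivity
        nlinarith

end Stochastic

/-! ### The constants of the weight matrix -/

section Constants

variable {A : Matrix (Fin N) (Fin N) ℝ}

lemma wnorm_nonneg (y : Fin N → ℝ) : 0 ≤ wnorm A y := Real.sqrt_nonneg _

lemma wnorm_sq (hv : ∀ i, 0 ≤ vinf A i) (y : Fin N → ℝ) :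
    wnorm A y ^ 2 = ∑ i, vinf A i * y i ^ 2 :=
  Real.sq_sqrt (Finset.sum_nonneg fun i _ => mul_nonneg (hv i) (sq_nonneg _))

lemma continuous_wnorm : Continuous (wnorm A) := by
  unfold wnorm
  fun_prop

lemma wnorm_zero : wnorm A 0 = 0 := by simp [wnorm]

lemma wnorm_eq_norm (hv : ∀ i, 0 ≤ vinf A i) (y : Fin N → ℝ) :
    wnorm A y = ‖WithLp.toLp 2 (fun i => Real.sqrt (vinf A i) * y i)‖ := by
  rw [EuclideanSpace.norm_eq, wnorm]
  congr 1
  refine Finset.sum_congr rfl fun i _ => ?_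
  rw [Real.norm_eq_abs, sq_abs, mul_pow, Real.sq_sqrt (hv i)]

lemma wnorm_add_le (hv : ∀ i, 0 ≤ vinf A i) (y z : Fin N → ℝ) :
    wnorm A (y + z) ≤ wnorm A y + wnorm A z := by
  rw [wnorm_eq_norm hv, wnorm_eq_norm hv, wnorm_eq_norm hv]
  refine le_trans (le_of_eq ?_) (norm_add_le _ _)
  congr 1
  ext i
  simp [mul_add]

lemma toLp_norm_sq (y : Fin N → ℝ) :
    ‖(WithLp.toLp 2 y : EuclideanSpace ℝ (Fin N))‖ ^ 2 = ∑ i, y i ^ 2 := by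
  rw [EuclideanSpace.norm_sq_eq]
  simp

lemma vinf_le_vmax (i : Fin N) : vinf A i ≤ vmax A :=
  le_ciSup (Set.finite_range _).bddAbove i

lemma vmin_le_vinf (i : Fin N) : vmin A ≤ vinf A i :=
  ciInf_le (Set.finite_range _).bddBelow i

lemma vmax_nonneg (hv : ∀ i, 0 < vinf A i) : 0 ≤ vmax A :=
  Real.iSup_nonneg fun i => (hv i).le

lemma vmin_pos (hN : 0 < N) (hv : ∀ i, 0 < vinf A i) : 0 < vmin A := by
  have : Nonempty (Fin N) := ⟨⟨0, hN⟩⟩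
  obtain ⟨i, hi⟩ := exists_eq_ciInf_of_finite (f := vinf A)
  rw [vmin, ← hi]
  exact hv i

lemma wnorm_le (hv : ∀ i, 0 < vinf A i) (y : Fin N → ℝ) :
    wnorm A y ≤ Real.sqrt (vmax A) * ‖(WithLp.toLp 2 y : EuclideanSpace ℝ (Fin N))‖ := by
  refine le_of_sq_le_sq ?_ (by positivity)
  rw [wnorm_sq fun i => (hv i).le, mul_pow, Real.sq_sqrt (vmax_nonneg hv), toLp_norm_sq,
    Finset.mul_sum]
  exact Finset.sum_le_sum fun i _ => mul_le_mul_of_nonneg_right (vinf_le_vmax i) (sq_nonneg _)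

lemma le_wnorm (hN : 0 < N) (hv : ∀ i, 0 < vinf A i) (y : Fin N → ℝ) :
    Real.sqrt (vmin A) * ‖(WithLp.toLp 2 y : EuclideanSpace ℝ (Fin N))‖ ≤ wnorm A y := by
  refine le_of_sq_le_sq ?_ (wnorm_nonneg y)
  rw [wnorm_sq fun i => (hv i).le, mul_pow, Real.sq_sqrt (vmin_pos hN hv).le, toLp_norm_sq,
    Finset.mul_sum]
  exact Finset.sum_le_sum fun i _ => mul_le_mul_of_nonneg_right (vmin_le_vinf i) (sq_nonneg _)

lemma norm_mulVec_le_opNorm (B : Matrix (Fin N) (Fin N) ℝ) (y : Fin N → ℝ) :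
    ‖(WithLp.toLp 2 (B.mulVec y) : EuclideanSpace ℝ (Fin N))‖
      ≤ opNorm B * ‖(WithLp.toLp 2 y : EuclideanSpace ℝ (Fin N))‖ := by
  have := (Matrix.toEuclideanCLM (𝕜 := ℝ) B).le_opNorm (WithLp.toLp 2 y)
  rwa [Matrix.toEuclideanCLM_toLp] at this

lemma continuous_opNorm : Continuous (opNorm (N := N)) := by
  unfold opNorm
  refine continuous_norm.comp ?_
  exact LinearMap.continuous_of_finiteDimensional
    (Matrix.toEuclideanCLM (𝕜 := ℝ) (n := Fin N)).toAlgEquiv.toLinearMap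

lemma opNorm_nonneg (B : Matrix (Fin N) (Fin N) ℝ) : 0 ≤ opNorm B := norm_nonneg _

lemma rho2_nonneg : 0 ≤ rho2 A := opNorm_nonneg _

lemma rho1_nonneg : 0 ≤ rho1 A := by
  refine Real.sSup_nonneg ?_
  rintro _ ⟨y, -, rfl⟩
  exact div_nonneg (wnorm_nonneg _) (wnorm_nonneg _)

lemma rhoSup_nonneg : 0 ≤ rhoSup A := Real.iSup_nonneg fun _ => opNorm_nonneg _

/-- Equivalence of the weighted and Euclidean norms bounds the quotients in `rho1`. This is needed
because the supremum of an unbounded set would take the default value 0. -/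
lemma wnorm_sub_Vinf_mulVec_le (hN : 0 < N) (hv : ∀ i, 0 < vinf A i) (y : Fin N → ℝ) :
    wnorm A ((A - Vinf A).mulVec y) ≤ rho1 A * wnorm A y := by
  have hmin := Real.sqrt_pos.mpr (vmin_pos hN hv)
  have hbound : ∀ z : Fin N → ℝ, wnorm A ((A - Vinf A).mulVec z)
      ≤ Real.sqrt (vmax A) * opNorm (A - Vinf A) / Real.sqrt (vmin A) * wnorm A z := by
    intro z
    calc wnorm A ((A - Vinf A).mulVec z)
        ≤ Real.sqrt (vmax A) * (opNorm (A - Vinf A) *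
            ‖(WithLp.toLp 2 z : EuclideanSpace ℝ (Fin N))‖) :=
          (wnorm_le hv _).trans (mul_le_mul_of_nonneg_left (norm_mulVec_le_opNorm _ _)
            (Real.sqrt_nonneg _))
      _ = Real.sqrt (vmax A) * opNorm (A - Vinf A) / Real.sqrt (vmin A) *
            (Real.sqrt (vmin A) * ‖(WithLp.toLp 2 z : EuclideanSpace ℝ (Fin N))‖) := by
          field_simp
      _ ≤ _ := mul_le_mul_of_nonneg_left (le_wnorm hN hv z)
          (div_nonneg (mul_nonneg (Real.sqrt_nonneg _) (opNorm_nonneg _)) hmin.le)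
  have hpos : ∀ z : Fin N → ℝ, z ≠ 0 → 0 < wnorm A z := by
    intro z hz
    refine lt_of_lt_of_le (mul_pos hmin (norm_pos_iff.mpr ?_)) (le_wnorm hN hv z)
    simpa using hz
  by_cases hy : y = 0
  · subst hy
    simp [wnorm_zero]
  · rw [← div_le_iff₀ (hpos y hy)]
    refine le_csSup ⟨Real.sqrt (vmax A) * opNorm (A - Vinf A) / Real.sqrt (vmin A), ?_⟩
      ⟨y, hy, rfl⟩
    rintro _ ⟨z, hz, rfl⟩
    rw [div_le_iff₀ (hpos z hz)]
    exact hbound z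

/-- The kernel of `Vinf A` is invariant under `A`, and on it `A` acts as `A - Vinf A`. -/
lemma IsPrimitiveStochastic.wnorm_pow_mulVec_le (hA : IsPrimitiveStochastic A) (hN : 0 < N)
    (n : ℕ) {y : Fin N → ℝ} (hy : (Vinf A).mulVec y = 0) :
    wnorm A ((A ^ n).mulVec y) ≤ rho1 A ^ n * wnorm A y := by
  induction n with
  | zero => simp
  | succ n ih =>
    have h0 : (Vinf A).mulVec ((A ^ n).mulVec y) = 0 := by
      rw [Matrix.mulVec_mulVec, hA.Vinf_mul_pow, hy]
    have := wnorm_sub_Vinf_mulVec_le hN hA.vinf_pos ((A ^ n).mulVec y)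
    rw [Matrix.sub_mulVec, h0, sub_zero, Matrix.mulVec_mulVec, ← pow_succ'] at this
    calc _ ≤ _ := this
      _ ≤ rho1 A * (rho1 A ^ n * wnorm A y) := mul_le_mul_of_nonneg_left ih rho1_nonneg
      _ = _ := by ring

lemma inv_diagonal_of_ne_zero {d : Fin N → ℝ} (hd : ∀ i, d i ≠ 0) :
    (Matrix.diagonal d)⁻¹ = Matrix.diagonal fun i => (d i)⁻¹ := by
  refine Matrix.inv_eq_right_inv ?_
  rw [Matrix.diagonal_mul_diagonal, ← Matrix.diagonal_one]
  congr 1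
  funext i
  exact mul_inv_cancel₀ (hd i)

lemma IsPrimitiveStochastic.norm_div_diag_le (hA : IsPrimitiveStochastic A) (n : ℕ)
    (u : Fin N → ℝ) :
    ‖(WithLp.toLp 2 (fun i => u i / (A ^ n) i i) : EuclideanSpace ℝ (Fin N))‖
      ≤ rhoSup A * ‖(WithLp.toLp 2 u : EuclideanSpace ℝ (Fin N))‖ := by
  have hinv : ∀ k : ℕ, (Matrix.diagonal (A ^ k).diag)⁻¹
      = Matrix.diagonal fun i => ((A ^ k) i i)⁻¹ := fun k =>
    inv_diagonal_of_ne_zero fun i => (hA.pow_diag_pos k i).ne'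
  -- The supremum in `rhoSup` is a genuine one: the inverse diagonals converge to the inverse of
  -- `diag v`, so their norms are bounded.
  have hlim : Tendsto (fun k : ℕ => opNorm ((Matrix.diagonal (A ^ k).diag)⁻¹)) atTop
      (𝓝 (opNorm (Matrix.diagonal fun i => (vinf A i)⁻¹))) := by
    simp only [hinv]
    refine (continuous_opNorm.tendsto _).comp ?_
    have hc : Continuous fun d : Fin N → ℝ => Matrix.diagonal d :=
      continuous_id.matrix_diagonal
    refine (hc.tendsto _).comp (tendsto_pi_nhds.mpr fun i => ?_)
    exact (hA.tendsto_pow_apply i i).inv₀ (hA.vinf_pos i).ne'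
  have h1 : opNorm ((Matrix.diagonal (A ^ n).diag)⁻¹) ≤ rhoSup A :=
    le_ciSup hlim.bddAbove_range n
  have h2 := norm_mulVec_le_opNorm ((Matrix.diagonal (A ^ n).diag)⁻¹) u
  have h3 : ((Matrix.diagonal (A ^ n).diag)⁻¹).mulVec u = fun i => u i / (A ^ n) i i := by
    rw [hinv]
    funext i
    rw [Matrix.mulVec_diagonal, div_eq_inv_mul]
  rw [h3] at h2
  exact h2.trans (mul_le_mul_of_nonneg_right h1 (norm_nonneg _))

end Constants

/-! ### The largest eigenvalue of a symmetric 2 × 2 matrix -/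

lemma mem_spectrum_two (a b c r : ℝ) :
    r ∈ spectrum ℝ (!![a, b; b, c] : Matrix (Fin 2) (Fin 2) ℝ) ↔ (r - a) * (r - c) = b * b := by
  rw [spectrum.mem_iff, Matrix.isUnit_iff_isUnit_det, isUnit_iff_ne_zero, not_not,
    Matrix.det_fin_two]
  simp [Matrix.algebraMap_matrix_apply, sub_eq_zero]

lemma lamMax_two (a b c : ℝ) :
    lamMax !![a, b; b, c] = (a + c) / 2 + Real.sqrt (((a - c) / 2) ^ 2 + b ^ 2) := by
  set s := Real.sqrt (((a - c) / 2) ^ 2 + b ^ 2) with hs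
  have hss : s ^ 2 = ((a - c) / 2) ^ 2 + b ^ 2 := Real.sq_sqrt (by positivity)
  have hs0 : 0 ≤ s := Real.sqrt_nonneg _
  refine IsGreatest.csSup_eq ⟨?_, fun r hr => ?_⟩
  · rw [mem_spectrum_two]
    nlinarith
  · rw [mem_spectrum_two] at hr
    by_contra! h
    nlinarith

/-- With λ the largest eigenvalue, the numbers `P = λ - a` and `Q = λ - c` are nonnegative with `P *
Q = b ^ 2`. The quadratic form bound is then the inequality `2 √P √Q |y| |z| ≤ P y² + Q z²`. -/
lemma lamMax_two_facts (a b c : ℝ) :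
    a ≤ lamMax !![a, b; b, c] ∧ c ≤ lamMax !![a, b; b, c] ∧
      ∀ y z : ℝ, a * y ^ 2 + 2 * b * y * z + c * z ^ 2
        ≤ lamMax !![a, b; b, c] * (y ^ 2 + z ^ 2) := by
  rw [lamMax_two]
  set s := Real.sqrt (((a - c) / 2) ^ 2 + b ^ 2) with hs
  have hss : s ^ 2 = ((a - c) / 2) ^ 2 + b ^ 2 := Real.sq_sqrt (by positivity)
  have hs0 : 0 ≤ s := Real.sqrt_nonneg _
  have h1 : |(a - c) / 2| ≤ s := by
    rw [hs]
    refine Real.abs_le_sqrt ?_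
    nlinarith [sq_nonneg b]
  obtain ⟨h2, h3⟩ := abs_le.mp h1
  refine ⟨by linarith, by linarith, fun y z => ?_⟩
  set P := (c - a) / 2 + s with hP
  set Q := (a - c) / 2 + s with hQ
  have hP0 : 0 ≤ P := by linarith
  have hQ0 : 0 ≤ Q := by linarith
  have hPQ : b ^ 2 = P * Q := by rw [hP, hQ]; nlinarith
  have hab : |b| = Real.sqrt P * Real.sqrt Q := by
    rw [← Real.sqrt_mul hP0, ← hPQ, Real.sqrt_sq_eq_abs]
  have key : 2 * b * y * z ≤ P * y ^ 2 + Q * z ^ 2 := by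
    have e1 := Real.sq_sqrt hP0
    have e2 := Real.sq_sqrt hQ0
    have : 2 * b * y * z ≤ 2 * (|b| * |y| * |z|) := by
      rw [← abs_mul, ← abs_mul]
      linarith [le_abs_self (b * y * z)]
    rw [hab] at this
    nlinarith [sq_nonneg (Real.sqrt P * |y| - Real.sqrt Q * |z|), sq_abs y, sq_abs z]
  have e : ((a + c) / 2 + s) * (y ^ 2 + z ^ 2)
      = a * y ^ 2 + c * z ^ 2 + (P * y ^ 2 + Q * z ^ 2) := by rw [hP, hQ]; ring
  rw [e]
  linarith

/-! ### A perturbed contraction -/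

/-- Once `η ≤ L + ε / 2`, the excess of `a` over `L + ε / 2` is multiplied by at most `1 - γ ≤ exp
(-γ)` in each step, and the product of these factors tends to 0. The positive part of the initial
excess keeps the bound monotone in the factor. -/
lemma eventually_le_of_perturbed_contraction {a γ η : ℕ → ℝ} {L : ℝ}
    (hγ0 : ∀ᶠ n in atTop, 0 ≤ γ n) (hγ1 : ∀ᶠ n in atTop, γ n ≤ 1)
    (hγ : Tendsto (fun n => ∑ i ∈ Finset.range n, γ i) atTop atTop)
    (hη : Tendsto η atTop (𝓝 L))
    (ha : ∀ᶠ n in atTop, a (n + 1) ≤ (1 - γ n) * a n + γ n * η n) {ε : ℝ} (hε : 0 < ε) :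
    ∀ᶠ n in atTop, a n ≤ L + ε := by
  have hη' : ∀ᶠ n in atTop, η n ≤ L + ε / 2 :=
    hη.eventually (eventually_le_nhds (by linarith))
  obtain ⟨K, hK⟩ := eventually_atTop.mp (((hγ0.and hγ1).and hη').and ha)
  have hd : ∀ n, K ≤ n → a n - (L + ε / 2)
      ≤ Real.exp (-(∑ i ∈ Finset.range n, γ i - ∑ i ∈ Finset.range K, γ i))
        * max (a K - (L + ε / 2)) 0 := by
    intro n hn
    induction n, hn using Nat.le_induction with
    | base => simp
    | succ n hn ih =>
      obtain ⟨⟨⟨h0, h1⟩, h2⟩, h3⟩ := hK n hn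
      have h4 : a (n + 1) - (L + ε / 2) ≤ (1 - γ n) * (a n - (L + ε / 2)) := by
        nlinarith [mul_le_mul_of_nonneg_left h2 h0]
      have h5 : 1 - γ n ≤ Real.exp (-γ n) := by linarith [Real.add_one_le_exp (-γ n)]
      rw [Finset.sum_range_succ, show -(∑ i ∈ Finset.range n, γ i + γ n
        - ∑ i ∈ Finset.range K, γ i) = -γ n + -(∑ i ∈ Finset.range n, γ i
          - ∑ i ∈ Finset.range K, γ i) by ring, Real.exp_add, mul_assoc]
      refine h4.trans ((mul_le_mul_of_nonneg_left ih (by linarith)).trans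
        (mul_le_mul_of_nonneg_right h5 (by positivity)))
  have hlim : Tendsto (fun n => Real.exp (-(∑ i ∈ Finset.range n, γ i
      - ∑ i ∈ Finset.range K, γ i)) * max (a K - (L + ε / 2)) 0) atTop (𝓝 0) := by
    have h1 : Tendsto (fun n => ∑ i ∈ Finset.range n, γ i - ∑ i ∈ Finset.range K, γ i)
        atTop atTop := tendsto_atTop_add_const_right _ _ hγ
    simpa using (Real.tendsto_exp_neg_atTop_nhds_zero.comp h1).mul_const
      (max (a K - (L + ε / 2)) 0)
  filter_upwards [eventually_ge_atTop K,
    hlim.eventually (eventually_le_nhds (show (0 : ℝ) < ε / 2 by linarith))] with n hn h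
  linarith [hd n hn]

lemma tendsto_zero_of_perturbed_contraction {a γ η : ℕ → ℝ} (ha0 : ∀ n, 0 ≤ a n)
    (hγ0 : ∀ᶠ n in atTop, 0 ≤ γ n) (hγ1 : ∀ᶠ n in atTop, γ n ≤ 1)
    (hγ : Tendsto (fun n => ∑ i ∈ Finset.range n, γ i) atTop atTop)
    (hη : Tendsto η atTop (𝓝 0))
    (ha : ∀ᶠ n in atTop, a (n + 1) ≤ (1 - γ n) * a n + γ n * η n) :
    Tendsto a atTop (𝓝 0) := by
  rw [Metric.tendsto_atTop]
  intro ε hε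
  obtain ⟨K, hK⟩ := eventually_atTop.mp
    (eventually_le_of_perturbed_contraction hγ0 hγ1 hγ hη ha (half_pos hε))
  refine ⟨K, fun n hn => ?_⟩
  rw [Real.dist_eq, sub_zero, abs_of_nonneg (ha0 n)]
  linarith [hK n hn]

lemma tendsto_sum_const_atTop {c : ℝ} (hc : 0 < c) :
    Tendsto (fun n => ∑ _i ∈ Finset.range n, c) atTop atTop := by
  simp only [Finset.sum_const, Finset.card_range, nsmul_eq_mul]
  exact tendsto_natCast_atTop_atTop.atTop_mul_const hc

/-! ### Projections -/

section Projection

variable {K : Set (Strat p)}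

lemma proj_spec (hne : K.Nonempty) (hc : IsCompact K) (hconv : Convex ℝ K) (u : Strat p) :
    proj K u ∈ K ∧ ∀ z ∈ K, inner ℝ (u - proj K u) (z - proj K u) ≤ 0 := by
  have hex : ∃ y, y ∈ K ∧ ∀ z ∈ K, ‖u - y‖ ≤ ‖u - z‖ := by
    obtain ⟨y, hy, h⟩ := hc.exists_isMinOn (f := fun z => ‖u - z‖) hne (by fun_prop)
    exact ⟨y, hy, fun z hz => h hz⟩
  obtain ⟨h1, h2⟩ : proj K u ∈ K ∧ ∀ z ∈ K, ‖u - proj K u‖ ≤ ‖u - z‖ :=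
    Classical.epsilon_spec hex
  refine ⟨h1, (norm_eq_iInf_iff_real_inner_le_zero hconv h1).mp (le_antisymm ?_ ?_)⟩
  · have : Nonempty K := ⟨⟨_, h1⟩⟩
    exact le_ciInf fun w => h2 w w.2
  · exact ciInf_le ⟨0, Set.forall_mem_range.mpr fun _ => norm_nonneg _⟩ (⟨_, h1⟩ : K)

lemma norm_proj_sub_le (hne : K.Nonempty) (hc : IsCompact K) (hconv : Convex ℝ K) (u : Strat p)
    {z : Strat p} (hz : z ∈ K) : ‖proj K u - z‖ ≤ ‖u - z‖ := by
  have h := (proj_spec hne hc hconv u).2 z hz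
  refine le_of_sq_le_sq ?_ (norm_nonneg _)
  have e : u - z = (u - proj K u) - (z - proj K u) := by abel
  rw [e, norm_sub_sq_real (u - proj K u), norm_sub_rev (proj K u) z]
  nlinarith [sq_nonneg ‖u - proj K u‖]

/-- The sum of the variational inequalities at the two projections gives `‖a - b‖² ≤ ⟪u - w, a -
b⟫`. The resulting continuity serves the measurability of the iterates. -/
lemma lipschitzWith_proj (hne : K.Nonempty) (hc : IsCompact K) (hconv : Convex ℝ K) :
    LipschitzWith 1 (proj K) := by
  refine LipschitzWith.of_dist_le_mul fun u w => ?_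
  rw [NNReal.coe_one, one_mul, dist_eq_norm, dist_eq_norm]
  obtain ⟨hu, hu'⟩ := proj_spec hne hc hconv u
  obtain ⟨hw, hw'⟩ := proj_spec hne hc hconv w
  have h1 := hu' _ hw
  have h2 := hw' _ hu
  set a := proj K u
  set b := proj K w
  have e : inner ℝ (u - w) (a - b) = ‖a - b‖ ^ 2 - inner ℝ (u - a) (b - a)
      - inner ℝ (w - b) (a - b) := by
    rw [← real_inner_self_eq_norm_sq]
    simp only [inner_sub_left, inner_sub_right, real_inner_comm]
    ring
  have h3 := real_inner_le_norm (u - w) (a - b)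
  have h4 : ‖a - b‖ ^ 2 ≤ ‖u - w‖ * ‖a - b‖ := by linarith
  rcases (norm_nonneg (a - b)).eq_or_lt with h | h
  · rw [← h]; exact norm_nonneg _
  · nlinarith

end Projection

/-! ### Consequences of the regularity of the game -/

namespace Game

variable {g : Game N p}

lemma aggOthers_add (x : Fin N → Strat p) (i : Fin N) :
    g.aggOthers x i + g.φ i (x i) = g.agg x :=
  Finset.sum_erase_add _ _ (Finset.mem_univ i)

/-- Writing `G` through the total derivative of the cost in both arguments gives both the chain rule
and the joint continuity of `G`. -/
lemma G_eq {i : Fin N} {U : Set (Strat p)} (hU : IsOpen U)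
    (hf : ContDiffOn ℝ 1 (fun q : Strat p × ℝ => g.f i q.1 q.2) (U ×ˢ Set.univ))
    {y : Strat p} (hy : y ∈ U) (s : ℝ) :
    g.G i y s = (InnerProductSpace.toDual ℝ (Strat p)).symm
        ((fderiv ℝ (fun q : Strat p × ℝ => g.f i q.1 q.2) (y, s)).comp
          (ContinuousLinearMap.inl ℝ (Strat p) ℝ))
      + fderiv ℝ (fun q : Strat p × ℝ => g.f i q.1 q.2) (y, s) (0, 1) •
        (InnerProductSpace.toDual ℝ (Strat p)).symm (fderiv ℝ (g.φ i) y) := by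
  have hd : HasFDerivAt (fun q : Strat p × ℝ => g.f i q.1 q.2)
      (fderiv ℝ (fun q : Strat p × ℝ => g.f i q.1 q.2) (y, s)) (y, s) :=
    ((hf.differentiableOn one_ne_zero).differentiableAt
      ((hU.prod isOpen_univ).mem_nhds ⟨hy, Set.mem_univ s⟩)).hasFDerivAt
  have h1 : HasFDerivAt (fun z => g.f i z s)
      ((fderiv ℝ (fun q : Strat p × ℝ => g.f i q.1 q.2) (y, s)).comp
        (ContinuousLinearMap.inl ℝ (Strat p) ℝ)) y :=
    HasFDerivAt.comp (g := fun q : Strat p × ℝ => g.f i q.1 q.2) y hd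
      (hasFDerivAt_prodMk_left (𝕜 := ℝ) y s)
  have h2 : HasDerivAt (fun t => g.f i y t)
      (fderiv ℝ (fun q : Strat p × ℝ => g.f i q.1 q.2) (y, s) (0, 1)) s :=
    HasFDerivAt.comp_hasDerivAt (l := fun q : Strat p × ℝ => g.f i q.1 q.2) s hd
      ((hasDerivAt_const s y).prodMk (hasDerivAt_id s))
  rw [Game.G, gradient, h1.fderiv, h2.deriv, gradient]

/-- This chain rule links the equilibrium condition, a minimisation over the own strategy with `φ i`
varying along, to the map `G`. -/
lemma hasFDerivAt_cost {i : Fin N} {U : Set (Strat p)} (hU : IsOpen U)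
    (hf : ContDiffOn ℝ 1 (fun q : Strat p × ℝ => g.f i q.1 q.2) (U ×ˢ Set.univ))
    (hφ : ContDiffOn ℝ 1 (g.φ i) U) {y : Strat p} (hy : y ∈ U) (c : ℝ) :
    HasFDerivAt (fun z => g.f i z (c + g.φ i z))
      (InnerProductSpace.toDual ℝ (Strat p) (g.G i y (c + g.φ i y))) y := by
  have hd : HasFDerivAt (fun q : Strat p × ℝ => g.f i q.1 q.2)
      (fderiv ℝ (fun q : Strat p × ℝ => g.f i q.1 q.2) (y, c + g.φ i y)) (y, c + g.φ i y) :=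
    ((hf.differentiableOn one_ne_zero).differentiableAt
      ((hU.prod isOpen_univ).mem_nhds ⟨hy, Set.mem_univ _⟩)).hasFDerivAt
  have hφd : HasFDerivAt (g.φ i) (fderiv ℝ (g.φ i) y) y :=
    ((hφ.differentiableOn one_ne_zero).differentiableAt (hU.mem_nhds hy)).hasFDerivAt
  have h := hd.comp y ((hasFDerivAt_id y).prodMk (hφd.const_add c))
  refine h.congr_fderiv ?_
  ext v
  rw [G_eq hU hf hy]
  set F' := fderiv ℝ (fun q : Strat p × ℝ => g.f i q.1 q.2) (y, c + g.φ i y)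
  have e : ((v, fderiv ℝ (g.φ i) y v) : Strat p × ℝ)
      = (v, 0) + fderiv ℝ (g.φ i) y v • (0, 1) := by simp
  simp only [InnerProductSpace.toDual_apply_apply, inner_add_left, inner_smul_left,
    InnerProductSpace.toDual_symm_apply, ContinuousLinearMap.comp_apply,
    ContinuousLinearMap.inl_apply, ContinuousLinearMap.prod_apply,
    ContinuousLinearMap.id_apply]
  rw [e, map_add, map_smul]
  simp [mul_comm]

lemma continuousOn_G (hreg : g.Regular) (i : Fin N) :
    ContinuousOn (fun q : Strat p × ℝ => g.G i q.1 q.2) (g.Ω i ×ˢ Set.univ) := by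
  obtain ⟨U, hU, hΩ, hf, hφ⟩ := hreg.smooth i
  refine ContinuousOn.mono (s := U ×ˢ Set.univ) ?_ (Set.prod_mono hΩ subset_rfl)
  have h1 := hf.continuousOn_fderiv_of_isOpen (hU.prod isOpen_univ) le_rfl
  have h2 := hφ.continuousOn_fderiv_of_isOpen hU le_rfl
  have h2' : ContinuousOn (fun q : Strat p × ℝ => fderiv ℝ (g.φ i) q.1) (U ×ˢ Set.univ) :=
    h2.comp continuousOn_fst fun q hq => hq.1
  have hd := (InnerProductSpace.toDual ℝ (Strat p)).symm.continuous
  refine ContinuousOn.congr (f := fun q : Strat p × ℝ =>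
    (InnerProductSpace.toDual ℝ (Strat p)).symm
        ((fderiv ℝ (fun q : Strat p × ℝ => g.f i q.1 q.2) q).comp
          (ContinuousLinearMap.inl ℝ (Strat p) ℝ))
      + fderiv ℝ (fun q : Strat p × ℝ => g.f i q.1 q.2) q (0, 1) •
        (InnerProductSpace.toDual ℝ (Strat p)).symm (fderiv ℝ (g.φ i) q.1)) ?_
    fun q hq => G_eq hU hf hq.1 q.2
  refine ContinuousOn.add ?_ (ContinuousOn.smul (h1.clm_apply continuousOn_const) ?_)
  · exact hd.comp_continuousOn (h1.clm_comp continuousOn_const)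
  · exact hd.comp_continuousOn h2'

lemma continuousOn_phi (hreg : g.Regular) (i : Fin N) : ContinuousOn (g.φ i) (g.Ω i) := by
  obtain ⟨U, hU, hΩ, hf, hφ⟩ := hreg.smooth i
  exact hφ.continuousOn.mono hΩ

lemma exists_phi_bound (hreg : g.Regular) :
    ∃ R, 0 ≤ R ∧ ∀ i, ∀ y ∈ g.Ω i, |g.φ i y| ≤ R := by
  choose R hR using fun i => (hreg.compact i).exists_bound_of_continuousOn
    (continuousOn_phi hreg i)
  refine ⟨∑ i, |R i|, Finset.sum_nonneg fun i _ => abs_nonneg _, fun i y hy => ?_⟩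
  exact (hR i y hy).trans ((le_abs_self _).trans
    (Finset.single_le_sum (f := fun i => |R i|) (fun _ _ => abs_nonneg _) (Finset.mem_univ i)))

lemma exists_norm_bound (hreg : g.Regular) : ∃ R, 0 ≤ R ∧ ∀ i, ∀ y ∈ g.Ω i, ‖y‖ ≤ R := by
  choose R hR using fun i => (hreg.compact i).exists_bound_of_continuousOn continuousOn_id
  refine ⟨∑ i, |R i|, Finset.sum_nonneg fun i _ => abs_nonneg _, fun i y hy => ?_⟩
  exact (hR i y hy).trans ((le_abs_self _).trans
    (Finset.single_le_sum (f := fun i => |R i|) (fun _ _ => abs_nonneg _) (Finset.mem_univ i)))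

lemma profile_norm_le {y : Fin N → Strat p} {R : ℝ} (h : ∀ i, ‖y i‖ ≤ R) :
    ‖(WithLp.toLp 2 y : Profile N p)‖ ≤ Real.sqrt (N * R ^ 2) := by
  rw [PiLp.norm_eq_of_L2]
  refine Real.sqrt_le_sqrt ?_
  calc ∑ i, ‖y i‖ ^ 2 ≤ ∑ _i : Fin N, R ^ 2 :=
        Finset.sum_le_sum fun i _ => pow_le_pow_left₀ (norm_nonneg _) (h i) 2
    _ = N * R ^ 2 := by simp

lemma exists_Gvec_bound (hreg : g.Regular) (R : ℝ) :
    ∃ M, ∀ x, g.Feasible x → ∀ s : Fin N → ℝ, (∀ i, |s i| ≤ R) → ‖g.Gvec x s‖ ≤ M := by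
  choose M hM using fun i =>
    ((hreg.compact i).prod (isCompact_Icc (a := -R) (b := R))).exists_bound_of_continuousOn
      ((continuousOn_G hreg i).mono (Set.prod_mono subset_rfl (Set.subset_univ _)))
  refine ⟨Real.sqrt (N * (∑ i, |M i|) ^ 2), fun x hx s hs => profile_norm_le fun i => ?_⟩
  exact (hM i (x i, s i) ⟨hx i, abs_le.mp (hs i)⟩).trans ((le_abs_self _).trans
    (Finset.single_le_sum (f := fun i => |M i|) (fun _ _ => abs_nonneg _) (Finset.mem_univ i)))

/-- The variational inequality of the Nash equilibrium. -/
lemma IsNash.inner_nonneg (hreg : g.Regular) {x : Fin N → Strat p} (hx : g.IsNash x) (i : Fin N)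
    {y : Strat p} (hy : y ∈ g.Ω i) : 0 ≤ inner ℝ (g.G i (x i) (g.agg x)) (y - x i) := by
  obtain ⟨U, hU, hΩ, hf, hφ⟩ := hreg.smooth i
  have h := hasFDerivAt_cost hU hf hφ (hΩ (hx.1 i)) (g.aggOthers x i)
  rw [aggOthers_add] at h
  have hmin : IsLocalMinOn (fun z => g.f i z (g.aggOthers x i + g.φ i z)) (g.Ω i) (x i) := by
    refine IsMinOn.localize fun z hz => ?_
    have := hx.2 i z hz
    rw [← aggOthers_add x i] at this
    exact this
  have := hmin.hasFDerivWithinAt_nonneg h.hasFDerivWithinAt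
    (sub_mem_posTangentConeAt_of_segment_subset ((hreg.convex i).segment_subset (hx.1 i) hy))
  simpa using this

end Game

/-! ### One projected gradient step -/

/-- The strategies after one projected gradient step. -/
noncomputable def projStep (g : Game N p) (α : ℝ) (x : Fin N → Strat p) (σ : Fin N → ℝ) :
    Fin N → Strat p :=
  fun i => proj (g.Ω i) (x i - α • g.G i (x i) (σ i))

section Step

variable {g : Game N p}

lemma projStep_feasible (hreg : g.Regular) (α : ℝ) (x : Fin N → Strat p) (σ : Fin N → ℝ) :
    g.Feasible (projStep g α x σ) := fun i =>
  (proj_spec (hreg.nonempty i) (hreg.compact i) (hreg.convex i) _).1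

lemma norm_projStep_sub_le (hreg : g.Regular) (α : ℝ) (x : Fin N → Strat p) (σ : Fin N → ℝ)
    {z : Fin N → Strat p} (hz : g.Feasible z) :
    ‖(WithLp.toLp 2 (projStep g α x σ) : Profile N p) - WithLp.toLp 2 z‖
      ≤ ‖(WithLp.toLp 2 x : Profile N p) - α • g.Gvec x σ - WithLp.toLp 2 z‖ := by
  refine le_of_sq_le_sq ?_ (norm_nonneg _)
  rw [PiLp.norm_sq_eq_of_L2, PiLp.norm_sq_eq_of_L2]
  refine Finset.sum_le_sum fun i _ => pow_le_pow_left₀ (norm_nonneg _) ?_ 2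
  exact norm_proj_sub_le (hreg.nonempty i) (hreg.compact i) (hreg.convex i) _ (hz i)

lemma norm_projStep_sub_self_le (hreg : g.Regular) {α : ℝ} (hα : 0 ≤ α) {x : Fin N → Strat p}
    (hx : g.Feasible x) (σ : Fin N → ℝ) :
    ‖(WithLp.toLp 2 (projStep g α x σ) : Profile N p) - WithLp.toLp 2 x‖
      ≤ α * ‖g.Gvec x σ‖ := by
  refine (norm_projStep_sub_le hreg α x σ hx).trans (le_of_eq ?_)
  rw [sub_sub_cancel_left, norm_neg, norm_smul, Real.norm_of_nonneg hα]

lemma norm_phi_sub_le {L₂ L₃ : ℝ} (hL₃ : 0 ≤ L₃) (hlip : g.LipschitzConsts L₂ L₃)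
    {x y : Fin N → Strat p} (hx : g.Feasible x) (hy : g.Feasible y) :
    ‖(WithLp.toLp 2 (fun i => g.φ i (y i) - g.φ i (x i)) : EuclideanSpace ℝ (Fin N))‖
      ≤ L₃ * ‖(WithLp.toLp 2 y : Profile N p) - WithLp.toLp 2 x‖ := by
  refine le_of_sq_le_sq ?_ (by positivity)
  rw [toLp_norm_sq, mul_pow, PiLp.norm_sq_eq_of_L2, Finset.mul_sum]
  refine Finset.sum_le_sum fun i _ => ?_
  rw [← sq_abs, ← mul_pow]
  exact pow_le_pow_left₀ (abs_nonneg _) (hlip.phi i _ (hy i) _ (hx i)) 2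

/-- Projection does not increase the distance to the feasible point `xs`, so it suffices to expand
the square of an unprojected step. The linear term is controlled by strong monotonicity, the
variational inequality at `xs`, and the Lipschitz bound on the error of the aggregate estimates. -/
lemma sq_norm_projStep_sub_le (hreg : g.Regular) {μ L₂ L₃ : ℝ} (hmono : g.StronglyMonotone μ)
    (hlip : g.LipschitzConsts L₂ L₃) {xs : Profile N p} (hxs : g.IsNash xs) {α : ℝ}
    (hα : 0 ≤ α) {x : Fin N → Strat p} (hx : g.Feasible x) (σ : Fin N → ℝ) :
    ‖(WithLp.toLp 2 (projStep g α x σ) : Profile N p) - xs‖ ^ 2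
      ≤ (1 - 2 * α * μ) * ‖(WithLp.toLp 2 x : Profile N p) - xs‖ ^ 2
        + 2 * α * (L₂ * ‖(WithLp.toLp 2 (fun i => σ i - g.agg x) : EuclideanSpace ℝ (Fin N))‖
          * ‖(WithLp.toLp 2 x : Profile N p) - xs‖)
        + α ^ 2 * ‖g.Gvec x σ‖ ^ 2 := by
  set X : Profile N p := WithLp.toLp 2 x with hX
  have h0 : ‖(WithLp.toLp 2 (projStep g α x σ) : Profile N p) - xs‖ ^ 2
      ≤ ‖X - xs - α • g.Gvec x σ‖ ^ 2 := by
    refine pow_le_pow_left₀ (norm_nonneg _) ?_ 2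
    have := norm_projStep_sub_le hreg α x σ hxs.1
    rw [sub_right_comm] at this
    exact this
  have h1 : μ * ‖X - xs‖ ^ 2 ≤ inner ℝ (g.pseudoGrad x - g.pseudoGrad xs) (X - xs) :=
    hmono X xs hx hxs.1
  have h2 : 0 ≤ inner ℝ (g.pseudoGrad xs) (X - xs) := by
    rw [PiLp.inner_apply]
    exact Finset.sum_nonneg fun i _ => hxs.inner_nonneg hreg i (hx i)
  have h3 : ‖g.Gvec x σ - g.pseudoGrad x‖
      ≤ L₂ * ‖(WithLp.toLp 2 (fun i => σ i - g.agg x) : EuclideanSpace ℝ (Fin N))‖ :=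
    hlip.grad x hx (WithLp.toLp 2 σ) (WithLp.toLp 2 fun _ => g.agg x)
  have h4 : -inner ℝ (g.Gvec x σ - g.pseudoGrad x) (X - xs)
      ≤ L₂ * ‖(WithLp.toLp 2 (fun i => σ i - g.agg x) : EuclideanSpace ℝ (Fin N))‖
        * ‖X - xs‖ := by
    have := neg_le_of_abs_le (abs_real_inner_le_norm (g.Gvec x σ - g.pseudoGrad x) (X - xs))
    have := mul_le_mul_of_nonneg_right h3 (norm_nonneg (X - xs))
    linarith
  -- Estimation error, monotone part and equilibrium part; the last one is nonnegative.
  have e : inner ℝ (X - xs) (α • g.Gvec x σ) = α * (inner ℝ (g.Gvec x σ - g.pseudoGrad x) (X - xs)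
      + inner ℝ (g.pseudoGrad x - g.pseudoGrad xs) (X - xs)
      + inner ℝ (g.pseudoGrad xs) (X - xs)) := by
    rw [inner_smul_right, real_inner_comm, ← inner_add_left, ← inner_add_left]
    congr 2
    abel
  refine h0.trans ?_
  rw [norm_sub_sq_real, e, norm_smul, mul_pow, Real.norm_eq_abs, sq_abs]
  nlinarith [mul_le_mul_of_nonneg_left h1 hα, mul_nonneg hα h2, mul_le_mul_of_nonneg_left h4 hα]

end Step

/-! ### The fast algorithm with variable step-sizes and numbers of rounds -/

/-- The fast algorithm with step-sizes `α n` and numbers of rounds `S n`. -/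
noncomputable def varRun (g : Game N p) (A : Matrix (Fin N) (Fin N) ℝ) (α : ℕ → ℝ) (S : ℕ → ℕ)
    (x1 : Fin N → Strat p) : ℕ → FastState N p
  | 0 => { x := x1, σ := fun i => g.φ i (x1 i), V := 1 }
  | n + 1 => fastStep g A (α n) (S n) (varRun g A α S x1 n)

/-- Variable sequences are needed because a restart at iteration `K` continues with the original
sequences shifted by `K`. Constant sequences are invariant under the shift. -/
lemma fastRun_eq_varRun (g : Game N p) (A : Matrix (Fin N) (Fin N) ℝ) (α : ℝ) (S : ℕ)
    (x1 : Fin N → Strat p) (n : ℕ) :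
    fastRun g A α S x1 n = varRun g A (fun _ => α) (fun _ => S) x1 n := by
  induction n with
  | zero => rfl
  | succ n ih => rw [fastRun, varRun, ih]

/-- The aggregation values divided by the diagonal weight estimates. -/
noncomputable def FastState.scaled (g : Game N p) (s : FastState N p) : Fin N → ℝ :=
  fun i => g.φ i (s.x i) / s.V i i

/-- The disagreement of the aggregate estimates. -/
noncomputable def FastState.dev (A : Matrix (Fin N) (Fin N) ℝ) (s : FastState N p) : Fin N → ℝ :=
  s.σ - (Vinf A).mulVec s.σ

section VarRun

variable {g : Game N p} {A : Matrix (Fin N) (Fin N) ℝ} {α : ℕ → ℝ} {S : ℕ → ℕ}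
  {x1 : Fin N → Strat p}

lemma varRun_x_succ (n : ℕ) : (varRun g A α S x1 (n + 1)).x
    = projStep g (α n) (varRun g A α S x1 n).x (varRun g A α S x1 n).σ := rfl

lemma varRun_V (n : ℕ) :
    (varRun g A α S x1 n).V = A ^ (∑ i ∈ Finset.range n, S i) := by
  induction n with
  | zero => simp [varRun]
  | succ n ih =>
    rw [Finset.sum_range_succ, add_comm (∑ i ∈ Finset.range n, S i), pow_add, ← ih]
    rfl

lemma varRun_feasible (hreg : g.Regular) (hx1 : g.Feasible x1) (n : ℕ) :
    g.Feasible (varRun g A α S x1 n).x := by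
  cases n with
  | zero => exact hx1
  | succ n => exact projStep_feasible hreg _ _ _

lemma varRun_σ_succ (n : ℕ) : (varRun g A α S x1 (n + 1)).σ
    = (A ^ S n).mulVec (varRun g A α S x1 n).σ
      + ((varRun g A α S x1 (n + 1)).scaled g - (varRun g A α S x1 n).scaled g) := by
  funext i
  exact add_sub_assoc _ _ _

/-- A conservation law: averaging with `A` preserves the `v`-average, so the increments of the
scaled values telescope. Both sides agree at the start because `V = 1` there. -/
lemma Vinf_mulVec_varRun_σ (hA : IsPrimitiveStochastic A) (n : ℕ) :
    (Vinf A).mulVec (varRun g A α S x1 n).σ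
      = (Vinf A).mulVec ((varRun g A α S x1 n).scaled g) := by
  induction n with
  | zero =>
    congr 1
    funext i
    simp [varRun, FastState.scaled]
  | succ n ih =>
    rw [varRun_σ_succ, Matrix.mulVec_add, Matrix.mulVec_mulVec, hA.Vinf_mul_pow, ih,
      Matrix.mulVec_sub]
    abel

lemma varRun_dev_succ (hA : IsPrimitiveStochastic A) (n : ℕ) :
    (varRun g A α S x1 (n + 1)).dev A = (A ^ S n).mulVec ((varRun g A α S x1 n).dev A)
      + (1 - Vinf A).mulVec
        ((varRun g A α S x1 (n + 1)).scaled g - (varRun g A α S x1 n).scaled g) := by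
  simp only [FastState.dev]
  conv_lhs => rw [varRun_σ_succ]
  simp only [Matrix.mulVec_add, Matrix.mulVec_mulVec, hA.Vinf_mul_pow, Matrix.mulVec_sub,
    hA.pow_mul_Vinf, Matrix.sub_mulVec, Matrix.one_mulVec]
  abel

lemma IsPrimitiveStochastic.Vinf_mulVec_dev (hA : IsPrimitiveStochastic A) (s : FastState N p) :
    (Vinf A).mulVec (s.dev A) = 0 := by
  rw [FastState.dev, Matrix.mulVec_sub, Matrix.mulVec_mulVec, hA.Vinf_mul_Vinf, sub_self]

lemma tendsto_varRun_V (hA : IsPrimitiveStochastic A) (hS : ∀ n, 1 ≤ S n) (i : Fin N) :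
    Tendsto (fun n => (varRun g A α S x1 n).V i i) atTop (𝓝 (vinf A i)) := by
  simp only [varRun_V]
  refine (hA.tendsto_pow_apply i i).comp (tendsto_atTop_mono (fun n => ?_) tendsto_id)
  calc n = ∑ _i ∈ Finset.range n, 1 := by simp
    _ ≤ _ := Finset.sum_le_sum fun i _ => hS i

lemma norm_le_norm_toLp (u : Fin N → ℝ) :
    ‖u‖ ≤ ‖(WithLp.toLp 2 u : EuclideanSpace ℝ (Fin N))‖ := by
  rw [pi_norm_le_iff_of_nonneg (norm_nonneg _)]
  exact fun i => PiLp.norm_apply_le (WithLp.toLp 2 u : EuclideanSpace ℝ (Fin N)) i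

lemma exists_scaled_bound (hA : IsPrimitiveStochastic A) (hreg : g.Regular)
    (hx1 : g.Feasible x1) : ∃ R, 0 ≤ R ∧ ∀ n, ‖(varRun g A α S x1 n).scaled g‖ ≤ R := by
  obtain ⟨R, hR0, hR⟩ := Game.exists_phi_bound hreg
  refine ⟨rhoSup A * Real.sqrt (N * R ^ 2), mul_nonneg rhoSup_nonneg (Real.sqrt_nonneg _),
    fun n => (norm_le_norm_toLp _).trans ?_⟩
  have h := hA.norm_div_diag_le (∑ i ∈ Finset.range n, S i)
    fun i => g.φ i ((varRun g A α S x1 n).x i)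
  simp only [← varRun_V (g := g) (α := α) (x1 := x1)] at h
  refine h.trans (mul_le_mul_of_nonneg_left ?_ rhoSup_nonneg)
  refine Real.le_sqrt_of_sq_le ?_
  rw [toLp_norm_sq]
  calc _ ≤ ∑ _i : Fin N, R ^ 2 := Finset.sum_le_sum fun i _ => by
          rw [← sq_abs]
          exact pow_le_pow_left₀ (abs_nonneg _) (hR i _ (varRun_feasible hreg hx1 n i)) 2
    _ = _ := by simp

/-- A single step multiplies the norm by up to `C * q`, which may exceed 1, so the norm itself need
not contract. The scalar majorant `c` carries a true contraction with factor `q`. -/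
lemma exists_dev_le (hA : IsPrimitiveStochastic A) :
    ∃ C q : ℝ, 0 < C ∧ 0 < q ∧ q < 1 ∧ ∀ (α : ℕ → ℝ) (S : ℕ → ℕ) (x1 : Fin N → Strat p),
      (∀ n, 1 ≤ S n) → ∃ c : ℕ → ℝ, (∀ n, 0 ≤ c n) ∧
        (∀ n, c (n + 1) = q * c n + ‖(varRun g A α S x1 (n + 1)).scaled g
          - (varRun g A α S x1 n).scaled g‖) ∧
        ∀ n, ‖(varRun g A α S x1 n).dev A‖ ≤ C * c n := by
  obtain ⟨C, q, hC, hq0, hq1, h⟩ := hA.exists_mulVec_sub_le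
  refine ⟨C, q, hC, hq0, hq1, fun α S x1 hS => ?_⟩
  let c : ℕ → ℝ := fun n => Nat.rec ‖(varRun g A α S x1 0).σ‖
    (fun n r => q * r + ‖(varRun g A α S x1 (n + 1)).scaled g
      - (varRun g A α S x1 n).scaled g‖) n
  have hc1 : ∀ n, c (n + 1) = q * c n + ‖(varRun g A α S x1 (n + 1)).scaled g
      - (varRun g A α S x1 n).scaled g‖ := fun n => rfl
  have hc0 : ∀ n, 0 ≤ c n := by
    intro n
    induction n with
    | zero => exact norm_nonneg _
    | succ n ih => rw [hc1]; positivity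
  -- Controlling all later powers of `A` applied to the deviation makes the constant `C` enter only
  -- once, instead of once per iteration.
  have key : ∀ n k, ‖(A ^ k).mulVec ((varRun g A α S x1 n).dev A)‖ ≤ C * q ^ k * c n := by
    intro n
    induction n with
    | zero =>
      intro k
      rw [FastState.dev, Matrix.mulVec_sub, Matrix.mulVec_mulVec, hA.pow_mul_Vinf]
      exact h k _
    | succ n ih =>
      intro k
      have h1 := ih (k + S n)
      have h2 := h k ((varRun g A α S x1 (n + 1)).scaled g - (varRun g A α S x1 n).scaled g)
      have h3 : C * q ^ (k + S n) * c n ≤ C * q ^ k * (q * c n) := by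
        have : q ^ (k + S n) ≤ q ^ k * q := by
          rw [← pow_succ]
          exact pow_le_pow_of_le_one hq0.le hq1.le (Nat.add_le_add_left (hS n) k)
        calc C * q ^ (k + S n) * c n ≤ C * (q ^ k * q) * c n := by gcongr; exact hc0 n
          _ = _ := by ring
      rw [varRun_dev_succ hA, Matrix.mulVec_add, Matrix.mulVec_mulVec, Matrix.mulVec_mulVec,
        ← pow_add, mul_sub, mul_one, hA.pow_mul_Vinf, Matrix.sub_mulVec, hc1, mul_add]
      exact (norm_add_le _ _).trans (add_le_add (h1.trans h3) h2)
  refine ⟨c, hc0, hc1, fun n => ?_⟩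
  simpa using key n 0

lemma exists_dev_bound (hA : IsPrimitiveStochastic A) (hreg : g.Regular)
    (hx1 : g.Feasible x1) (hS : ∀ n, 1 ≤ S n) :
    ∃ R, ∀ n, ‖(varRun g A α S x1 n).dev A‖ ≤ R := by
  obtain ⟨C, q, hC, hq0, hq1, h⟩ := exists_dev_le (g := g) hA
  obtain ⟨c, hc0, hc1, hc⟩ := h α S x1 hS
  obtain ⟨R, hR0, hR⟩ := exists_scaled_bound (α := α) (S := S) hA hreg hx1
  have hq : 0 < 1 - q := sub_pos.mpr hq1
  -- The value `2 * R / (1 - q)` is the fixed point of `c ↦ q * c + 2 * R`.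
  have hb : ∀ n, c n ≤ c 0 + 2 * R / (1 - q) := by
    intro n
    induction n with
    | zero => linarith [div_nonneg (mul_nonneg zero_le_two hR0) hq.le]
    | succ n ih =>
      have h1 : ‖(varRun g A α S x1 (n + 1)).scaled g - (varRun g A α S x1 n).scaled g‖
          ≤ 2 * R := (norm_sub_le _ _).trans (by linarith [hR n, hR (n + 1)])
      have h2 : 2 * R = 2 * R / (1 - q) * (1 - q) := by field_simp
      rw [hc1]
      nlinarith [mul_le_mul_of_nonneg_left ih hq0.le, hc0 0]
  exact ⟨C * (c 0 + 2 * R / (1 - q)), fun n =>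
    (hc n).trans (mul_le_mul_of_nonneg_left (hb n) hC.le)⟩

/-- An estimate is its deviation plus the `v`-average of the scaled values, and `v` is a probability
vector. -/
lemma exists_σ_bound (hA : IsPrimitiveStochastic A) (hreg : g.Regular)
    (hx1 : g.Feasible x1) (hS : ∀ n, 1 ≤ S n) :
    ∃ R, ∀ n i, |(varRun g A α S x1 n).σ i| ≤ R := by
  obtain ⟨R, hR⟩ := exists_dev_bound (α := α) hA hreg hx1 hS
  obtain ⟨R', hR0', hR'⟩ := exists_scaled_bound (α := α) (S := S) hA hreg hx1
  refine ⟨R + R', fun n i => ?_⟩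
  have e : (varRun g A α S x1 n).σ i = (varRun g A α S x1 n).dev A i
      + ∑ j, vinf A j * (varRun g A α S x1 n).scaled g j := by
    rw [← hA.Vinf_mulVec _ i, ← Vinf_mulVec_varRun_σ hA]
    simp [FastState.dev]
  rw [e]
  refine (abs_add_le _ _).trans (add_le_add ((norm_le_pi_norm _ i).trans (hR n)) ?_)
  have e1 : R' = ∑ j, vinf A j * R' := by
    rw [← Finset.sum_mul, hA.sum_vinf (Fin.pos i), one_mul]
  rw [e1]
  refine (Finset.abs_sum_le_sum_abs _ _).trans (Finset.sum_le_sum fun j _ => ?_)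
  rw [abs_mul, abs_of_pos (hA.vinf_pos j)]
  exact mul_le_mul_of_nonneg_left ((norm_le_pi_norm _ j).trans (hR' n)) (hA.vinf_pos j).le

lemma exists_grad_bound (hA : IsPrimitiveStochastic A) (hreg : g.Regular)
    (hx1 : g.Feasible x1) (hS : ∀ n, 1 ≤ S n) :
    ∃ M, ∀ n, ‖g.Gvec (varRun g A α S x1 n).x (varRun g A α S x1 n).σ‖ ≤ M := by
  obtain ⟨R, hR⟩ := exists_σ_bound (α := α) hA hreg hx1 hS
  obtain ⟨M, hM⟩ := Game.exists_Gvec_bound hreg R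
  exact ⟨M, fun n => hM _ (varRun_feasible hreg hx1 n) _ (hR n)⟩

/-- The weighted average of the estimates approaches the aggregate. -/
lemma tendsto_average_sub_agg (hA : IsPrimitiveStochastic A) (hreg : g.Regular)
    (hx1 : g.Feasible x1) (hS : ∀ n, 1 ≤ S n) :
    Tendsto (fun n i => (Vinf A).mulVec (varRun g A α S x1 n).σ i
      - g.agg (varRun g A α S x1 n).x) atTop (𝓝 (0 : Fin N → ℝ)) := by
  obtain ⟨R, hR0, hR⟩ := Game.exists_phi_bound hreg
  refine tendsto_pi_nhds.mpr fun i => ?_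
  -- By the conservation law each player contributes its bounded value `φ j` times `v j / V j j -
  -- 1`, which tends to 0.
  have e : ∀ n, (Vinf A).mulVec (varRun g A α S x1 n).σ i - g.agg (varRun g A α S x1 n).x
      = ∑ j, (vinf A j / (varRun g A α S x1 n).V j j - 1)
        * g.φ j ((varRun g A α S x1 n).x j) := by
    intro n
    rw [Vinf_mulVec_varRun_σ hA, hA.Vinf_mulVec, Game.agg, ← Finset.sum_sub_distrib]
    refine Finset.sum_congr rfl fun j _ => ?_
    rw [FastState.scaled]
    ring
  simp only [e, Pi.zero_apply]
  rw [← Finset.sum_const_zero (s := (Finset.univ : Finset (Fin N)))]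
  refine tendsto_finsetSum _ fun j _ => ?_
  refine Tendsto.zero_mul_isBoundedUnder_le ?_ ?_
  · have h := (tendsto_varRun_V (g := g) (α := α) (x1 := x1) hA hS j)
    have h1 := (tendsto_const_nhds (x := vinf A j)).div h (hA.vinf_pos j).ne'
    rw [div_self (hA.vinf_pos j).ne'] at h1
    simpa using h1.sub_const 1
  · refine isBoundedUnder_of ⟨R, fun n => ?_⟩
    exact hR j _ (varRun_feasible hreg hx1 n j)

/-- The increment of the scaled aggregation values that is due to the weight estimates. -/
lemma tendsto_weight_increment (hA : IsPrimitiveStochastic A) (hreg : g.Regular)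
    (hx1 : g.Feasible x1) (hS : ∀ n, 1 ≤ S n) :
    Tendsto (fun n i => (1 / (varRun g A α S x1 (n + 1)).V i i - 1 / (varRun g A α S x1 n).V i i)
      * g.φ i ((varRun g A α S x1 n).x i)) atTop (𝓝 (0 : Fin N → ℝ)) := by
  obtain ⟨R, hR0, hR⟩ := Game.exists_phi_bound hreg
  refine tendsto_pi_nhds.mpr fun i => Tendsto.zero_mul_isBoundedUnder_le ?_
    (isBoundedUnder_of ⟨R, fun n => hR i _ (varRun_feasible hreg hx1 n i)⟩)
  have h := (tendsto_varRun_V (g := g) (α := α) (x1 := x1) hA hS i)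
  have h1 := (tendsto_const_nhds (x := (1 : ℝ))).div h (hA.vinf_pos i).ne'
  have h2 := (h1.comp (tendsto_add_atTop_nat 1)).sub h1
  rw [sub_self] at h2
  exact h2

/-- The first part is of the order of the step-size; the second vanishes because the weights
converge, whatever the step-size. -/
lemma scaled_increment (n : ℕ) :
    (varRun g A α S x1 (n + 1)).scaled g - (varRun g A α S x1 n).scaled g
      = (fun i => (g.φ i ((varRun g A α S x1 (n + 1)).x i) - g.φ i ((varRun g A α S x1 n).x i))
          / (varRun g A α S x1 (n + 1)).V i i)
        + fun i => (1 / (varRun g A α S x1 (n + 1)).V i i - 1 / (varRun g A α S x1 n).V i i)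
          * g.φ i ((varRun g A α S x1 n).x i) := by
  funext i
  simp only [FastState.scaled, Pi.sub_apply, Pi.add_apply]
  ring

lemma norm_strategy_increment_le (hA : IsPrimitiveStochastic A) (hreg : g.Regular) {L₂ L₃ : ℝ}
    (hL₃ : 0 ≤ L₃) (hlip : g.LipschitzConsts L₂ L₃) (hx1 : g.Feasible x1) {n : ℕ}
    (hα : 0 ≤ α n) {M : ℝ}
    (hM : ‖g.Gvec (varRun g A α S x1 n).x (varRun g A α S x1 n).σ‖ ≤ M) :
    ‖(WithLp.toLp 2 (fun i => (g.φ i ((varRun g A α S x1 (n + 1)).x i)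
        - g.φ i ((varRun g A α S x1 n).x i)) / (varRun g A α S x1 (n + 1)).V i i) :
        EuclideanSpace ℝ (Fin N))‖ ≤ rhoSup A * (L₃ * (α n * M)) := by
  rw [varRun_V]
  refine (hA.norm_div_diag_le _ _).trans (mul_le_mul_of_nonneg_left ?_ rhoSup_nonneg)
  refine (norm_phi_sub_le hL₃ hlip (varRun_feasible hreg hx1 n)
    (varRun_feasible hreg hx1 (n + 1))).trans (mul_le_mul_of_nonneg_left ?_ hL₃)
  exact (norm_projStep_sub_self_le hreg hα (varRun_feasible hreg hx1 n) _).trans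
    (mul_le_mul_of_nonneg_left hM hα)

end VarRun

/-! ### Convergence of the fast algorithm -/

section Convergence

variable {g : Game N p} {A : Matrix (Fin N) (Fin N) ℝ} {α : ℕ → ℝ} {S : ℕ → ℕ}
  {x1 : Fin N → Strat p} {μ L₂ L₃ : ℝ} {xs : Profile N p}

lemma Game.exists_dist_bound (hreg : g.Regular) (xs : Profile N p) :
    ∃ R, 0 ≤ R ∧ ∀ x, g.Feasible x → ‖(WithLp.toLp 2 x : Profile N p) - xs‖ ≤ R := by
  obtain ⟨R, hR0, hR⟩ := Game.exists_norm_bound hreg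
  refine ⟨Real.sqrt (N * R ^ 2) + ‖xs‖, by positivity, fun x hx => ?_⟩
  exact (norm_sub_le _ _).trans
    (add_le_add_left (Game.profile_norm_le fun i => hR i _ (hx i)) _)

lemma σ_sub_agg_eq (n : ℕ) : (fun i => (varRun g A α S x1 n).σ i - g.agg (varRun g A α S x1 n).x)
    = (varRun g A α S x1 n).dev A + fun i => (Vinf A).mulVec (varRun g A α S x1 n).σ i
      - g.agg (varRun g A α S x1 n).x := by
  funext i
  simp [FastState.dev]

lemma tendsto_norm_toLp_zero {u : ℕ → Fin N → ℝ} (h : Tendsto u atTop (𝓝 0)) :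
    Tendsto (fun n => ‖(WithLp.toLp 2 (u n) : EuclideanSpace ℝ (Fin N))‖) atTop (𝓝 0) := by
  have hc : Continuous fun u : Fin N → ℝ => ‖(WithLp.toLp 2 u : EuclideanSpace ℝ (Fin N))‖ :=
    continuous_norm.comp (PiLp.continuous_toLp 2 _)
  simpa [Function.comp_def] using (hc.tendsto 0).comp h

lemma tendsto_dev_zero (hA : IsPrimitiveStochastic A) (hS : ∀ n, 1 ≤ S n)
    (hz : Tendsto (fun n => ‖(varRun g A α S x1 (n + 1)).scaled g
      - (varRun g A α S x1 n).scaled g‖) atTop (𝓝 0)) :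
    Tendsto (fun n => (varRun g A α S x1 n).dev A) atTop (𝓝 0) := by
  obtain ⟨C, q, hC, hq0, hq1, h⟩ := exists_dev_le (g := g) hA
  obtain ⟨c, hc0, hc1, hc⟩ := h α S x1 hS
  have hq : 0 < 1 - q := sub_pos.mpr hq1
  have hlim : Tendsto c atTop (𝓝 0) := by
    refine tendsto_zero_of_perturbed_contraction (γ := fun _ => 1 - q)
      (η := fun n => ‖(varRun g A α S x1 (n + 1)).scaled g
        - (varRun g A α S x1 n).scaled g‖ / (1 - q)) hc0 (Eventually.of_forall fun _ => hq.le)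
      (Eventually.of_forall fun _ => by linarith) (tendsto_sum_const_atTop hq) ?_
      (Eventually.of_forall fun n => ?_)
    · simpa using hz.div_const (1 - q)
    · rw [hc1, mul_div_cancel₀ _ hq.ne']
      linarith
  rw [tendsto_zero_iff_norm_tendsto_zero]
  refine squeeze_zero (fun _ => norm_nonneg _) hc ?_
  simpa using hlim.const_mul C

/-- With diminishing step-sizes the fast algorithm converges to the Nash equilibrium. -/
lemma tendsto_varRun (hA : IsPrimitiveStochastic A) (hreg : g.Regular)
    (hμ : 0 < μ) (hL₃ : 0 ≤ L₃) (hmono : g.StronglyMonotone μ)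
    (hlip : g.LipschitzConsts L₂ L₃) (hxs : g.IsNash xs) (hx1 : g.Feasible x1)
    (hS : ∀ n, 1 ≤ S n) (hα0 : ∀ n, 0 ≤ α n) (hα : Tendsto α atTop (𝓝 0))
    (hαs : Tendsto (fun n => ∑ i ∈ Finset.range n, α i) atTop atTop) :
    Tendsto (fun n => ‖(WithLp.toLp 2 (varRun g A α S x1 n).x : Profile N p) - xs‖ ^ 2) atTop
      (𝓝 0) := by
  obtain ⟨M, hM⟩ := exists_grad_bound (α := α) hA hreg hx1 hS
  obtain ⟨R, hR0, hR⟩ := Game.exists_dist_bound hreg xs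
  have hz : Tendsto (fun n => ‖(varRun g A α S x1 (n + 1)).scaled g
      - (varRun g A α S x1 n).scaled g‖) atTop (𝓝 0) := by
    have h1 : Tendsto (fun n => rhoSup A * (L₃ * (α n * M))) atTop (𝓝 0) := by
      simpa using (((hα.mul_const M).const_mul L₃).const_mul (rhoSup A))
    have h2 := (tendsto_weight_increment (α := α) hA hreg hx1 hS).norm
    rw [norm_zero] at h2
    refine squeeze_zero (fun _ => norm_nonneg _) (fun n => ?_) ((h1.add h2).trans_eq (by simp))
    rw [scaled_increment]
    exact (norm_add_le _ _).trans (add_le_add_left ((norm_le_norm_toLp _).trans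
      (norm_strategy_increment_le hA hreg hL₃ hlip hx1 (hα0 n) (hM n))) _)
  have hH : Tendsto (fun n => ‖(WithLp.toLp 2 (fun i => (varRun g A α S x1 n).σ i
      - g.agg (varRun g A α S x1 n).x) : EuclideanSpace ℝ (Fin N))‖) atTop (𝓝 0) := by
    refine tendsto_norm_toLp_zero ?_
    refine Tendsto.congr (fun n => (σ_sub_agg_eq n).symm) ?_
    simpa using (tendsto_dev_zero hA hS hz).add (tendsto_average_sub_agg hA hreg hx1 hS)
  set H : ℕ → ℝ := fun n => ‖(WithLp.toLp 2 (fun i => (varRun g A α S x1 n).σ i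
      - g.agg (varRun g A α S x1 n).x) : EuclideanSpace ℝ (Fin N))‖
  have hγ : Tendsto (fun n => 2 * μ * α n) atTop (𝓝 0) := by simpa using hα.const_mul (2 * μ)
  -- Dividing the perturbation by `2 * μ` extracts the factor `γ n`. What remains tends to 0
  -- together with the tracking error `H` and the step-size.
  refine tendsto_zero_of_perturbed_contraction (γ := fun n => 2 * μ * α n)
    (η := fun n => (2 * |L₂| * H n * R + α n * M ^ 2) / (2 * μ)) (fun n => sq_nonneg _)
    (Eventually.of_forall fun n => mul_nonneg (by positivity) (hα0 n))
    (hγ.eventually (eventually_le_nhds one_pos)) ?_ ?_ (Eventually.of_forall fun n => ?_)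
  · simp only [← Finset.mul_sum]
    exact hαs.const_mul_atTop (by positivity)
  · simpa using (((hH.const_mul (2 * |L₂|)).mul_const R).add (hα.mul_const (M ^ 2))).div_const
      (2 * μ)
  · have h := sq_norm_projStep_sub_le hreg hmono hlip hxs (hα0 n)
      (varRun_feasible hreg hx1 n (A := A) (α := α) (S := S)) (varRun g A α S x1 n).σ
    rw [varRun_x_succ]
    refine h.trans ?_
    have e : 2 * μ * α n * ((2 * |L₂| * H n * R + α n * M ^ 2) / (2 * μ))
        = 2 * α n * (|L₂| * H n * R) + α n ^ 2 * M ^ 2 := by field_simp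
    rw [e, show 1 - 2 * μ * α n = 1 - 2 * α n * μ by ring, add_assoc]
    refine add_le_add_right (add_le_add ?_ ?_) _
    · refine mul_le_mul_of_nonneg_left ?_ (mul_nonneg zero_le_two (hα0 n))
      have hHn : 0 ≤ H n := norm_nonneg _
      exact mul_le_mul (mul_le_mul_of_nonneg_right (le_abs_self _) hHn)
        (hR _ (varRun_feasible hreg hx1 n)) (norm_nonneg _) (mul_nonneg (abs_nonneg _) hHn)
    · exact mul_le_mul_of_nonneg_left (pow_le_pow_left₀ (norm_nonneg _) (hM n) 2) (sq_nonneg _)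

lemma D3_nonneg (hA : IsPrimitiveStochastic A) {L α Mt M : ℝ} {S : ℕ} (hL : 0 ≤ L) (hα : 0 ≤ α)
    (hMt : 0 ≤ Mt) (hM : 0 ≤ M) : 0 ≤ D3 A L α S Mt M := by
  have h1 := rho1_nonneg (A := A)
  have h2 := rho2_nonneg (A := A)
  have h3 := rhoSup_nonneg (A := A)
  have h4 := vmax_nonneg hA.vinf_pos
  unfold D3
  positivity

lemma IsTrackingBound.nonneg {α Mt : ℝ} {S : ℕ} (h : IsTrackingBound g A α S x1 Mt) : 0 ≤ Mt :=
  (wnorm_nonneg _).trans (h 0)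

lemma IsGradBound.nonneg {α M : ℝ} {S : ℕ} (h : IsGradBound g A α S x1 M) : 0 ≤ M :=
  (norm_nonneg _).trans (h 0)

lemma exists_isTrackingBound (hA : IsPrimitiveStochastic A) (hreg : g.Regular)
    (hx1 : g.Feasible x1) (α : ℝ) {S : ℕ} (hS : 1 ≤ S) :
    ∃ Mt, IsTrackingBound g A α S x1 Mt := by
  obtain ⟨R, hR⟩ := exists_dev_bound (α := fun _ => α) hA hreg hx1 fun _ => hS
  obtain ⟨K, hK⟩ := (isCompact_closedBall (0 : Fin N → ℝ) R).exists_bound_of_continuousOn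
    (continuous_wnorm (A := A)).continuousOn
  refine ⟨K, fun n => ?_⟩
  rw [fastRun_eq_varRun]
  exact (le_abs_self _).trans (hK _ (mem_closedBall_zero_iff.mpr (hR (n + 1))))

lemma exists_isGradBound (hA : IsPrimitiveStochastic A) (hreg : g.Regular)
    (hx1 : g.Feasible x1) (α : ℝ) {S : ℕ} (hS : 1 ≤ S) :
    ∃ M, IsGradBound g A α S x1 M := by
  obtain ⟨M, hM⟩ := exists_grad_bound (α := fun _ => α) hA hreg hx1 fun _ => hS
  refine ⟨M, fun n => ?_⟩
  rw [fastRun_eq_varRun]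
  exact hM n

lemma norm_toLp_add_le (u v : Fin N → ℝ) :
    ‖(WithLp.toLp 2 (u + v) : EuclideanSpace ℝ (Fin N))‖
      ≤ ‖(WithLp.toLp 2 u : EuclideanSpace ℝ (Fin N))‖
        + ‖(WithLp.toLp 2 v : EuclideanSpace ℝ (Fin N))‖ := by
  rw [WithLp.toLp_add]
  exact norm_add_le _ _

/-- The tracking error splits into disagreement and error of the average. The disagreement stays
coupled to the distance, giving the off-diagonal entry of `Γ_α`; the error of the average vanishes,
so there the distance may be replaced by the bound `R`. -/
lemma sq_error_succ_le (hN : 0 < N) (hA : IsPrimitiveStochastic A) (hreg : g.Regular)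
    (hL₂ : 0 ≤ L₂) (hmono : g.StronglyMonotone μ)
    (hlip : g.LipschitzConsts L₂ L₃) (hxs : g.IsNash xs) (hx1 : g.Feasible x1) {n : ℕ}
    (hα : 0 ≤ α n) {M R : ℝ}
    (hM : ‖g.Gvec (varRun g A α S x1 n).x (varRun g A α S x1 n).σ‖ ≤ M)
    (hR : ‖(WithLp.toLp 2 (varRun g A α S x1 n).x : Profile N p) - xs‖ ≤ R) :
    ‖(WithLp.toLp 2 (varRun g A α S x1 (n + 1)).x : Profile N p) - xs‖ ^ 2
      ≤ (1 - 2 * α n * μ) * ‖(WithLp.toLp 2 (varRun g A α S x1 n).x : Profile N p) - xs‖ ^ 2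
        + 2 * (α n * L₂ / Real.sqrt (vmin A))
          * ‖(WithLp.toLp 2 (varRun g A α S x1 n).x : Profile N p) - xs‖
          * wnorm A ((varRun g A α S x1 n).dev A)
        + 2 * α n * L₂ * R * ‖(WithLp.toLp 2 (fun i => (Vinf A).mulVec (varRun g A α S x1 n).σ i
          - g.agg (varRun g A α S x1 n).x) : EuclideanSpace ℝ (Fin N))‖
        + α n ^ 2 * M ^ 2 := by
  have h1 := sq_norm_projStep_sub_le hreg hmono hlip hxs hα
    (varRun_feasible hreg hx1 n (A := A) (α := α) (S := S)) (varRun g A α S x1 n).σ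
  rw [← varRun_x_succ] at h1
  set e := ‖(WithLp.toLp 2 (varRun g A α S x1 n).x : Profile N p) - xs‖
  set δ := wnorm A ((varRun g A α S x1 n).dev A)
  set h := ‖(WithLp.toLp 2 (fun i => (Vinf A).mulVec (varRun g A α S x1 n).σ i
    - g.agg (varRun g A α S x1 n).x) : EuclideanSpace ℝ (Fin N))‖
  set H := ‖(WithLp.toLp 2 (fun i => (varRun g A α S x1 n).σ i
    - g.agg (varRun g A α S x1 n).x) : EuclideanSpace ℝ (Fin N))‖ with hH
  have he0 : 0 ≤ e := norm_nonneg _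
  have hh0 : 0 ≤ h := norm_nonneg _
  have h2 : H ≤ δ / Real.sqrt (vmin A) + h := by
    rw [hH, σ_sub_agg_eq]
    refine (norm_toLp_add_le _ _).trans (add_le_add_left ?_ _)
    rw [le_div_iff₀' (Real.sqrt_pos.mpr (vmin_pos hN hA.vinf_pos))]
    exact le_wnorm hN hA.vinf_pos _
  have h3 : L₂ * H * e ≤ L₂ * (δ / Real.sqrt (vmin A)) * e + L₂ * h * R := by
    calc _ ≤ L₂ * (δ / Real.sqrt (vmin A) + h) * e :=
          mul_le_mul_of_nonneg_right (mul_le_mul_of_nonneg_left h2 hL₂) he0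
      _ = L₂ * (δ / Real.sqrt (vmin A)) * e + L₂ * h * e := by ring
      _ ≤ _ := add_le_add_right (mul_le_mul_of_nonneg_left hR (mul_nonneg hL₂ hh0)) _
  have h4 := mul_le_mul_of_nonneg_left (pow_le_pow_left₀ (norm_nonneg _) hM 2) (sq_nonneg (α n))
  have h5 := mul_le_mul_of_nonneg_left h3 (mul_nonneg zero_le_two hα)
  refine h1.trans ?_
  calc _ ≤ (1 - 2 * α n * μ) * e ^ 2 + 2 * α n * (L₂ * (δ / Real.sqrt (vmin A)) * e
        + L₂ * h * R) + α n ^ 2 * M ^ 2 := add_le_add (add_le_add_right h5 _) h4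
    _ = _ := by ring

lemma wnorm_dev_succ_le (hN : 0 < N) (hA : IsPrimitiveStochastic A) (hreg : g.Regular)
    (hL₃ : 0 ≤ L₃) (hlip : g.LipschitzConsts L₂ L₃) (hx1 : g.Feasible x1) {n : ℕ}
    (hα : 0 ≤ α n) {M : ℝ}
    (hM : ‖g.Gvec (varRun g A α S x1 n).x (varRun g A α S x1 n).σ‖ ≤ M) :
    wnorm A ((varRun g A α S x1 (n + 1)).dev A)
      ≤ rho1 A ^ S n * wnorm A ((varRun g A α S x1 n).dev A)
        + (Real.sqrt (vmax A) * (rho2 A * (rhoSup A * (L₃ * (α n * M))))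
          + wnorm A ((1 - Vinf A).mulVec fun i =>
            (1 / (varRun g A α S x1 (n + 1)).V i i - 1 / (varRun g A α S x1 n).V i i)
              * g.φ i ((varRun g A α S x1 n).x i))) := by
  have hv0 : ∀ i, 0 ≤ vinf A i := fun i => (hA.vinf_pos i).le
  rw [varRun_dev_succ hA, scaled_increment, Matrix.mulVec_add]
  refine (wnorm_add_le hv0 _ _).trans (add_le_add
    (hA.wnorm_pow_mulVec_le hN _ (hA.Vinf_mulVec_dev _))
    ((wnorm_add_le hv0 _ _).trans (add_le_add_left ?_ _)))
  refine (wnorm_le hA.vinf_pos _).trans (mul_le_mul_of_nonneg_left ?_ (Real.sqrt_nonneg _))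
  refine (norm_mulVec_le_opNorm _ _).trans (mul_le_mul_of_nonneg_left ?_ rho2_nonneg)
  exact norm_strategy_increment_le hA hreg hL₃ hlip hx1 hα hM

/-- Only the cross term uses `δ ≤ Mt`. It produces the summand of `D3` linear in the step-size,
while everything containing `h` is collected separately because it will vanish. -/
lemma sq_le_of_affine_bound {δ δ' r Mt B h : ℝ} (hr : 0 ≤ r) (hδ' : 0 ≤ δ') (hδ : δ ≤ Mt)
    (hb : 0 ≤ B + h) (hstep : δ' ≤ r * δ + (B + h)) :
    δ' ^ 2 ≤ r ^ 2 * δ ^ 2 + 2 * r * Mt * B + B ^ 2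
      + (2 * (r * Mt + B) * h + h ^ 2) := by
  calc δ' ^ 2 ≤ (r * δ + (B + h)) ^ 2 := pow_le_pow_left₀ hδ' hstep 2
    _ = r ^ 2 * δ ^ 2 + 2 * (r * (B + h)) * δ + (B + h) ^ 2 := by ring
    _ ≤ r ^ 2 * δ ^ 2 + 2 * (r * (B + h)) * Mt + (B + h) ^ 2 := by
      have := mul_le_mul_of_nonneg_left hδ (mul_nonneg zero_le_two (mul_nonneg hr hb))
      linarith
    _ = _ := by ring

lemma D3_eq (hv : ∀ i, 0 < vinf A i) (L α : ℝ) (S : ℕ) (Mt M : ℝ) :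
    D3 A L α S Mt M
      = 2 * rho1 A ^ S * Mt * (Real.sqrt (vmax A) * (rho2 A * (rhoSup A * (L * (α * M)))))
        + 2 * (Real.sqrt (vmax A) * (rho2 A * (rhoSup A * (L * (α * M))))) ^ 2
        + 4 * (α ^ 2 * M ^ 2) := by
  simp only [D3, mul_pow, Real.sq_sqrt (vmax_nonneg hv)]
  ring

/-- The Lyapunov function is `e ^ 2 + δ ^ 2`: the quadratic form bound contracts it by `lam`. The
constant perturbation is `2 * r * Mt * B + B ^ 2 + Q`, which the numerator of the bound dominates.
-/
lemma eventually_sq_le_of_coupled_contraction {e δ h h' : ℕ → ℝ} {a b c r lam B Mt Q ε : ℝ}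
    (hray : ∀ y z : ℝ, a * y ^ 2 + 2 * b * y * z + r ^ 2 * z ^ 2 ≤ lam * (y ^ 2 + z ^ 2))
    (hlam0 : 0 ≤ lam) (hlam1 : lam < 1) (hr : 0 ≤ r) (hB : 0 ≤ B) (hQ : 0 ≤ Q)
    (hh : Tendsto h atTop (𝓝 0)) (hh' : Tendsto h' atTop (𝓝 0)) (hh0' : ∀ n, 0 ≤ h' n)
    (hδ0 : ∀ n, 0 ≤ δ n) (hδ1 : ∀ n, δ (n + 1) ≤ Mt)
    (he : ∀ n, e (n + 1) ^ 2 ≤ a * e n ^ 2 + 2 * b * e n * δ n + c * h n + Q)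
    (hδ : ∀ n, δ (n + 1) ≤ r * δ n + (B + h' n)) (hε : 0 < ε) :
    ∀ᶠ n in atTop, e n ^ 2 ≤ (2 * r * Mt * B + 2 * B ^ 2 + 4 * Q) / (1 - lam) + ε := by
  have hlam : 0 < 1 - lam := sub_pos.mpr hlam1
  set D := 2 * r * Mt * B + 2 * B ^ 2 + 4 * Q with hD
  set η : ℕ → ℝ := fun n => (D + (c * h n + 2 * (r * Mt + B) * h' n + h' n ^ 2)) / (1 - lam)
    with hη
  have hηlim : Tendsto η atTop (𝓝 (D / (1 - lam))) := by
    have h1 := ((hh.const_mul c).add (hh'.const_mul (2 * (r * Mt + B)))).add (hh'.pow 2)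
    have h2 := (h1.const_add D).div_const (1 - lam)
    simpa using h2
  have hmain := eventually_le_of_perturbed_contraction (a := fun n => e n ^ 2 + δ n ^ 2)
    (γ := fun _ => 1 - lam) (η := η) (Eventually.of_forall fun _ => hlam.le)
    (Eventually.of_forall fun _ => by linarith) (tendsto_sum_const_atTop hlam) hηlim ?_ hε
  · filter_upwards [hmain] with n hn
    linarith [sq_nonneg (δ n)]
  -- The bound `Mt` on the disagreement holds only from index 1 on.
  · filter_upwards [eventually_ge_atTop 1] with n hn
    obtain ⟨k, rfl⟩ := Nat.exists_eq_add_of_le' hn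
    have h1 := sq_le_of_affine_bound hr (hδ0 _) (hδ1 k) (add_nonneg hB (hh0' _)) (hδ (k + 1))
    have h2 := hray (e (k + 1)) (δ (k + 1))
    have h3 := he (k + 1)
    simp only [hη]
    rw [sub_sub_cancel, mul_div_cancel₀ _ hlam.ne', hD]
    nlinarith [sq_nonneg B]

/-- With constant step-size, the fast algorithm approaches a neighbourhood of the Nash
equilibrium. -/
lemma eventually_fastRun_le (hN : 0 < N) (hA : IsPrimitiveStochastic A) (hreg : g.Regular)
    (hL₂ : 0 ≤ L₂) (hL₃ : 0 ≤ L₃) (hmono : g.StronglyMonotone μ)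
    (hlip : g.LipschitzConsts L₂ L₃) (hxs : g.IsNash xs) (hx1 : g.Feasible x1)
    {α : ℝ} (hα : 0 ≤ α) {S : ℕ} (hS : 1 ≤ S) (hlam : lamMax (Gam A μ L₂ α S) < 1)
    {Mt M : ℝ} (hMt : IsTrackingBound g A α S x1 Mt) (hM : IsGradBound g A α S x1 M)
    {ε : ℝ} (hε : 0 < ε) :
    ∀ᶠ n in atTop, ‖(WithLp.toLp 2 (fastRun g A α S x1 n).x : Profile N p) - xs‖ ^ 2
      ≤ D3 A L₃ α S Mt M / (1 - lamMax (Gam A μ L₂ α S)) + ε := by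
  have hM0 := hM.nonneg
  obtain ⟨R, hR0, hR⟩ := Game.exists_dist_bound hreg xs
  have hα' : ∀ _n : ℕ, 0 ≤ α := fun _ => hα
  have hS' : ∀ _n : ℕ, 1 ≤ S := fun _ => hS
  simp only [IsTrackingBound, IsGradBound, fastRun_eq_varRun] at hMt hM ⊢
  have hstep1 := fun n => sq_error_succ_le (S := fun _ => S) hN hA hreg hL₂ hmono hlip hxs hx1
    (hα' n) (hM n) (hR _ (varRun_feasible hreg hx1 n))
  have hstep2 := fun n => wnorm_dev_succ_le (S := fun _ => S) hN hA hreg hL₃ hlip hx1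
    (hα' n) (hM n)
  have hhlim := tendsto_norm_toLp_zero (tendsto_average_sub_agg (α := fun _ => α) hA hreg hx1 hS')
  have hhlim' : Tendsto (fun n => wnorm A ((1 - Vinf A).mulVec fun i =>
      (1 / (varRun g A (fun _ => α) (fun _ => S) x1 (n + 1)).V i i
        - 1 / (varRun g A (fun _ => α) (fun _ => S) x1 n).V i i)
      * g.φ i ((varRun g A (fun _ => α) (fun _ => S) x1 n).x i))) atTop (𝓝 0) := by
    have hc : Continuous fun u : Fin N → ℝ => wnorm A ((1 - Vinf A).mulVec u) :=
      continuous_wnorm.comp (Continuous.matrix_mulVec continuous_const continuous_id)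
    have := (hc.tendsto 0).comp
      (tendsto_weight_increment (α := fun _ => α) (S := fun _ => S) hA hreg hx1 hS')
    rw [Matrix.mulVec_zero, wnorm_zero] at this
    exact this
  obtain ⟨-, hlam0, hray⟩ := lamMax_two_facts (1 - 2 * α * μ)
    (α * L₂ / Real.sqrt (vmin A)) ((rho1 A ^ 2) ^ S)
  change _ ≤ lamMax (Gam A μ L₂ α S) at hlam0
  change ∀ y z : ℝ, _ ≤ lamMax (Gam A μ L₂ α S) * _ at hray
  generalize lamMax (Gam A μ L₂ α S) = lam at *
  -- The largest eigenvalue dominates the diagonal entry `(rho1 A ^ 2) ^ S`, which is nonnegative.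
  have hlam0 : 0 ≤ lam := le_trans (by positivity) hlam0
  rw [D3_eq hA.vinf_pos]
  have hB0 : 0 ≤ Real.sqrt (vmax A) * (rho2 A * (rhoSup A * (L₃ * (α * M)))) := by
    have h2 := rho2_nonneg (A := A)
    have h3 := rhoSup_nonneg (A := A)
    positivity
  generalize Real.sqrt (vmax A) * (rho2 A * (rhoSup A * (L₃ * (α * M)))) = B at *
  rw [← pow_mul, mul_comm 2 S, pow_mul] at hray
  exact eventually_sq_le_of_coupled_contraction
    (e := fun n => ‖(WithLp.toLp 2 (varRun g A (fun _ => α) (fun _ => S) x1 n).x : Profile N p)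
      - xs‖)
    (δ := fun n => wnorm A ((varRun g A (fun _ => α) (fun _ => S) x1 n).dev A))
    hray hlam0 hlam (pow_nonneg rho1_nonneg _) hB0 (by positivity) hhlim hhlim'
    (fun n => wnorm_nonneg _) (fun n => wnorm_nonneg _) hMt hstep1 hstep2 hε

end Convergence

/-! ### The resilient algorithm after the classification has settled -/

/-- The legitimate in-neighbours, as players of the whole network. -/
noncomputable def legitTrust (D : Digraph (Fin (N + m))) (i : Fin N) : Finset (Fin (N + m)) :=
  (legitNbr D i).map (Fin.castAddEmb m)

/-- Every legitimate player trusts exactly its legitimate in-neighbours. -/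
def Classified (D : Digraph (Fin (N + m))) (s : State N m p) : Prop :=
  ∀ i, trusted D s i = legitTrust D i

lemma received_castAdd {X : Type} (own : Fin N → X) (adv : Fin m → X) (i : Fin N) :
    received own adv (Fin.castAdd m i) = own i := by
  simp [received]

lemma received_natAdd {X : Type} (own : Fin N → X) (adv : Fin m → X) (j : Fin m) :
    received own adv (Fin.natAdd N j) = adv j := by
  simp [received]

lemma sum_weight_legitTrust (D : Digraph (Fin (N + m))) (i : Fin N) (F : Fin (N + m) → ℝ) :
    ∑ h ∈ inNbr D i, weight (legitTrust D i) h * F h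
      = ∑ j, weightMatrix D i j * F (Fin.castAdd m j) := by
  classical
  have hsub : legitTrust D i ⊆ inNbr D i := by
    intro h hh
    obtain ⟨j, hj, rfl⟩ := Finset.mem_map.mp hh
    exact mem_legitNbr.mp hj
  rw [← Finset.sum_subset hsub fun h _ hh => by rw [weight, if_neg hh, zero_mul]]
  conv_lhs => rw [legitTrust, Finset.sum_map]
  have hr : ∀ j ∈ Finset.univ, j ∉ legitNbr D i →
      weightMatrix D i j * F (Fin.castAdd m j) = 0 := by
    intro j _ hj
    rw [weightMatrix, if_neg hj, zero_mul]
  rw [← Finset.sum_subset (Finset.subset_univ (legitNbr D i)) hr]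
  refine Finset.sum_congr rfl fun j hj => ?_
  rw [weightMatrix, if_pos hj, weight, if_pos (Finset.mem_map_of_mem _ hj), Finset.card_map]
  rfl

/-- Only the first `N` coordinates of the weight vectors are followed. With correct trusted sets
each round is a multiplication by the weight matrix, and no malicious message enters. -/
lemma mrc_of_classified {D : Digraph (Fin (N + m))} {s : State N m p} (hs : Classified D s)
    (att : Attack N m) (k : ℕ) (V : Matrix (Fin N) (Fin N) ℝ)
    (hV : ∀ i j, s.v i (Fin.castAdd m j) = V i j) (l : ℕ) :
    (mrc D att k s l).1 = (weightMatrix D ^ l).mulVec s.σ ∧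
      ∀ i j, (mrc D att k s l).2 i (Fin.castAdd m j) = (weightMatrix D ^ l * V) i j := by
  induction l with
  | zero => exact ⟨by simp [mrc], fun i j => by simpa [mrc] using hV i j⟩
  | succ l ih =>
    refine ⟨?_, fun i j => ?_⟩
    · rw [pow_succ', ← Matrix.mulVec_mulVec, ← ih.1]
      funext i
      simp only [mrc, hs i]
      rw [sum_weight_legitTrust]
      simp [Matrix.mulVec, dotProduct, received_castAdd]
    · rw [pow_succ', mul_assoc, Matrix.mul_apply]
      simp only [mrc, hs i, Finset.sum_apply, Pi.smul_apply, smul_eq_mul]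
      rw [sum_weight_legitTrust D i fun h => received (mrc D att k s l).2
        (fun j => att.vec i j k l) h (Fin.castAdd m j)]
      exact Finset.sum_congr rfl fun h _ => by rw [received_castAdd, ih.2]

lemma cntSpread_of_classified {D : Digraph (Fin (N + m))} {s : State N m p}
    (hs : Classified D s) (att : Attack N m) (k : ℕ) (i : Fin N) :
    cntSpread D att k s i = (legitNbr D i).sup (cntNoticed D s) := by
  rw [cntSpread, hs i, legitTrust, Finset.sup_map]
  congr 1
  funext j
  exact received_castAdd _ _ j

section Run

variable {g : Game N p} {D : Digraph (Fin (N + m))} {x1 : Fin N → Strat p} {att : Attack N m}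
  {α : ℕ → ℝ} {S : ℕ → ℕ} {τ : Fin N → Fin (N + m) → ℕ → ℕ → ℝ}

lemma resilientRun_mark_succ (n : ℕ) :
    (resilientRun g D x1 att α S τ (n + 1)).mark
      = markNext D att (n + 1) (resilientRun g D x1 att α S τ n) := rfl

lemma resilientRun_cnt_succ (n : ℕ) (i : Fin N) :
    (resilientRun g D x1 att α S τ (n + 1)).cnt i
      = cntSpread D att (n + 1) (resilientRun g D x1 att α S τ n) i - 1 := rfl

/-- Honest marks are past iteration numbers, and malicious ones are admissible. Thus a player's own
mark cannot be pushed so high that others drop out of its list. -/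
lemma markNext_le (hatt : ∀ i j k h, 1 ≤ k → att.mark i j k h ≤ k) (n : ℕ) :
    ∀ i j, markNext D att (n + 1) (resilientRun g D x1 att α S τ n) i j ≤ n + 1 := by
  induction n with
  | zero =>
    intro i j
    refine Finset.sup_le fun h _ => ?_
    refine Fin.addCases (fun a => ?_) (fun a => ?_) h
    · rw [received_castAdd, markOwn, Function.update_apply]
      split_ifs
      · exact le_rfl
      · exact Nat.zero_le _
    · rw [received_natAdd]
      exact hatt i a 1 j le_rfl
  | succ n ih =>
    intro i j
    refine Finset.sup_le fun h _ => ?_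
    refine Fin.addCases (fun a => ?_) (fun a => ?_) h
    · rw [received_castAdd, markOwn, Function.update_apply]
      split_ifs
      · exact le_rfl
      · rw [resilientRun_mark_succ]
        exact (ih a j).trans (Nat.le_succ _)
    · rw [received_natAdd]
      exact hatt i a _ j (Nat.succ_pos _)

/-- A fresh mark of `j` crosses one edge per iteration, so along `d + 1` edges it arrives with age
at most `d`. All iterations involved must lie after `K`, whence `K + d ≤ n`. -/
lemma le_markNext {K : ℕ} (hK : ∀ n, K ≤ n → Classified D (resilientRun g D x1 att α S τ n))
    (d : ℕ) : ∀ n, K + d ≤ n → ∀ i j, Reach D (d + 1) i j →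
      n + 1 ≤ markNext D att (n + 1) (resilientRun g D x1 att α S τ n) i (Fin.castAdd m j)
        + d := by
  have key : ∀ n, K ≤ n → ∀ i, ∀ h ∈ legitNbr D i, ∀ j,
      markOwn (n + 1) (resilientRun g D x1 att α S τ n) h j
        ≤ markNext D att (n + 1) (resilientRun g D x1 att α S τ n) i j := by
    intro n hn i h hh j
    have hmem : Fin.castAdd m h ∈ trusted D (resilientRun g D x1 att α S τ n) i := by
      rw [hK n hn i]
      exact Finset.mem_map_of_mem (Fin.castAddEmb m) hh
    have := Finset.le_sup (f := fun h => received
      (markOwn (n + 1) (resilientRun g D x1 att α S τ n)) (fun a => att.mark i a (n + 1)) h j) hmem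
    simp only [received_castAdd] at this
    exact this
  induction d with
  | zero =>
    rintro n hn i j ⟨h, hh, rfl⟩
    have := key n (by omega) i h hh (Fin.castAdd m h)
    simpa [markOwn] using this
  | succ d ih =>
    rintro n hn i j ⟨h, hh, hr⟩
    refine le_trans ?_ (Nat.add_le_add_right (key n (by omega) i h hh (Fin.castAdd m j)) _)
    rw [markOwn, Function.update_apply]
    split_ifs
    · omega
    · obtain ⟨n, rfl⟩ : ∃ n', n = n' + 1 := ⟨n - 1, by omega⟩
      rw [resilientRun_mark_succ]
      have := ih n (by omega) h j hr
      omega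

/-- Every legitimate mark at `i` is at most `N - 1` iterations old, so all legitimate players are
listed. Malicious players may be listed too, but they are numbered after `i` and do not affect its
position. -/
lemma position_eq (hconn : LegitStronglyConnected D)
    (hatt : ∀ i j k h, 1 ≤ k → att.mark i j k h ≤ k) {K : ℕ}
    (hK : ∀ n, K ≤ n → Classified D (resilientRun g D x1 att α S τ n)) {n : ℕ}
    (hn : K + N ≤ n + 1 ∨ K = 0) (i : Fin N) :
    position D att (n + 1) (resilientRun g D x1 att α S τ n) i = Fin.castAdd m i := by
  have hNpos : 0 < N := Fin.pos i
  have hlist : ∀ j : Fin N,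
      Fin.castAdd m j ∈ playerList D att (n + 1) (resilientRun g D x1 att α S τ n) i := by
    intro j
    have h1 := markNext_le (g := g) (D := D) (x1 := x1) (α := α) (S := S) (τ := τ) hatt n i
      (Fin.castAdd m i)
    have h2 : n + 1 ≤ markNext D att (n + 1) (resilientRun g D x1 att α S τ n) i
        (Fin.castAdd m j) + (N - 1) := by
      -- Otherwise `K = 0` and `n + 1 ≤ N - 1`, so that even a mark 0 is recent enough.
      by_cases hle : K + (N - 1) ≤ n
      · refine le_markNext hK (N - 1) n hle i j ?_
        rw [Nat.sub_add_cancel hNpos]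
        exact reach_card hconn i j
      · omega
    rw [playerList, Finset.mem_filter]
    refine ⟨Finset.mem_univ _, ?_⟩
    omega
  have hfilter : (playerList D att (n + 1) (resilientRun g D x1 att α S τ n) i).filter
      (fun j => j < Fin.castAdd m i) = Finset.Iio (Fin.castAdd m i) := by
    ext j
    rw [Finset.mem_filter, Finset.mem_Iio]
    refine ⟨fun h => h.2, fun h => ⟨?_, h⟩⟩
    have hj : j.val < N := lt_trans h i.isLt
    exact hlist ⟨j.val, hj⟩
  apply Fin.ext
  simp only [position]
  rw [hfilter, Fin.card_Iio]

/-- From a synchronous reset on, the resilient algorithm coincides with the fast one. -/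
lemma resilientRun_eq_varRun {K : ℕ}
    (hclass : ∀ n, K ≤ n → Classified D (resilientRun g D x1 att α S τ n))
    (hcnt : ∀ n, K ≤ n → ∀ i, cntSpread D att (n + 1) (resilientRun g D x1 att α S τ n) i = 0)
    (hpos : ∀ n, K ≤ n → ∀ i,
      position D att (n + 1) (resilientRun g D x1 att α S τ n) i = Fin.castAdd m i)
    (hx : (resilientRun g D x1 att α S τ K).x = x1)
    (hv : ∀ i, (resilientRun g D x1 att α S τ K).v i = Pi.single (Fin.castAdd m i) 1)
    (hσ : ∀ i, (resilientRun g D x1 att α S τ K).σ i = g.φ i (x1 i)) (n : ℕ) :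
    (resilientRun g D x1 att α S τ (K + n)).x = (varRun g (weightMatrix D)
        (fun n => α (K + n + 1)) (fun n => S (K + n + 1)) x1 n).x ∧
      (resilientRun g D x1 att α S τ (K + n)).σ = (varRun g (weightMatrix D)
        (fun n => α (K + n + 1)) (fun n => S (K + n + 1)) x1 n).σ ∧
      ∀ i j, (resilientRun g D x1 att α S τ (K + n)).v i (Fin.castAdd m j)
        = (varRun g (weightMatrix D)
          (fun n => α (K + n + 1)) (fun n => S (K + n + 1)) x1 n).V i j := by
  induction n with
  | zero =>
    refine ⟨hx, funext hσ, fun i j => ?_⟩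
    rw [Nat.add_zero, hv]
    simp only [varRun, Matrix.one_apply, Pi.single_apply, Fin.castAdd_inj]
    simp only [eq_comm]
  | succ n ih =>
    obtain ⟨ihx, ihσ, ihv⟩ := ih
    have hKn : K ≤ K + n := Nat.le_add_right K n
    obtain ⟨m1, m2⟩ := mrc_of_classified (hclass _ hKn) att (K + n + 1) _ ihv (S (K + n + 1))
    set s := resilientRun g D x1 att α S τ (K + n) with hs
    set f := varRun g (weightMatrix D) (fun n => α (K + n + 1)) (fun n => S (K + n + 1)) x1 n
      with hf
    have hcnt' : ∀ i, cntSpread D att (K + n + 1) s i = 0 := hcnt _ hKn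
    have hpos' : ∀ i, position D att (K + n + 1) s i = Fin.castAdd m i := hpos _ hKn
    have hx' : (resilientRun g D x1 att α S τ (K + (n + 1))).x
        = fun i => proj (g.Ω i) (f.x i - α (K + n + 1) • g.G i (f.x i) (f.σ i)) := by
      funext i
      rw [← add_assoc, resilientRun, ← hs]
      simp only [step, hcnt', if_true, ← ihx, ← ihσ]
    refine ⟨hx', ?_, ?_⟩
    · funext i
      rw [← add_assoc, resilientRun, ← hs]
      simp only [step, hcnt', if_true, hpos', m1, m2, ihv]
      rw [ihx, ihσ]
      rfl
    · intro i j
      rw [← add_assoc, resilientRun, ← hs]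
      simp only [step, hcnt', if_true, m2]
      rfl

/-- If the classification is eventually correct, the resilient algorithm eventually runs the fast
algorithm from the initial strategies. -/
lemma exists_resilientRun_eq_varRun (hN : 0 < N) (hconn : LegitStronglyConnected D)
    (hatt : ∀ i j k h, 1 ≤ k → att.mark i j k h ≤ k)
    (hclass : ∀ᶠ n in atTop, Classified D (resilientRun g D x1 att α S τ n)) :
    ∃ K, ∀ n, (resilientRun g D x1 att α S τ (K + n)).x = (varRun g (weightMatrix D)
        (fun n => α (K + n + 1)) (fun n => S (K + n + 1)) x1 n).x := by
  classical
  set s := resilientRun g D x1 att α S τ with hs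
  -- After the last change the trusted sets are constant; being eventually correct, they are correct
  -- already from `T` on.
  have hstable : ∀ T, (∀ n, T < n → ∀ i, (s n).trust i = trusted D (s n) i) →
      ∀ n, T ≤ n → Classified D (s n) := by
    intro T hT n hn i
    have hconst : ∀ n', n ≤ n' → trusted D (s n') i = trusted D (s n) i := by
      intro n' hn'
      induction n', hn' using Nat.le_induction with
      | base => rfl
      | succ n' hn' ih =>
        rw [← hT (n' + 1) (by omega) i, ← ih]
        rfl
    obtain ⟨n', h1, h2⟩ := ((eventually_ge_atTop n).and hclass).exists
    rw [← hconst n' h1]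
    exact h2 i
  by_cases hch : ∃ n i, (s n).trust i ≠ trusted D (s n) i
  · -- the last change of the classification
    obtain ⟨T, ⟨i₀, hi₀⟩, hT⟩ : ∃ T, (∃ i, (s T).trust i ≠ trusted D (s T) i) ∧
        ∀ n, T < n → ∀ i, (s n).trust i = trusted D (s n) i := by
      obtain ⟨K, hK⟩ := eventually_atTop.mp hclass
      have hlate : ∀ n, K < n → ∀ i, (s n).trust i = trusted D (s n) i := by
        intro n hn i
        obtain ⟨n, rfl⟩ : ∃ n', n = n' + 1 := ⟨n - 1, by omega⟩
        rw [hK (n + 1) (by omega) i, ← hK n (by omega) i]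
        rfl
      obtain ⟨n₀, hn₀⟩ := hch
      have hle : n₀ ≤ K := by
        by_contra! h
        obtain ⟨i, hi⟩ := hn₀
        exact hi (hlate n₀ h i)
      refine ⟨Nat.findGreatest (fun n => ∃ i, (s n).trust i ≠ trusted D (s n) i) K,
        Nat.findGreatest_spec (P := fun n => ∃ i, (s n).trust i ≠ trusted D (s n) i) hle hn₀,
        fun n hn i => ?_⟩
      by_cases hnK : n ≤ K
      · have := Nat.findGreatest_is_greatest hn hnK
        push Not at this
        exact this i
      · exact hlate n (by omega) i
    have hgood := hstable T hT
    -- At offset `d` after the last change, `u d` are the counters before and `w d` those after the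
    -- maximum over in-neighbours.
    set u : ℕ → Fin N → ℕ := fun d => cntNoticed D (s (T + d)) with hu
    set w : ℕ → Fin N → ℕ := fun d => cntSpread D att (T + d + 1) (s (T + d)) with hw
    have hwu : ∀ d i, w d i = (legitNbr D i).sup (u d) := fun d i =>
      cntSpread_of_classified (hgood _ (Nat.le_add_right T d)) att _ i
    have hus : ∀ d i, u (d + 1) i = w d i - 1 := by
      intro d i
      simp only [hu]
      rw [cntNoticed, if_neg (not_not.mpr (hT _ (by omega) i))]
      rfl
    have : Nonempty (Fin N) := ⟨⟨0, hN⟩⟩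
    obtain ⟨j, hj⟩ := Finite.exists_max (u 0)
    -- The value `B` may exceed `N + m`, since malicious counters may have been accepted earlier.
    set B := u 0 j with hB
    have hBN : N + m ≤ B := by
      refine le_trans (le_of_eq ?_) (hj i₀)
      simp only [hu, Nat.add_zero]
      rw [cntNoticed, if_pos hi₀]
    -- Taking maxima creates no larger values and each iteration subtracts 1, so all counters are at
    -- most `B - d`; `hlower` gives equality for players reached from `j` in `d` rounds.
    have hupper : ∀ d i, u d i ≤ B - d := by
      intro d
      induction d with
      | zero => exact hj
      | succ d ih =>
        intro i
        have : w d i ≤ B - d := by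
          rw [hwu]
          exact Finset.sup_le fun h _ => ih h
        rw [hus]
        omega
    have hlower_w : ∀ d i, (∀ h, Reach D d h j → B ≤ u d h + d) → Reach D (d + 1) i j →
        B ≤ w d i + d := by
      rintro d i ih ⟨h, hh, hr⟩
      have h1 : u d h ≤ w d i := by
        rw [hwu]
        exact Finset.le_sup hh
      have := ih h hr
      omega
    have hlower : ∀ d i, Reach D d i j → B ≤ u d i + d := by
      intro d
      induction d with
      | zero =>
        intro i hr
        cases (show i = j from hr)
        exact le_rfl
      | succ d ih =>
        intro i hr
        have := hlower_w d i ih hr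
        rw [hus]
        omega
    have hw0 : ∀ n, T + B ≤ n → ∀ i, cntSpread D att (n + 1) (s n) i = 0 := by
      intro n hn i
      obtain ⟨d, rfl⟩ := Nat.exists_eq_add_of_le (show T ≤ n by omega)
      have : w d i ≤ B - d := by
        rw [hwu]
        exact Finset.sup_le fun h _ => hupper d h
      have h0 : w d i = 0 := by omega
      exact h0
    -- Offset `b = B - 1` is the common last reset: since `N ≤ b + 1`, every player has received a
    -- counter that is still positive there, and from offset `B` on all counters are 0.
    obtain ⟨b, hb⟩ : ∃ b, B = b + 1 := ⟨B - 1, by omega⟩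
    have hwb : ∀ i, w b i ≠ 0 := by
      intro i
      have := hlower_w b i (hlower b) (Reach.mono (by omega) (reach_card hconn i j))
      omega
    have hpos : ∀ n, T + b ≤ n → ∀ i, position D att (n + 1) (s n) i = Fin.castAdd m i :=
      fun n hn i => position_eq hconn hatt hgood (Or.inl (by omega)) i
    have hreset : s (T + B) = step g D x1 att (T + b + 1) (α (T + b + 1)) (S (T + b + 1))
        (fun i j l => τ i j (T + b + 1) l) (s (T + b)) := by
      rw [hb]
      rfl
    have hwb' : ∀ i, cntSpread D att (T + b + 1) (s (T + b)) i ≠ 0 := hwb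
    refine ⟨T + B, fun n => (resilientRun_eq_varRun (fun n hn => hgood n (by omega)) hw0
      (fun n hn => hpos n (by omega)) ?_ ?_ ?_ n).1⟩
    · rw [← hs, hreset]
      funext i
      simp [step, hwb' i]
    · intro i
      rw [← hs, hreset]
      simp [step, hwb' i, hpos (T + b) le_rfl i]
    · intro i
      rw [← hs, hreset]
      simp [step, hwb' i]
  -- Without any change the trusted sets are correct from the start and all counters stay 0, so no
  -- reset ever happens.
  · push Not at hch
    have hgood := hstable 0 fun n _ i => hch n i
    have hspread : ∀ n, (∀ i, (s n).cnt i = 0) →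
        ∀ i, cntSpread D att (n + 1) (s n) i = 0 := by
      intro n h0 i
      rw [cntSpread_of_classified (hgood n (Nat.zero_le n))]
      refine Nat.le_zero.mp (Finset.sup_le fun h _ => ?_)
      rw [cntNoticed, if_neg (not_not.mpr (hch n h)), h0 h]
    have hcnt : ∀ n i, (s n).cnt i = 0 := by
      intro n
      induction n with
      | zero => exact fun i => rfl
      | succ n ih =>
        intro i
        rw [hs, resilientRun_cnt_succ, ← hs, hspread n ih i]
    exact ⟨0, fun n => (resilientRun_eq_varRun (fun n hn => hgood n hn)
      (fun n _ i => hspread n (hcnt n) i) (fun n _ i => position_eq hconn hatt hgood (Or.inr rfl) i)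
      rfl (fun i => rfl) (fun i => rfl) n).1⟩

end Run

/-! ### The classification is almost surely correct from some iteration on -/

section Classification

variable {W : Type*} [MeasurableSpace W] {P : Measure W} [IsProbabilityMeasure P]

/-- By Hoeffding's inequality the failure probabilities are dominated by a geometric series, and the
Borel–Cantelli lemma applies. -/
lemma ae_eventually_sum_pos {ι : Type*} {X : ι → W → ℝ} (hind : iIndepFun X P)
    (hm : ∀ q, Measurable (X q)) (hr : ∀ q ω, X q ω ∈ Set.Icc (0 : ℝ) 1) {E : ℝ} (hE : 0 < E)
    (hmean : ∀ q, ∫ ω, X q ω ∂P = 1 / 2 + E) {F : ℕ → Finset ι} (hF : ∀ n, n ≤ (F n).card) :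
    ∀ᵐ ω ∂P, ∀ᶠ n in atTop, 0 < ∑ q ∈ F n, (X q ω - 1 / 2) := by
  have hsub : ∀ q, HasSubgaussianMGF (fun ω => 1 / 2 + E - X q ω) (1 / 4) P := by
    intro q
    have h := (hasSubgaussianMGF_of_mem_Icc (hm q).aemeasurable
      (ae_of_all P (hr q))).neg
    rw [hmean] at h
    -- A variable with values in an interval of length 1 is, after centring, sub-Gaussian with
    -- parameter `(1 / 2) ^ 2`.
    have e1 : (‖(1 : ℝ) - 0‖₊ / 2) ^ 2 = 1 / 4 := by
      rw [sub_zero, nnnorm_one]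
      norm_num
    rw [e1] at h
    convert h using 1
    funext ω
    simp
  have hind' : iIndepFun (fun q ω => 1 / 2 + E - X q ω) P :=
    hind.comp (fun _ x => 1 / 2 + E - x) fun _ => measurable_const.sub measurable_id
  have hbound : ∀ n, P.real {ω | ¬ 0 < ∑ q ∈ F n, (X q ω - 1 / 2)}
      ≤ Real.exp (-2 * E ^ 2) ^ n := by
    intro n
    have h := HasSubgaussianMGF.measure_sum_ge_le_of_iIndepFun hind' (s := F n)
      (fun q _ => hsub q) (ε := (F n).card * E) (by positivity)
    have hset : {ω | ¬ 0 < ∑ q ∈ F n, (X q ω - 1 / 2)}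
        = {ω | (F n).card * E ≤ ∑ q ∈ F n, (1 / 2 + E - X q ω)} := by
      ext ω
      have : ∑ q ∈ F n, (1 / 2 + E - X q ω) = (F n).card * E - ∑ q ∈ F n, (X q ω - 1 / 2) := by
        rw [← nsmul_eq_mul, ← Finset.sum_const, ← Finset.sum_sub_distrib]
        exact Finset.sum_congr rfl fun _ _ => by ring
      change ¬ 0 < ∑ q ∈ F n, (X q ω - 1 / 2) ↔ (F n).card * E ≤ ∑ q ∈ F n, (1 / 2 + E - X q ω)
      rw [this, not_lt]
      constructor <;> intro h <;> linarith
    rw [hset]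
    refine h.trans ?_
    rw [← Real.exp_nat_mul, Real.exp_le_exp]
    have hc : ((∑ _q ∈ F n, (1 / 4 : NNReal) : NNReal) : ℝ) = (F n).card * (1 / 4) := by
      simp
    rw [hc]
    have hn : (n : ℝ) ≤ (F n).card := Nat.cast_le.mpr (hF n)
    -- An empty `F n` is treated separately because the exponent then has denominator 0.
    rcases (Nat.cast_nonneg (α := ℝ) (F n).card).eq_or_lt with h0 | h0
    · rw [← h0] at hn ⊢
      have : (n : ℝ) = 0 := le_antisymm hn (Nat.cast_nonneg n)
      simp [this]
    · have e : -((F n).card * E) ^ 2 / (2 * ((F n).card * (1 / 4)))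
          = (F n).card * (-2 * E ^ 2) := by
        field_simp
        ring
      rw [e]
      nlinarith [sq_nonneg E]
  have hlt : Real.exp (-2 * E ^ 2) < 1 := by
    rw [Real.exp_lt_one_iff]
    nlinarith
  have hsum : ∑' n, P {ω | ¬ 0 < ∑ q ∈ F n, (X q ω - 1 / 2)} ≠ ⊤ := by
    refine ne_top_of_le_ne_top (summable_geometric_of_lt_one (Real.exp_nonneg _)
      hlt).tsum_ofReal_ne_top (ENNReal.tsum_le_tsum fun n => ?_)
    rw [← ENNReal.ofReal_toReal (measure_ne_top P _)]
    exact ENNReal.ofReal_le_ofReal (hbound n)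
  filter_upwards [ae_eventually_notMem hsum] with ω hω
  filter_upwards [hω] with n hn
  exact not_not.mp hn

lemma ae_eventually_sum_neg {ι : Type*} {X : ι → W → ℝ} (hind : iIndepFun X P)
    (hm : ∀ q, Measurable (X q)) (hr : ∀ q ω, X q ω ∈ Set.Icc (0 : ℝ) 1) {E : ℝ} (hE : E < 0)
    (hmean : ∀ q, ∫ ω, X q ω ∂P = 1 / 2 + E) {F : ℕ → Finset ι} (hF : ∀ n, n ≤ (F n).card) :
    ∀ᵐ ω ∂P, ∀ᶠ n in atTop, ∑ q ∈ F n, (X q ω - 1 / 2) < 0 := by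
  have h := ae_eventually_sum_pos (P := P) (X := fun q ω => 1 - X q ω)
    (hind.comp (fun _ x => 1 - x) fun _ => measurable_const.sub measurable_id)
    (fun q => measurable_const.sub (hm q))
    (fun q ω => ⟨by linarith [(hr q ω).2], by linarith [(hr q ω).1]⟩) (neg_pos.mpr hE)
    (fun q => by
      rw [integral_sub (integrable_const _)
        (Integrable.of_mem_Icc 0 1 (hm q).aemeasurable (ae_of_all P (hr q))), hmean]
      simp
      ring) hF
  filter_upwards [h] with ω hω
  filter_upwards [hω] with n hn
  have : ∑ q ∈ F n, (1 - X q ω - 1 / 2) = -∑ q ∈ F n, (X q ω - 1 / 2) := by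
    rw [← Finset.sum_neg_distrib]
    exact Finset.sum_congr rfl fun _ _ => by ring
  linarith

/-- The trust values are functions of the observations alone. An attack that depends on the
observations therefore cannot disturb the classification. -/
lemma resilientRun_β (g : Game N p) (D : Digraph (Fin (N + m))) (x1 : Fin N → Strat p)
    (att : Attack N m) (α : ℕ → ℝ) (S : ℕ → ℕ) (τ : Fin N → Fin (N + m) → ℕ → ℕ → ℝ) (n : ℕ)
    (i : Fin N) (j : Fin (N + m)) :
    (resilientRun g D x1 att α S τ n).β i j
      = ∑ k ∈ Finset.range n, ∑ l ∈ Finset.range (S (k + 1)), (τ i j (k + 1) l - 1 / 2) := by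
  induction n with
  | zero => rfl
  | succ n ih =>
    rw [Finset.sum_range_succ, ← ih]
    rfl

variable {D : Digraph (Fin (N + m))} {S : ℕ → ℕ} {τ : Fin N → Fin (N + m) → ℕ → ℕ → W → ℝ}
  {E : Fin N → Fin (N + m) → ℝ}

lemma TrustAssumption.ae_eventually_sign (hτ : TrustAssumption P D S τ E)
    (hS : ∀ k, 1 ≤ k → 1 ≤ S k) {i : Fin N} {j : Fin (N + m)} (hj : j ∈ inNbr D i) :
    (0 < E i j → ∀ᵐ ω ∂P, ∀ᶠ n in atTop, 0 < ∑ k ∈ Finset.range n,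
        ∑ l ∈ Finset.range (S (k + 1)), (τ i j (k + 1) l ω - 1 / 2)) ∧
      (E i j < 0 → ∀ᵐ ω ∂P, ∀ᶠ n in atTop, ∑ k ∈ Finset.range n,
        ∑ l ∈ Finset.range (S (k + 1)), (τ i j (k + 1) l ω - 1 / 2) < 0) := by
  -- All rounds of all iterations form one independent family; since each iteration has at least one
  -- round, `F n` contains at least `n` observations.
  let X : (Σ k : ℕ, Fin (S (k + 1))) → W → ℝ := fun q => τ i j (q.1 + 1) q.2
  let F : ℕ → Finset (Σ k : ℕ, Fin (S (k + 1))) := fun n =>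
    (Finset.range n).sigma fun _ => Finset.univ
  have hind : iIndepFun X P := by
    refine (hτ.indep i j hj).precomp (g := fun q : Σ k : ℕ, Fin (S (k + 1)) =>
      (⟨(q.1 + 1, q.2), Nat.succ_pos _, q.2.isLt⟩ : {q : ℕ × ℕ // 1 ≤ q.1 ∧ q.2 < S q.1})) ?_
    rintro ⟨k, l⟩ ⟨k', l'⟩ h
    simp only [Subtype.mk.injEq, Prod.mk.injEq, Nat.add_right_cancel_iff] at h
    obtain ⟨rfl, h⟩ := h
    rw [Fin.ext h]
  have hm : ∀ q, Measurable (X q) := fun q =>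
    hτ.meas i j hj _ _ (Nat.succ_pos _) q.2.isLt
  have hr : ∀ q ω, X q ω ∈ Set.Icc (0 : ℝ) 1 := fun q =>
    hτ.range i j hj _ _ (Nat.succ_pos _) q.2.isLt
  have hmean : ∀ q, ∫ ω, X q ω ∂P = 1 / 2 + E i j := by
    intro q
    rw [hτ.mean i j hj _ _ (Nat.succ_pos _) q.2.isLt]
    ring
  have hF : ∀ n, n ≤ (F n).card := by
    intro n
    simp only [F, Finset.card_sigma, Finset.card_univ, Fintype.card_fin]
    calc n = ∑ _k ∈ Finset.range n, 1 := by simp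
      _ ≤ _ := Finset.sum_le_sum fun k _ => hS (k + 1) (Nat.succ_pos k)
  have hsum : ∀ n ω, ∑ q ∈ F n, (X q ω - 1 / 2) = ∑ k ∈ Finset.range n,
      ∑ l ∈ Finset.range (S (k + 1)), (τ i j (k + 1) l ω - 1 / 2) := by
    intro n ω
    rw [Finset.sum_sigma]
    refine Finset.sum_congr rfl fun k _ => ?_
    rw [Finset.sum_range]
  refine ⟨fun hE => ?_, fun hE => ?_⟩
  · simpa only [hsum] using ae_eventually_sum_pos hind hm hr hE hmean hF
  · simpa only [hsum] using ae_eventually_sum_neg hind hm hr hE hmean hF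

lemma TrustAssumption.ae_eventually_classified (hτ : TrustAssumption P D S τ E)
    (hS : ∀ k, 1 ≤ k → 1 ≤ S k) (g : Game N p) (x1 : Fin N → Strat p) (att : W → Attack N m)
    (α : ℕ → ℝ) :
    ∀ᵐ ω ∂P, ∀ᶠ n in atTop, Classified D
      (resilientRun g D x1 (att ω) α S (fun i j k l => τ i j k l ω) n) := by
  have h : ∀ i, ∀ j : Fin (N + m), ∀ᵐ ω ∂P, ∀ᶠ n in atTop,
      (j ∈ trusted D (resilientRun g D x1 (att ω) α S (fun i j k l => τ i j k l ω) n) i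
        ↔ j ∈ legitTrust D i) := by
    intro i j
    by_cases hj : j ∈ inNbr D i
    · induction j using Fin.addCases with
      | left j =>
        filter_upwards [(hτ.ae_eventually_sign hS hj).1 (hτ.legit i j hj)] with ω hω
        filter_upwards [hω] with n hn
        have h1 : Fin.castAdd m j ∈ legitTrust D i :=
          Finset.mem_map_of_mem (Fin.castAddEmb m) (mem_legitNbr.mpr hj)
        refine iff_of_true (Finset.mem_filter.mpr ⟨hj, ?_⟩) h1
        rw [resilientRun_β]
        exact hn.le
      | right j =>
        filter_upwards [(hτ.ae_eventually_sign hS hj).2 (hτ.malicious i j hj)] with ω hω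
        filter_upwards [hω] with n hn
        refine iff_of_false (fun h => ?_) (fun h => ?_)
        · have := (Finset.mem_filter.mp h).2
          rw [resilientRun_β] at this
          exact absurd this (not_le.mpr hn)
        · obtain ⟨a, -, ha⟩ := Finset.mem_map.mp h
          have := congrArg Fin.val ha
          simp at this
          omega
    · refine ae_of_all P fun ω => Eventually.of_forall fun n => iff_of_false ?_ ?_
      · exact fun h => hj (Finset.mem_filter.mp h).1
      · intro h
        obtain ⟨a, ha, rfl⟩ := Finset.mem_map.mp h
        exact hj (mem_legitNbr.mp ha)
  filter_upwards [ae_all_iff.mpr fun i => ae_all_iff.mpr (h i)] with ω hω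
  have := eventually_all.mpr fun i => eventually_all.mpr (hω i)
  filter_upwards [this] with n hn i
  exact Finset.ext (hn i)

end Classification

/-! ### Measurability of the resilient algorithm -/

section Measurability

variable {W : Type*} [MeasurableSpace W]

/-- Trusted sets and positions take finitely many values, so the algorithm is measurable once each
of its discrete branches is. -/
lemma measurable_of_countable_cases {C β : Type*} [Countable C] [MeasurableSpace β] {c : W → C}
    (hc : ∀ t, MeasurableSet {ω | c ω = t}) {f : C → W → β} (hf : ∀ t, Measurable (f t)) :
    Measurable fun ω => f (c ω) ω := by
  intro s hs
  have : (fun ω => f (c ω) ω) ⁻¹' s = ⋃ t, {ω | c ω = t} ∩ f t ⁻¹' s := by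
    ext ω
    simp
  rw [this]
  exact MeasurableSet.iUnion fun t => (hc t).inter (hf t hs)

/-- The maps `φ i` and `G i` are controlled only on the strategy sets, which is why feasibility is
part of `MeasurableState`. -/
lemma measurable_comp_of_continuousOn {X Y : Type*} [TopologicalSpace X] [MeasurableSpace X]
    [OpensMeasurableSpace X] [TopologicalSpace Y] [MeasurableSpace Y] [BorelSpace Y] {f : X → Y}
    {s : Set X} (hf : ContinuousOn f s) {u : W → X} (hu : Measurable u) (hus : ∀ ω, u ω ∈ s) :
    Measurable fun ω => f (u ω) :=
  (continuousOn_iff_continuous_domRestrict.mp hf).measurable.comp (hu.subtype_mk (h := hus))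

lemma measurable_finset_sup_nat {ι : Type*} (T : Finset ι) {f : ι → W → ℕ}
    (hf : ∀ h, Measurable (f h)) : Measurable fun ω => T.sup fun h => f h ω := by
  classical
  induction T using Finset.induction_on with
  | empty => exact measurable_const
  | insert a T _ ih =>
    simp only [Finset.sup_insert]
    exact (hf a).sup ih

lemma measurableSet_finset_eq {ι : Type*} [Finite ι] {c : W → Finset ι}
    (hc : ∀ j, MeasurableSet {ω | j ∈ c ω}) (T : Finset ι) : MeasurableSet {ω | c ω = T} := by
  have : {ω | c ω = T} = ⋂ j, {ω | j ∈ c ω ↔ j ∈ T} := by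
    ext ω
    simp [Finset.ext_iff]
  rw [this]
  refine MeasurableSet.iInter fun j => ?_
  by_cases hj : j ∈ T
  · simpa [hj] using hc j
  · have e : {ω | j ∈ c ω ↔ j ∈ T} = {ω | j ∈ c ω}ᶜ := by
      ext ω
      simp [hj]
    rw [e]
    exact (hc j).compl

lemma measurable_received {β : Type} [MeasurableSpace β] {own : W → Fin N → β}
    {adv : W → Fin m → β} (ho : ∀ i, Measurable fun ω => own ω i)
    (ha : ∀ j, Measurable fun ω => adv ω j) (h : Fin (N + m)) :
    Measurable fun ω => received (own ω) (adv ω) h := by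
  induction h using Fin.addCases with
  | left i => simpa only [received_castAdd] using ho i
  | right j => simpa only [received_natAdd] using ha j

/-- The variables of a random state are measurable and its strategies are feasible. -/
structure MeasurableState (g : Game N p) (D : Digraph (Fin (N + m))) (s : W → State N m p) :
    Prop where
  x : ∀ i, Measurable fun ω => (s ω).x i
  v : ∀ i h, Measurable fun ω => (s ω).v i h
  σ : ∀ i, Measurable fun ω => (s ω).σ i
  β : ∀ i, ∀ j ∈ inNbr D i, Measurable fun ω => (s ω).β i j
  trust : ∀ i T, MeasurableSet {ω | (s ω).trust i = T}
  cnt : ∀ i, Measurable fun ω => (s ω).cnt i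
  mark : ∀ i j, Measurable fun ω => (s ω).mark i j
  feasible : ∀ ω, g.Feasible (s ω).x

variable {g : Game N p} {D : Digraph (Fin (N + m))} {s : W → State N m p} {att : W → Attack N m}

lemma MeasurableState.trusted (hs : MeasurableState g D s) (i : Fin N) (T : Finset (Fin (N + m))) :
    MeasurableSet {ω | trusted D (s ω) i = T} := by
  refine measurableSet_finset_eq (c := fun ω => AggGame.trusted D (s ω) i) (fun j => ?_) T
  by_cases hj : j ∈ inNbr D i
  · have : {ω | j ∈ AggGame.trusted D (s ω) i} = {ω | 0 ≤ (s ω).β i j} := by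
      ext ω
      exact Finset.mem_filter.trans (and_iff_right hj)
    rw [this]
    exact measurableSet_le measurable_const (hs.β i j hj)
  · have : {ω | j ∈ AggGame.trusted D (s ω) i} = ∅ := by
      ext ω
      exact iff_of_false (fun h => hj (Finset.mem_filter.mp h).1) (Set.notMem_empty ω)
    rw [this]
    exact MeasurableSet.empty

lemma MeasurableState.mrc (hs : MeasurableState g D s) (hatt : AdmissibleAttack att) (k l : ℕ) :
    (∀ i, Measurable fun ω => (mrc D (att ω) k (s ω) l).1 i) ∧
      ∀ i h, Measurable fun ω => (mrc D (att ω) k (s ω) l).2 i h := by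
  have hw : ∀ i h, Measurable fun ω => weight (AggGame.trusted D (s ω) i) h := fun i h =>
    measurable_of_countable_cases (f := fun T _ => weight T h) (hs.trusted i)
      fun _ => measurable_const
  induction l with
  | zero => exact ⟨hs.σ, hs.v⟩
  | succ l ih =>
    refine ⟨fun i => ?_, fun i h' => ?_⟩
    · simp only [AggGame.mrc]
      exact Finset.measurable_sum _ fun h _ => (hw i h).mul
        (measurable_received ih.1 (fun j => hatt.sig i j k l) h)
    · simp only [AggGame.mrc, Finset.sum_apply, Pi.smul_apply, smul_eq_mul]
      refine Finset.measurable_sum _ fun h _ => (hw i h).mul ?_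
      -- Receiving a vector and then taking a coordinate is the same as receiving that coordinate.
      have : ∀ ω, received (AggGame.mrc D (att ω) k (s ω) l).2 (fun j => (att ω).vec i j k l) h h'
          = received (fun i => (AggGame.mrc D (att ω) k (s ω) l).2 i h')
            (fun j => (att ω).vec i j k l h') h := by
        intro ω
        induction h using Fin.addCases with
        | left a => simp only [received_castAdd]
        | right a => simp only [received_natAdd]
      simp only [this]
      exact measurable_received (fun i => ih.2 i h') (fun j => hatt.vec i j k l h') h

lemma MeasurableState.cntSpread (hs : MeasurableState g D s) (hatt : AdmissibleAttack att)
    (k : ℕ) (i : Fin N) : Measurable fun ω => cntSpread D (att ω) k (s ω) i := by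
  have hn : ∀ i, Measurable fun ω => cntNoticed D (s ω) i := by
    intro i
    refine Measurable.ite ?_ measurable_const (hs.cnt i)
    have : {ω | (s ω).trust i ≠ AggGame.trusted D (s ω) i}
        = (⋃ T, {ω | (s ω).trust i = T} ∩ {ω | AggGame.trusted D (s ω) i = T})ᶜ := by
      ext ω
      simp [eq_comm]
    rw [this]
    exact (MeasurableSet.iUnion fun T => (hs.trust i T).inter (hs.trusted i T)).compl
  exact measurable_of_countable_cases (f := fun T ω => T.sup
    (received (cntNoticed D (s ω)) fun j => (att ω).cnt i j k)) (hs.trusted i) fun T =>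
      measurable_finset_sup_nat T fun h => measurable_received hn (fun j => hatt.cnt i j k) h

lemma MeasurableState.markNext (hs : MeasurableState g D s) (hatt : AdmissibleAttack att)
    (k : ℕ) (i : Fin N) (j : Fin (N + m)) :
    Measurable fun ω => markNext D (att ω) k (s ω) i j := by
  have ho : ∀ i, Measurable fun ω => markOwn k (s ω) i j := by
    intro i
    by_cases hj : j = Fin.castAdd m i
    · subst hj
      simp only [markOwn, Function.update_self]
      exact measurable_const
    · simp only [markOwn, Function.update_of_ne hj]
      exact hs.mark i j
  refine measurable_of_countable_cases (f := fun T ω => T.sup fun h =>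
    received (markOwn k (s ω)) (fun a => (att ω).mark i a k) h j) (hs.trusted i) fun T =>
      measurable_finset_sup_nat T fun h => ?_
  induction h using Fin.addCases with
  | left a => simpa only [received_castAdd] using ho a
  | right a => simpa only [received_natAdd] using hatt.mark i a k j

lemma MeasurableState.position (hs : MeasurableState g D s) (hatt : AdmissibleAttack att)
    (k : ℕ) (i : Fin N) (t : Fin (N + m)) :
    MeasurableSet {ω | AggGame.position D (att ω) k (s ω) i = t} := by
  have hl : ∀ T, MeasurableSet {ω | playerList D (att ω) k (s ω) i = T} := by
    refine measurableSet_finset_eq (c := fun ω => playerList D (att ω) k (s ω) i) fun j => ?_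
    have : {ω | j ∈ playerList D (att ω) k (s ω) i}
        = {ω | (AggGame.markNext D (att ω) k (s ω) i (Fin.castAdd m i) : ℤ)
          - (AggGame.markNext D (att ω) k (s ω) i j : ℤ) ≤ ((N + m : ℕ) : ℤ) - 1} := by
      ext ω
      exact Finset.mem_filter.trans (and_iff_right (Finset.mem_univ j))
    rw [this]
    exact measurableSet_le ((measurable_from_top.comp (hs.markNext hatt k i _)).sub
      (measurable_from_top.comp (hs.markNext hatt k i j))) measurable_const
  have : {ω | AggGame.position D (att ω) k (s ω) i = t}
      = ⋃ T : Finset (Fin (N + m)), {ω | playerList D (att ω) k (s ω) i = T} ∩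
        {_ω | (T.filter fun j => j < Fin.castAdd m i).card = t.val} := by
    ext ω
    simp [AggGame.position, Fin.ext_iff]
  rw [this]
  exact MeasurableSet.iUnion fun T => (hl T).inter (MeasurableSet.const _)

lemma measurable_projStep (hreg : g.Regular) {x : W → Fin N → Strat p} {σ : W → Fin N → ℝ}
    (hx : ∀ i, Measurable fun ω => x ω i) (hσ : ∀ i, Measurable fun ω => σ ω i)
    (hfeas : ∀ ω, g.Feasible (x ω)) (α : ℝ) (i : Fin N) :
    Measurable fun ω => projStep g α (x ω) (σ ω) i := by
  have hG : Measurable fun ω => g.G i (x ω i) (σ ω i) :=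
    measurable_comp_of_continuousOn (f := fun q : Strat p × ℝ => g.G i q.1 q.2)
      (u := fun ω => (x ω i, σ ω i))
      (Game.continuousOn_G hreg i) ((hx i).prodMk (hσ i)) fun ω => ⟨hfeas ω i, Set.mem_univ _⟩
  have hu : Measurable fun ω => x ω i - α • g.G i (x ω i) (σ ω i) :=
    (hx i).sub (hG.const_smul α)
  exact (lipschitzWith_proj (hreg.nonempty i) (hreg.compact i)
    (hreg.convex i)).continuous.measurable.comp hu

lemma MeasurableState.step (hreg : g.Regular) (hs : MeasurableState g D s)
    (hatt : AdmissibleAttack att) {x1 : Fin N → Strat p} (hx1 : g.Feasible x1) (k : ℕ) (α : ℝ)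
    (S : ℕ) {obs : W → Fin N → Fin (N + m) → ℕ → ℝ}
    (hobs : ∀ i, ∀ j ∈ inNbr D i, ∀ l < S, Measurable fun ω => obs ω i j l) :
    MeasurableState g D fun ω => step g D x1 (att ω) k α S (obs ω) (s ω) := by
  have hx' := measurable_projStep hreg hs.x hs.σ hs.feasible α
  have hι : ∀ i, MeasurableSet {ω | AggGame.cntSpread D (att ω) k (s ω) i = 0} := fun i =>
    hs.cntSpread hatt k i (measurableSet_singleton 0)
  obtain ⟨hq1, hq2⟩ := hs.mrc hatt k S
  have hφ : ∀ i {u : W → Fin N → Strat p}, (∀ i, Measurable fun ω => u ω i) →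
      (∀ ω, g.Feasible (u ω)) → Measurable fun ω => g.φ i (u ω i) := fun i u hu hf =>
    measurable_comp_of_continuousOn (Game.continuousOn_phi hreg i) (hu i) fun ω => hf ω i
  have hpos : ∀ i {f : W → Fin (N + m) → ℝ}, (∀ h, Measurable fun ω => f ω h) →
      Measurable fun ω => f ω (AggGame.position D (att ω) k (s ω) i) := fun i f hf =>
    measurable_of_countable_cases (f := fun h ω => f ω h) (hs.position hatt k i) hf
  refine ⟨fun i => ?_, fun i h => ?_, fun i => ?_, fun i j hj => ?_, hs.trusted, fun i => ?_,
    hs.markNext hatt k, fun ω i => ?_⟩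
  · exact Measurable.ite (hι i) (hx' i) measurable_const
  · have : ∀ ω, (AggGame.step g D x1 (att ω) k α S (obs ω) (s ω)).v i h
        = if AggGame.cntSpread D (att ω) k (s ω) i = 0 then (AggGame.mrc D (att ω) k (s ω) S).2 i h
          else (Pi.single (AggGame.position D (att ω) k (s ω) i) 1 : Fin (N + m) → ℝ) h := by
      intro ω
      simp only [AggGame.step]
      split_ifs <;> rfl
    simp only [this]
    exact Measurable.ite (hι i) (hq2 i h) (measurable_of_countable_cases
      (f := fun t _ => (Pi.single t 1 : Fin (N + m) → ℝ) h) (hs.position hatt k i)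
      fun _ => measurable_const)
  · exact Measurable.ite (hι i) (((hq1 i).add
      ((hφ i hx' fun ω => projStep_feasible hreg _ _ _).div (hpos i (hq2 i)))).sub
      ((hφ i hs.x hs.feasible).div (hpos i (hs.v i)))) measurable_const
  · exact (hs.β i j hj).add (Finset.measurable_sum _ fun l hl =>
      (hobs i j hj l (Finset.mem_range.mp hl)).sub_const _)
  · exact (hs.cntSpread hatt k i).sub_const 1
  · simp only [AggGame.step]
    split_ifs
    · exact projStep_feasible hreg α (s ω).x (s ω).σ i
    · exact hx1 i

lemma measurableState_resilientRun {P : Measure W} (hreg : g.Regular) (hatt : AdmissibleAttack att)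
    {x1 : Fin N → Strat p} (hx1 : g.Feasible x1) (α : ℕ → ℝ) {S : ℕ → ℕ}
    {τ : Fin N → Fin (N + m) → ℕ → ℕ → W → ℝ} {E : Fin N → Fin (N + m) → ℝ}
    (hτ : TrustAssumption P D S τ E) (n : ℕ) :
    MeasurableState g D fun ω =>
      resilientRun g D x1 (att ω) α S (fun i j k l => τ i j k l ω) n := by
  induction n with
  | zero =>
    exact ⟨fun _ => measurable_const, fun _ _ => measurable_const, fun _ => measurable_const,
      fun _ _ _ => measurable_const, fun i T => MeasurableSet.const (inNbr D i = T),
      fun _ => measurable_const, fun _ _ => measurable_const, fun _ => hx1⟩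
  | succ n ih =>
    exact ih.step hreg hatt hx1 (n + 1) (α (n + 1)) (S (n + 1))
      fun i j hj l hl => hτ.meas i j hj (n + 1) l (Nat.succ_pos n) hl

lemma measurable_sqError {P : Measure W} (hreg : g.Regular) (hatt : AdmissibleAttack att)
    {x1 : Fin N → Strat p} (hx1 : g.Feasible x1) (α : ℕ → ℝ) {S : ℕ → ℕ}
    {τ : Fin N → Fin (N + m) → ℕ → ℕ → W → ℝ} {E : Fin N → Fin (N + m) → ℝ}
    (hτ : TrustAssumption P D S τ E) (xs : Profile N p) (n : ℕ) :
    Measurable fun ω => sqError g D x1 (att ω) α S (fun i j k l => τ i j k l ω) xs n := by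
  have h := (measurableState_resilientRun hreg hatt hx1 α hτ n).x
  have e : ∀ ω, sqError g D x1 (att ω) α S (fun i j k l => τ i j k l ω) xs n
      = ∑ i, ‖(resilientRun g D x1 (att ω) α S (fun i j k l => τ i j k l ω) n).x i - xs i‖ ^ 2 :=
    fun ω => PiLp.norm_sq_eq_of_L2 _ _
  simp only [e]
  exact Finset.measurable_sum _ fun i _ => (((h i).sub_const (xs i)).norm).pow_const 2

end Measurability

/-! ### From almost sure bounds to bounds of the expectation -/

section Expectation

variable {W : Type*} [MeasurableSpace W] {P : Measure W} [IsProbabilityMeasure P]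

lemma integrable_of_mem_Icc {f : W → ℝ} {R : ℝ} (hm : Measurable f)
    (hf : ∀ ω, f ω ∈ Set.Icc 0 R) : Integrable f P :=
  Integrable.of_mem_Icc 0 R hm.aemeasurable (ae_of_all P hf)

/-- The excess `max (f n ω - L) 0` is bounded by `R` and tends to 0 almost surely, although `f n`
need not converge. -/
lemma eventually_integral_le {f : ℕ → W → ℝ} {R L : ℝ} (hm : ∀ n, Measurable (f n))
    (hf : ∀ n ω, f n ω ∈ Set.Icc 0 R) (hL : 0 ≤ L)
    (h : ∀ᵐ ω ∂P, ∀ ε, 0 < ε → ∀ᶠ n in atTop, f n ω ≤ L + ε) {ε : ℝ} (hε : 0 < ε) :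
    ∀ᶠ n in atTop, ∫ ω, f n ω ∂P ≤ L + ε := by
  have hm' : ∀ n, Measurable fun ω => max (f n ω - L) 0 := fun n =>
    ((hm n).sub_const L).max measurable_const
  have hR : ∀ n ω, max (f n ω - L) 0 ∈ Set.Icc 0 R := fun n ω =>
    ⟨le_max_right _ _, max_le (by linarith [(hf n ω).2]) ((hf n ω).1.trans (hf n ω).2)⟩
  have hlim : Tendsto (fun n => ∫ ω, max (f n ω - L) 0 ∂P) atTop (𝓝 (∫ _ω, (0 : ℝ) ∂P)) := by
    refine tendsto_integral_of_dominated_convergence (fun _ => R)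
      (fun n => (hm' n).aestronglyMeasurable) (integrable_const R) (fun n => ae_of_all P fun ω => ?_)
      ?_
    · rw [Real.norm_of_nonneg (hR n ω).1]
      exact (hR n ω).2
    · filter_upwards [h] with ω hω
      rw [Metric.tendsto_atTop]
      intro δ hδ
      obtain ⟨K, hK⟩ := eventually_atTop.mp (hω (δ / 2) (half_pos hδ))
      refine ⟨K, fun n hn => ?_⟩
      rw [Real.dist_eq, sub_zero, abs_of_nonneg (hR n ω).1]
      exact max_lt (by linarith [hK n hn]) hδ
  rw [integral_zero] at hlim
  filter_upwards [hlim.eventually (eventually_le_nhds hε)] with n hn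
  have h1 : ∫ ω, f n ω ∂P ≤ ∫ ω, (L + max (f n ω - L) 0) ∂P :=
    integral_mono (integrable_of_mem_Icc (hm n) (hf n))
      ((integrable_const L).add (integrable_of_mem_Icc (hm' n) (hR n)))
      fun ω => by linarith [le_max_left (f n ω - L) 0]
  rw [integral_add (integrable_const L) (integrable_of_mem_Icc (hm' n) (hR n))] at h1
  simp only [integral_const, probReal_univ, one_smul] at h1
  linarith

lemma limsup_integral_le {f : ℕ → W → ℝ} {R L : ℝ} (hm : ∀ n, Measurable (f n))
    (hf : ∀ n ω, f n ω ∈ Set.Icc 0 R) (hL : 0 ≤ L)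
    (h : ∀ᵐ ω ∂P, ∀ ε, 0 < ε → ∀ᶠ n in atTop, f n ω ≤ L + ε) :
    limsup (fun n => ∫ ω, f n ω ∂P) atTop ≤ L := by
  refine le_of_forall_pos_le_add fun ε hε => ?_
  refine limsup_le_of_le ?_ (eventually_integral_le hm hf hL h hε)
  -- The lower bound 0 on the integrals excludes the default value of a real `limsup`.
  exact isCoboundedUnder_le_of_eventually_le (x := 0) atTop
    (Eventually.of_forall fun n => integral_nonneg fun ω => (hf n ω).1)

lemma tendsto_integral_zero {f : ℕ → W → ℝ} {R : ℝ} (hm : ∀ n, Measurable (f n))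
    (hf : ∀ n ω, f n ω ∈ Set.Icc 0 R)
    (h : ∀ᵐ ω ∂P, Tendsto (fun n => f n ω) atTop (𝓝 0)) :
    Tendsto (fun n => ∫ ω, f n ω ∂P) atTop (𝓝 0) := by
  have := tendsto_integral_of_dominated_convergence (μ := P) (F := f) (f := fun _ => 0)
    (fun _ => R) (fun n => (hm n).aestronglyMeasurable) (integrable_const R)
    (fun n => ae_of_all P fun ω => by
      rw [Real.norm_of_nonneg (hf n ω).1]
      exact (hf n ω).2) h
  simpa using this

end Expectation

lemma TrustAssumption.Emin_pos {W : Type*} [MeasurableSpace W] {P : Measure W}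
    {D : Digraph (Fin (N + m))} {S : ℕ → ℕ} {τ : Fin N → Fin (N + m) → ℕ → ℕ → W → ℝ}
    {E : Fin N → Fin (N + m) → ℝ} (hτ : TrustAssumption P D S τ E) (hN : 0 < N) :
    0 < Emin D E := by
  have : Nonempty {q : Fin N × Fin (N + m) // q.2 ∈ inNbr D q.1} :=
    ⟨⟨(⟨0, hN⟩, Fin.castAdd m ⟨0, hN⟩), mem_inNbr.mpr (Or.inr rfl)⟩⟩
  obtain ⟨⟨⟨i, j⟩, hj⟩, hq⟩ := exists_eq_ciInf_of_finite
    (f := fun q : {q : Fin N × Fin (N + m) // q.2 ∈ inNbr D q.1} => |E q.1.1 q.1.2|)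
  rw [Emin, ← hq]
  refine abs_pos.mpr ?_
  induction j using Fin.addCases with
  | left j => exact (hτ.legit i j hj).ne'
  | right j => exact (hτ.malicious i j hj).ne

/-- The additional factor is at least 1 because `1 - exp (-2E²) ≤ 1 ≤ exp (2E²)`. -/
lemma le_mul_exp_div {c lam E : ℝ} (hc : 0 ≤ c) (hlam : lam < 1) (hE : 0 < E) :
    c / (1 - lam) ≤ c * Real.exp (2 * E ^ 2) / ((1 - lam) * (1 - Real.exp (-2 * E ^ 2))) := by
  have h1 : 0 < 1 - lam := sub_pos.mpr hlam
  have h2 : 0 < 1 - Real.exp (-2 * E ^ 2) := by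
    rw [sub_pos, Real.exp_lt_one_iff]
    nlinarith
  have h3 : 1 ≤ Real.exp (2 * E ^ 2) := Real.one_le_exp (by positivity)
  have h4 := Real.exp_pos (-2 * E ^ 2)
  rw [div_le_div_iff₀ h1 (mul_pos h1 h2)]
  have h5 : 1 - Real.exp (-2 * E ^ 2) ≤ Real.exp (2 * E ^ 2) := by linarith
  calc c * ((1 - lam) * (1 - Real.exp (-2 * E ^ 2)))
      ≤ c * ((1 - lam) * Real.exp (2 * E ^ 2)) := by gcongr
    _ = _ := by ring

/-! ### Diminishing step-sizes -/

lemma tendsto_shifted_rpow {r : ℝ} (hr : 0 < r) (K : ℕ) :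
    Tendsto (fun n : ℕ => 1 / (((K + n + 1 : ℕ) : ℝ) + 1) ^ r) atTop (𝓝 0) := by
  simp only [one_div]
  refine (tendsto_rpow_atTop hr).comp ?_ |>.inv_tendsto_atTop
  refine tendsto_atTop_mono (fun n => ?_) (tendsto_natCast_atTop_atTop (R := ℝ))
  push_cast
  linarith [Nat.cast_nonneg (α := ℝ) K]

lemma tendsto_sum_shifted_rpow {r : ℝ} (hr : r < 1) (K : ℕ) :
    Tendsto (fun n => ∑ i ∈ Finset.range n, 1 / (((K + i + 1 : ℕ) : ℝ) + 1) ^ r) atTop atTop := by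
  refine (not_summable_iff_tendsto_nat_atTop_of_nonneg fun n => by positivity).mp ?_
  have h : ¬ Summable fun n : ℕ => 1 / (n : ℝ) ^ r := by
    rw [Real.summable_one_div_nat_rpow]
    exact not_lt.mpr hr.le
  rw [← summable_nat_add_iff (K + 2)] at h
  have e : ∀ n : ℕ, ((n + (K + 2) : ℕ) : ℝ) = ((K + n + 1 : ℕ) : ℝ) + 1 := by
    intro n
    push_cast
    ring
  simpa only [e] using h

/-! ### The resilient algorithm -/

section Resilient

variable {g : Game N p} {D : Digraph (Fin (N + m))} {x1 : Fin N → Strat p} {att : Attack N m}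
  {S : ℕ → ℕ} {τ : Fin N → Fin (N + m) → ℕ → ℕ → ℝ} {μ L₂ L₃ : ℝ} {xs : Profile N p}

/-- The restart index depends on the sample path, but constant parameters make the restarted run the
same `fastRun` on every path. Bounds `Mt` and `M` for this one run therefore suffice. -/
lemma eventually_sqError_le (hN : 0 < N) (hconn : LegitStronglyConnected D) (hreg : g.Regular)
    (hL₂ : 0 ≤ L₂) (hL₃ : 0 ≤ L₃) (hmono : g.StronglyMonotone μ)
    (hlip : g.LipschitzConsts L₂ L₃) (hxs : g.IsNash xs) (hx1 : g.Feasible x1)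
    (hatt : ∀ i j k h, 1 ≤ k → att.mark i j k h ≤ k) {α : ℝ} (hα : 0 ≤ α) {S₀ : ℕ}
    (hS₀ : 1 ≤ S₀) (hS : ∀ k, 1 ≤ k → S k = S₀)
    (hlam : lamMax (Gam (weightMatrix D) μ L₂ α S₀) < 1)
    (hclass : ∀ᶠ n in atTop, Classified D (resilientRun g D x1 att (fun _ => α) S τ n))
    {Mt M : ℝ} (hMt : IsTrackingBound g (weightMatrix D) α S₀ x1 Mt)
    (hM : IsGradBound g (weightMatrix D) α S₀ x1 M) {ε : ℝ} (hε : 0 < ε) :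
    ∀ᶠ n in atTop, sqError g D x1 att (fun _ => α) S τ xs n
      ≤ D3 (weightMatrix D) L₃ α S₀ Mt M / (1 - lamMax (Gam (weightMatrix D) μ L₂ α S₀)) + ε := by
  obtain ⟨K, hK⟩ := exists_resilientRun_eq_varRun hN hconn hatt hclass
  have hS' : ∀ n, S (K + n + 1) = S₀ := fun n => hS _ (Nat.succ_pos _)
  simp only [hS', ← fastRun_eq_varRun] at hK
  obtain ⟨n₀, hn₀⟩ := eventually_atTop.mp (eventually_fastRun_le hN
    (isPrimitiveStochastic_weightMatrix hconn) hreg hL₂ hL₃ hmono hlip hxs hx1 hα hS₀ hlam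
    hMt hM hε)
  filter_upwards [eventually_ge_atTop (K + n₀)] with n hn
  obtain ⟨d, rfl⟩ := Nat.exists_eq_add_of_le (show K ≤ n by omega)
  rw [sqError, hK]
  exact hn₀ d (by omega)

lemma tendsto_sqError (hN : 0 < N) (hconn : LegitStronglyConnected D) (hreg : g.Regular)
    (hμ : 0 < μ) (hL₃ : 0 ≤ L₃) (hmono : g.StronglyMonotone μ)
    (hlip : g.LipschitzConsts L₂ L₃) (hxs : g.IsNash xs) (hx1 : g.Feasible x1)
    (hatt : ∀ i j k h, 1 ≤ k → att.mark i j k h ≤ k) (hS : ∀ k, 1 ≤ k → 1 ≤ S k)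
    {r : ℝ} (hr0 : 0 < r) (hr1 : r < 1)
    (hclass : ∀ᶠ n in atTop, Classified D
      (resilientRun g D x1 att (fun k => 1 / ((k : ℝ) + 1) ^ r) S τ n)) :
    Tendsto (fun n => sqError g D x1 att (fun k => 1 / ((k : ℝ) + 1) ^ r) S τ xs n) atTop
      (𝓝 0) := by
  obtain ⟨K, hK⟩ := exists_resilientRun_eq_varRun hN hconn hatt hclass
  rw [← tendsto_add_atTop_iff_nat K]
  have h := tendsto_varRun (isPrimitiveStochastic_weightMatrix hconn) hreg hμ hL₃ hmono hlip hxs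
    hx1 (S := fun n => S (K + n + 1)) (fun n => hS _ (Nat.succ_pos _))
    (fun n => by positivity) (tendsto_shifted_rpow hr0 K) (tendsto_sum_shifted_rpow hr1 K)
  refine h.congr fun n => ?_
  rw [sqError, add_comm n K, hK]

end Resilient

end AggGame

open AggGame in
theorem theorem3 {N m p : ℕ} (hN : 0 < N)
    {W : Type*} [MeasurableSpace W] (P : Measure W) [IsProbabilityMeasure P]
    (g : Game N p) (D : Digraph (Fin (N + m))) (μ L₂ L₃ : ℝ)
    (hμ : 0 < μ) (hL₂ : 0 < L₂) (hL₃ : 0 < L₃)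
    (hreg : g.Regular) (hmono : g.StronglyMonotone μ) (hlip : g.LipschitzConsts L₂ L₃)
    (hconn : LegitStronglyConnected D)
    (xs : Profile N p) (hxs : g.IsNash xs)
    (x1 : Fin N → Strat p) (hx1 : g.Feasible x1)
    (att : W → Attack N m) (hatt : AdmissibleAttack att)
    (S : ℕ → ℕ) (hS : ∀ k, 1 ≤ k → 1 ≤ S k)
    (τ : Fin N → Fin (N + m) → ℕ → ℕ → W → ℝ) (E : Fin N → Fin (N + m) → ℝ)
    (hτ : TrustAssumption P D S τ E) :
    -- constant step-size and number of rounds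
    (∀ (α : ℝ) (S₀ : ℕ), 0 < α → (∀ k, 1 ≤ k → S k = S₀) →
      lamMax (Gam (weightMatrix D) μ L₂ α S₀) < 1 →
      let err : ℕ → W → ℝ := fun n ω =>
        sqError g D x1 (att ω) (fun _ => α) S (fun i j k l => τ i j k l ω) xs n
      (∀ n, Integrable (err n) P) ∧
      BddAbove (Set.range fun n => ∫ ω, err n ω ∂P) ∧
      (∃ Mt, IsTrackingBound g (weightMatrix D) α S₀ x1 Mt) ∧
      (∃ M, IsGradBound g (weightMatrix D) α S₀ x1 M) ∧
      ∀ Mt M, IsTrackingBound g (weightMatrix D) α S₀ x1 Mt →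
        IsGradBound g (weightMatrix D) α S₀ x1 M →
        limsup (fun n => ∫ ω, err n ω ∂P) atTop ≤
          D3 (weightMatrix D) L₃ α S₀ Mt M * Real.exp (2 * Emin D E ^ 2) /
            ((1 - lamMax (Gam (weightMatrix D) μ L₂ α S₀)) *
              (1 - Real.exp (-2 * Emin D E ^ 2)))) ∧
    -- diminishing step-size
    (∀ r : ℝ, 1 / 2 < r → r < 1 →
      (∀ k, 1 ≤ k →
        Real.log (1 / 2) / (2 * Real.log (rho1 (weightMatrix D))) ≤ (S k : ℝ)) →
      let err : ℕ → W → ℝ := fun n ω =>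
        sqError g D x1 (att ω) (fun k => 1 / ((k : ℝ) + 1) ^ r) S
          (fun i j k l => τ i j k l ω) xs n
      (∀ n, Integrable (err n) P) ∧
      Tendsto (fun n => ∫ ω, err n ω ∂P) atTop (𝓝 0)) := by
  have hA := isPrimitiveStochastic_weightMatrix hconn
  obtain ⟨R, hR0, hR⟩ := Game.exists_dist_bound hreg xs
  -- The iterates never leave the compact set `Ω`, even before the classification has settled. This
  -- uniform bound gives integrability and the domination.
  have hmem : ∀ (α : ℕ → ℝ) n ω,
      sqError g D x1 (att ω) α S (fun i j k l => τ i j k l ω) xs n ∈ Set.Icc 0 (R ^ 2) :=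
    fun α n ω => ⟨sq_nonneg _, pow_le_pow_left₀ (norm_nonneg _)
      (hR _ ((measurableState_resilientRun hreg hatt hx1 α hτ n).feasible ω)) 2⟩
  have hmeas := fun α => measurable_sqError hreg hatt hx1 α hτ xs
  have hclass := fun α => hτ.ae_eventually_classified hS g x1 att α
  refine ⟨fun α S₀ hα hS₀ hlam => ?_, fun r hr hr1 _ => ?_⟩
  · have h1 : 1 ≤ S₀ := hS₀ 1 le_rfl ▸ hS 1 le_rfl
    refine ⟨fun n => integrable_of_mem_Icc (hmeas _ n) (hmem _ n), ⟨R ^ 2, ?_⟩,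
      exists_isTrackingBound hA hreg hx1 α h1, exists_isGradBound hA hreg hx1 α h1,
      fun Mt M hMt hM => ?_⟩
    · rintro _ ⟨n, rfl⟩
      refine (integral_mono (integrable_of_mem_Icc (hmeas _ n) (hmem _ n))
        (integrable_const (R ^ 2)) fun ω => (hmem _ n ω).2).trans ?_
      simp
    · have hD := D3_nonneg hA hL₃.le hα.le hMt.nonneg hM.nonneg (S := S₀)
      refine (limsup_integral_le (hmeas _) (hmem _)
        (div_nonneg hD (sub_nonneg.mpr hlam.le)) ?_).trans
        (le_mul_exp_div hD hlam (hτ.Emin_pos hN))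
      filter_upwards [hclass fun _ => α] with ω hω ε hε
      exact eventually_sqError_le hN hconn hreg hL₂.le hL₃.le hmono hlip hxs hx1
        (hatt.mark_le ω) hα.le h1 hS₀ hlam hω hMt hM hε
  · refine ⟨fun n => integrable_of_mem_Icc (hmeas _ n) (hmem _ n),
      tendsto_integral_zero (hmeas _) (hmem _) ?_⟩
    filter_upwards [hclass fun k => 1 / ((k : ℝ) + 1) ^ r] with ω hω
    exact tendsto_sqError hN hconn hreg hμ hL₃.le hmono hlip hxs hx1 (hatt.mark_le ω) hS
      (by linarith) hr1 hω
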